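/- **Setting.** Let $n\ge 1$, $\chi=8(n+2)$, and let $\mathbb{HP}^n=\mathrm U(n+1,\mathbb H)/(\mathrm U(1,\mathbb H)\times \mathrm U(n,\mathbb H))$ (the unit sphere of $\mathbb H^{n+1}$ modulo $\mathrm U(1,\mathbb H)$) carry the invariant Riemannian metric $g$ and Levi-Civita connection $\nabla$. Write $\mathfrak g=\mathfrak u(n+1,\mathbb H)=\mathfrak h\oplus\mathfrak m$ for the symmetric decomposition, with $\mathfrak h=\mathfrak u(1,\mathbb H)\oplus\mathfrak u(n,\mathbb H)$ and Cartan-Killing form $\langle X,Y\rangle=4(n+2)\,\mathrm{Re}\,\mathrm{tr}(XY)$; the metric is $g(X,Y)=-\langle e_X,e_Y\rangle$ in any $\mathfrak m$-valued coframe $e$. Elements of $\mathfrak m$ are matrices $$(a,\mathbf b)=\begin{pmatrix}0&a&\mathbf b\\-\bar a&0&0\\-\bar{\mathbf b}^{t}&0&0\end{pmatrix},\qquad a\in\mathbb H,\ \mathbf b\in\mathbb H^{n-1}.$$ Let $e_x=\chi^{-1/2}(1,\mathbf 0)$, let $\mathfrak m_\parallel=\mathbb R e_x$ and $\mathfrak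 h_\parallel$ be the centralizers of $e_x$ in $\mathfrak m$ and $\mathfrak h$, and let $\mathfrak m_\perp,\mathfrak h_\perp$ be their orthogonal complements. Then $\mathrm{ad}(e_x)$ maps $\mathfrak m_\perp$ and $\mathfrak h_\perp$ isomorphically onto each other, and $\mathfrak h_\perp\simeq \mathrm{Im}\,\mathbb H\oplus\mathbb H^{n-1}$ via $$(\mathrm u,\mathbf u)=\begin{pmatrix}\mathrm u&0&0\\0&-\mathrm u&\mathbf u\\0&-\bar{\mathbf u}^{t}&0\end{pmatrix},$$ on which $(a,A)\in \mathrm U(1,\mathbb H)\times \mathrm U(n-1,\mathbb H)$ acts by $(\mathrm u,\mathbf u)\mapsto(a\mathrm u a^{-1},a\mathbf uA)$. A moving frame along a curve or surface $\gamma$ is a lift $\psi$ of $\gamma$ to $\mathrm U(n+1,\mathbb H)$; $\psi^{-1}d\psi=e+\omega$ gives the $\mathfrak m$-valued coframe $e$ and the $\mathfrak h$-valued connection $\omega$; $e^*$ denotes the dual frame, $-\langle e^*,e\rangle=\mathrm{id}$. A frame along an arclength-parametrized curve $\gamma(x)$ is *parallel with covariants* $u=(\mathrm u,\mathbf u)$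 if $e\rfloor\gamma_x=e_x$ and $\omega_x=u\in\mathfrak h_\perp$. Let $x$ range over an open interval $I$. An *equivariant flow* is a smooth $\mathfrak h_\perp$-valued function $h^\perp(x,u,u_x,\dots,\partial_x^ku)$, $x\in I$, with $h^\perp(x,\mathrm{Ad}(a)u,\mathrm{Ad}(a)u_x,\dots)=\mathrm{Ad}(a)h^\perp(x,u,u_x,\dots)$ for all $a\in \mathrm U(1,\mathbb H)\times \mathrm U(n-1,\mathbb H)$. Put $$\mathcal Y(h^\perp)=D_x^{-1}[u,\mathrm{ad}(e_x)^{-1}h^\perp]_\parallel-\mathrm{ad}(e_x)^{-1}h^\perp,$$ $$h_\perp=\chi^{-1}\mathrm{ad}(e_x)^{-1}h^\perp,\qquad h_\parallel=-D_x^{-1}[u,h_\perp]_\parallel .$$ Here $D_x^{-1}$ is a formal inverse of $D_x$: the term $D_x^{-1}[u,\mathrm{ad}(e_x)^{-1}h^\perp]_\parallel$ is a primitive of $[u,\mathrm{ad}(e_x)^{-1}h^\perp]_\parallel$ selected for each smooth $u:I\to\mathfrak h_\perp$, the same for $u$ and $\mathrm{Ad}(a)u$ (for constant $a$), and $h_\parallel$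 is $-\chi^{-1}$ times it. The corresponding evolution of the covariants is $$u_t=D_x\varpi^\perp+[u,\varpi^\parallel]+[u,\varpi^\perp]_\perp+\chi^{-1}h^\perp,\qquad \varpi^\parallel=-D_x^{-1}[u,\varpi^\perp]_\parallel,$$ $$\varpi^\perp=-\mathrm{ad}(e_x)^{-1}\big(D_xh_\perp+[u,h_\parallel]+[u,h_\perp]_\perp\big),$$ where $\varpi^\parallel$ may be any $\mathfrak h_\parallel$-valued primitive, and a solution is understood to be smooth on $J\times I$ ($J$ an open $t$-interval) together with its nonlocal terms. **Proposition.** Let $h^\perp$ be an equivariant flow, with any choice of $D_x^{-1}[u,\mathrm{ad}(e_x)^{-1}h^\perp]_\parallel$ as above. 1. Every smooth arclength-parametrized curve $\gamma:I\to\mathbb{HP}^n$ has a parallel frame, and the vector field $$Y[\gamma]=\chi^{-1}\langle e^*,\mathcal Y(h^\perp)\rangle$$ along $\gamma$ is the same for all parallel frames of $\gamma$. It is smooth, tangent to $\mathbb{HP}^n$, and non-stretching: $g(\nabla_xY,\gamma_x)=0$. 2. The evolution equation $\gamma_t=Y[\gamma]$ is $\mathrm U(n+1,\mathbb H)$-invariant: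 $Y[\mathsf g\gamma]=\mathsf g_*Y[\gamma]$ for all $\mathsf g\in \mathrm U(n+1,\mathbb H)$. 3. $Y$ is a function of $(x,\gamma_x,\nabla_x\gamma_x,\nabla_x^2\gamma_x,\dots)$ in the following sense: there are $\mathrm U(n+1,\mathbb H)$-equivariant, respectively invariant, functions $N$ and $f$ of $(x,\gamma,\gamma_x,\dots,\nabla_x^{k+1}\gamma_x)$, independent of $\gamma$, with $Y=N+c\,\gamma_x$, $N\perp\gamma_x$ and $c=D_x^{-1}f$, i.e. $D_xc=f$. If the term $D_x^{-1}[u,\mathrm{ad}(e_x)^{-1}h^\perp]_\parallel$ is a function of $(x,u,u_x,\dots,\partial_x^lu)$ for some $l$, then $Y=G(x,\gamma,\gamma_x,\dots,\nabla_x^{k'}\gamma_x)$ for some $k'$ and some $\mathrm U(n+1,\mathbb H)$-equivariant function $G$. 4. Every solution $u(t,x)$ of the evolution of the covariants on $J\times I$ determines a non-stretching curve flow: there is a smooth $\gamma:J\times I\to\mathbb{HP}^n$ with $|\gamma_x|=1$ and a smooth framing of it which is parallel with covariants $u(t,\cdot)$ at each $t$ and has $e\rfloor\gamma_t=h_\perp+h_\parallel$,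 $\omega_t=\varpi^\perp+\varpi^\parallel$. Every such $\gamma$ satisfies $\gamma_t=Y[\gamma(t,\cdot)]$, and any two differ by an element of $\mathrm U(n+1,\mathbb H)$. -/

import Mathlib

open scoped ContDiff
open Set

namespace QuatCurve

noncomputable section

/-! ### Quaternionic linear algebra.  Throughout `n = m + 1`, so that `n - 1 = m`. -/

/-- Hamilton's quaternions. -/
abbrev Quat := Quaternion ℝ

instance : StarModule ℝ Quat := ⟨fun r q => by simp [Quaternion.star_smul]⟩

/-- Quaternionic matrices of size `n + 1 = m + 2`. -/
abbrev Mat (m : ℕ) := Matrix (Fin (m + 2)) (Fin (m + 2)) Quat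

/-- The imaginary quaternions, i.e. those with `q + q̄ = 0`. -/
abbrev ImQuat := skewAdjoint.submodule ℝ Quat

/-- The Lie algebra `𝔲(n-1, ℍ)` of skew-Hermitian quaternionic matrices. -/
abbrev UAlg (m : ℕ) := skewAdjoint.submodule ℝ (Matrix (Fin m) (Fin m) Quat)

/-- Scalar-vector pairs in `Im ℍ ⊕ ℍⁿ⁻¹`: the covariants `(u, 𝐮)` and the flow variables
`(h^⊥, 𝐡^⊥)`. -/
abbrev Cov (m : ℕ) := ImQuat × (Fin m → Quat)

/-- The group `U(n+1, ℍ)`. -/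
abbrev UGroup (m : ℕ) := unitary (Mat m)

/-- The normalisation constant `χ = 8 (n + 2)`. -/
def chi (m : ℕ) : ℝ := 8 * (((m : ℝ) + 1) + 2)

/-- The Cartan-Killing form of `𝔲(n+1, ℍ)`, `⟨X, Y⟩ = 4 (n + 2) Re tr (X Y)`. -/
def killing {m : ℕ} (X Y : Mat m) : ℝ := 4 * (((m : ℝ) + 1) + 2) * (Matrix.trace (X * Y)).re

/-- The element `(a, 𝐛)` of `𝔪`, with rows `(0, a, 𝐛)`, `(-ā, 0, 0)`, `(-𝐛̄ᵗ, 0, 0)`. -/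
def mMat {m : ℕ} (a : Quat) (b : Fin m → Quat) : Mat m :=
  Matrix.of (Fin.cons (Fin.cons 0 (Fin.cons a b))
    (Fin.cons (Fin.cons (-star a) (Fin.cons 0 0))
      (fun l => Fin.cons (-star (b l)) (Fin.cons 0 0))))

/-- The element `(p, q, 𝐡, 𝐇)` of `𝔥`, with rows `(p, 0, 0)`, `(0, q, 𝐡)`, `(0, -𝐡̄ᵗ, 𝐇)`. -/
def hMat {m : ℕ} (p q : Quat) (h : Fin m → Quat) (H : Matrix (Fin m) (Fin m) Quat) : Mat m :=
  Matrix.of (Fin.cons (Fin.cons p (Fin.cons 0 0))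
    (Fin.cons (Fin.cons 0 (Fin.cons q h))
      (fun l => Fin.cons 0 (Fin.cons (-star (h l)) (H l)))))

/-- The element of `𝔥_⊥` with components `(u, 𝐮)`, i.e. `(u, -u, 𝐮, 0)`. -/
def perpMat {m : ℕ} (v : Cov m) : Mat m := hMat (v.1 : Quat) (-(v.1 : Quat)) v.2 0

/-- The element of `𝔥_∥` with components `(w, 𝐖)`, i.e. `(w, w, 0, 𝐖)`. -/
def parMat {m : ℕ} (w : ImQuat × UAlg m) : Mat m :=
  hMat (w.1 : Quat) (w.1 : Quat) 0 (w.2 : Matrix (Fin m) (Fin m) Quat)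

/-- The fixed unit-norm element `e_x = χ^{-1/2} (1, 𝟎)` of `𝔪_∥`. -/
def ex (m : ℕ) : Mat m := (Real.sqrt (chi m))⁻¹ • mMat 1 0

/-- For `X = (a, 𝐛) ∈ 𝔪`, the real number `Re a`; the projection of `X` to
`𝔪_∥ = ℝ (1, 𝟎)` is `mParCoeff X • (1, 𝟎)`. -/
def mParCoeff {m : ℕ} (X : Mat m) : ℝ := (X 0 1).re

/-- The projection of `𝔪` to `𝔪_⊥`. -/
def mPerp {m : ℕ} (X : Mat m) : Mat m := X - mParCoeff X • mMat 1 0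

/-- The projection of `𝔥` to `𝔥_∥`: `(p, q, 𝐡, 𝐇)` is sent to
`((p + q) / 2, (p + q) / 2, 0, 𝐇)`. -/
def hPar {m : ℕ} (X : Mat m) : Mat m :=
  hMat ((1 / 2 : ℝ) • (X 0 0 + X 1 1)) ((1 / 2 : ℝ) • (X 0 0 + X 1 1)) 0
    (Matrix.of fun i j => X i.succ.succ j.succ.succ)

/-- The projection of `𝔥` to `𝔥_⊥`. -/
def hPerp {m : ℕ} (X : Mat m) : Mat m := X - hPar X

/-- The inverse of `ad(e_x) : 𝔪_⊥ → 𝔥_⊥`. -/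
def adInvH {m : ℕ} (v : Cov m) : Mat m :=
  Real.sqrt (chi m) • mMat ((1 / 2 : ℝ) • (v.1 : Quat)) (-v.2)

/-- The inverse of `ad(e_x) : 𝔥_⊥ → 𝔪_⊥`, applied to `X = (a, 𝐛) ∈ 𝔪_⊥`. -/
def adInvM {m : ℕ} (X : Mat m) : Mat m :=
  Real.sqrt (chi m) • hMat (-((1 / 2 : ℝ) • X 0 1)) ((1 / 2 : ℝ) • X 0 1)
    (fun l => X 0 l.succ.succ) 0

/-- Smoothness of a matrix-valued function. -/
def MSmoothOn {m : ℕ} {E : Type*} [NormedAddCommGroup E] [NormedSpace ℝ E] (A : E → Mat m)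
    (S : Set E) : Prop :=
  ∀ i j, ContDiffOn ℝ ∞ (fun p => A p i j) S

/-- The derivative of a matrix-valued function. -/
def mderiv {m : ℕ} (A : ℝ → Mat m) (x : ℝ) : Mat m :=
  Matrix.of fun i j => deriv (fun y => A y i j) x

/-- The matrix-valued function `A` is differentiable at `x` with derivative `A'`. -/
def MHasDerivAt {m : ℕ} (A : ℝ → Mat m) (A' : Mat m) (x : ℝ) : Prop :=
  ∀ i j, HasDerivAt (fun y => A y i j) (A' i j) x

/-- The action `(u, 𝐮) ↦ (a u a⁻¹, a 𝐮 A)` of `(a, A) ∈ U(1, ℍ) × U(n-1, ℍ)` on covariants. -/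
def act {m : ℕ} (a : unitary Quat) (A : unitary (Matrix (Fin m) (Fin m) Quat)) (v : Cov m) :
    Cov m :=
  (⟨(a : Quat) * v.1 * star (a : Quat), skewAdjoint.conjugate v.1.2 (a : Quat)⟩,
    Matrix.vecMul (fun i => (a : Quat) * v.2 i) (A : Matrix (Fin m) (Fin m) Quat))

theorem chi_pos (m : ℕ) : 0 < chi m := by unfold chi; positivity

/-- `adInvH` inverts `ad(e_x)` on `𝔥_⊥`. -/
theorem ad_adInvH {m : ℕ} (v : Cov m) : ⁅ex m, adInvH v⁆ = perpMat v := by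
  have hs : Real.sqrt (chi m) ≠ 0 := (Real.sqrt_pos.2 (chi_pos m)).ne'
  have hq : star (v.1 : Quat) = -(v.1 : Quat) := skewAdjoint.mem_iff.1 v.1.2
  have h2 : (2⁻¹ : ℝ) • (v.1 : Quat) + (2⁻¹ : ℝ) • (v.1 : Quat) = v.1 := by
    rw [← add_smul]; norm_num
  rw [ex, adInvH, Ring.lie_def, smul_mul_smul_comm, smul_mul_smul_comm, inv_mul_cancel₀ hs,
    mul_inv_cancel₀ hs, one_smul, one_smul]
  ext1 i j
  refine Fin.cases ?_ (fun i => ?_) i <;> refine Fin.cases ?_ (fun j => ?_) j <;>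
  (try refine Fin.cases ?_ (fun i => ?_) i) <;> (try refine Fin.cases ?_ (fun j => ?_) j) <;>
  simp [mMat, perpMat, hMat, Matrix.mul_apply, Fin.sum_univ_succ, hq, h2]
  rw [← neg_add', h2]

/-- `adInvM` inverts `ad(e_x)` on `𝔪_⊥`. -/
theorem ad_adInvM {m : ℕ} (a : ImQuat) (b : Fin m → Quat) :
    ⁅ex m, adInvM (mMat (a : Quat) b)⁆ = mMat (a : Quat) b := by
  have hs : Real.sqrt (chi m) ≠ 0 := (Real.sqrt_pos.2 (chi_pos m)).ne'
  have hq : star (a : Quat) = -(a : Quat) := skewAdjoint.mem_iff.1 a.2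
  have h2 : (2⁻¹ : ℝ) • (a : Quat) + (2⁻¹ : ℝ) • (a : Quat) = a := by
    rw [← add_smul]; norm_num
  rw [ex, adInvM, Ring.lie_def, smul_mul_smul_comm, smul_mul_smul_comm, inv_mul_cancel₀ hs,
    mul_inv_cancel₀ hs, one_smul, one_smul]
  ext1 i j
  refine Fin.cases ?_ (fun i => ?_) i <;> refine Fin.cases ?_ (fun j => ?_) j <;>
  (try refine Fin.cases ?_ (fun i => ?_) i) <;> (try refine Fin.cases ?_ (fun j => ?_) j) <;>
  simp [mMat, hMat, Matrix.mul_apply, Fin.sum_univ_succ, hq, h2]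

/-! ### The quaternionic projective space -/

/-- `ℍPⁿ`: the unit sphere of `ℍⁿ⁺¹` (columns) modulo `v ∼ v q`, `|q| = 1`, realised as the
submanifold of the Hermitian matrices formed by the projections `P = v v*`; compare
`vecMulVec_eq_iff`. -/
def HP (m : ℕ) : Set (Mat m) :=
  {P | ∃ v : Fin (m + 2) → Quat, ∑ i, ‖v i‖ ^ 2 = 1 ∧ P = Matrix.vecMulVec v (star v)}

/-- Two unit vectors give the same point iff they differ by a right factor in `U(1, ℍ)`. -/
theorem vecMulVec_eq_iff {m : ℕ} (v w : Fin (m + 2) → Quat) (hv : ∑ i, ‖v i‖ ^ 2 = 1)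
    (hw : ∑ i, ‖w i‖ ^ 2 = 1) :
    Matrix.vecMulVec v (star v) = Matrix.vecMulVec w (star w) ↔
      ∃ q ∈ unitary Quat, w = fun i => v i * q := by
  have key : ∀ z : Fin (m + 2) → Quat, ∑ i, ‖z i‖ ^ 2 = 1 → ∑ i, star (z i) * z i = 1 := by
    intro z hz
    have : ∀ i, star (z i) * z i = ((‖z i‖ ^ 2 : ℝ) : Quat) := by
      intro i
      rw [Quaternion.star_mul_self, Quaternion.normSq_eq_norm_mul_self, sq]
    simp_rw [this]
    have e := map_sum (algebraMap ℝ Quat) (fun i => ‖z i‖ ^ 2) Finset.univ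
    rw [hz, map_one] at e
    exact e.symm
  constructor
  · intro h
    have hij : ∀ i j, v i * star (v j) = w i * star (w j) := fun i j => by
      simpa [Matrix.vecMulVec_apply] using congrFun (congrFun h i) j
    have h1 : w = fun i => v i * ∑ j, star (v j) * w j := by
      funext i
      have : v i * ∑ j, star (v j) * w j = w i * ∑ j, star (w j) * w j := by
        rw [Finset.mul_sum, Finset.mul_sum]
        refine Finset.sum_congr rfl fun j _ => ?_
        rw [← mul_assoc, hij, mul_assoc]
      rw [this, key w hw, mul_one]
    refine ⟨∑ j, star (v j) * w j, ?_, h1⟩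
    set q := ∑ j, star (v j) * w j with hq
    have h2 : star q * q = 1 := by
      have e : ∑ i, star (w i) * w i = star q * (∑ i, star (v i) * v i) * q := by
        rw [Finset.mul_sum (s := Finset.univ) (f := fun i => star (v i) * v i), Finset.sum_mul]
        refine Finset.sum_congr rfl fun i _ => ?_
        have hi : w i = v i * q := congrFun h1 i
        rw [hi, star_mul]
        simp only [mul_assoc]
      rw [key w hw, key v hv, mul_one] at e
      exact e.symm
    exact Unitary.mem_iff.2 ⟨h2, mul_eq_one_comm.1 h2⟩
  · rintro ⟨q, hq, rfl⟩
    ext1 i j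
    have := (Unitary.mem_iff.1 hq).2
    simp only [Matrix.vecMulVec_apply, Pi.star_apply, star_mul]
    rw [mul_assoc, ← mul_assoc q, this, one_mul]

/-- The origin `o = [1 : 0 : ⋯ : 0]`. -/
def origin (m : ℕ) : Mat m := Matrix.single 0 0 1

/-- The tangent space of `ℍPⁿ` at `P`, as a space of Hermitian matrices. -/
def tangent {m : ℕ} (P : Mat m) : Set (Mat m) := {Z | star Z = Z ∧ P * Z + Z * P = Z}

/-- The `U(n+1, ℍ)`-invariant Riemannian metric, normalised by the Cartan-Killing form as in
`metric_eq_killing`. -/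
def metric {m : ℕ} (Z W : Mat m) : ℝ := 4 * (((m : ℝ) + 1) + 2) * (Matrix.trace (Z * W)).re

/-- The orthogonal projection of Hermitian matrices to the tangent space at `P`. -/
def tproj {m : ℕ} (P A : Mat m) : Mat m := P * A * (1 - P) + (1 - P) * A * P

/-- The Levi-Civita covariant derivative `∇_x Z` of a vector field along the curve `γ`: the
tangential part of the derivative in the ambient Euclidean space. -/
def covDeriv {m : ℕ} (γ Z : ℝ → Mat m) (x : ℝ) : Mat m := tproj (γ x) (mderiv Z x)

/-- `∇_x^i γ_x`. -/
def covIter {m : ℕ} (γ : ℝ → Mat m) : ℕ → ℝ → Mat m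
  | 0 => mderiv γ
  | i + 1 => covDeriv γ (covIter γ i)

/-- The tuple `(γ_x, ∇_x γ_x, …, ∇_x^k γ_x)` at `x`. -/
def curveJet {m : ℕ} (k : ℕ) (γ : ℝ → Mat m) (x : ℝ) : Fin (k + 1) → Mat m :=
  fun i => covIter γ (i : ℕ) x

/-- The action of `g ∈ U(n+1, ℍ)` on points and on tangent vectors of `ℍPⁿ`. -/
def uconj {m : ℕ} (g : UGroup m) (A : Mat m) : Mat m := (g : Mat m) * A * star (g : Mat m)

/-- A smooth curve in `ℍPⁿ` over the interval `I`, parametrised by arclength. -/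
structure IsUnitSpeed {m : ℕ} (I : Set ℝ) (γ : ℝ → Mat m) : Prop where
  mem : ∀ x ∈ I, γ x ∈ HP m
  smooth : MSmoothOn γ I
  unit : ∀ x ∈ I, metric (mderiv γ x) (mderiv γ x) = 1

/-! ### Frames

A moving frame along a curve (or surface) `γ` in `ℍPⁿ = U(n+1, ℍ) / (U(1, ℍ) × U(n, ℍ))` is given
by a lift `ψ` to `U(n+1, ℍ)`, `γ = ψ o ψ*`.  The pull-back `ψ⁻¹ dψ = e + ω` of the Maurer-Cartan
form is the sum of the `𝔪`-valued linear coframe `e` and the `𝔥`-valued linear connection `ω`. -/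

/-- The linear coframe `e : T_γ ℍPⁿ → 𝔪` at the point `ψ o ψ*`. -/
def coframe {m : ℕ} (ψ Z : Mat m) : Mat m := ⁅star ψ * Z * ψ, origin m⁆

/-- `⟨e*, X⟩` for `X ∈ 𝔪`, where `e*` is the frame dual to the coframe `e`: the map
`X ↦ -⟨e*, X⟩` is the inverse of `e`, see `pairing_coframe`. -/
def pairing {m : ℕ} (ψ X : Mat m) : Mat m := -(ψ * ⁅X, origin m⁆ * star ψ)

/-- The connection component `ω`, the projection to `𝔥` of `ψ⁻¹ ψ'`, from the value `ψ` and
the derivative `ψ'` of the lift. -/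
def connection {m : ℕ} (ψ ψ' : Mat m) : Mat m :=
  origin m * (star ψ * ψ') * origin m + (1 - origin m) * (star ψ * ψ') * (1 - origin m)

theorem origin_sq (m : ℕ) : origin m * origin m = origin m := by simp [origin]

theorem star_origin (m : ℕ) : star (origin m) = origin m := by
  simp [origin, Matrix.star_eq_conjTranspose]

/-- The pull-back of a tangent vector at `ψ o ψ*` to the origin. -/
theorem tangent_pull {m : ℕ} (ψ : UGroup m) (Z : Mat m)
    (hZ : Z ∈ tangent (uconj ψ (origin m))) :
    Z = (ψ : Mat m) * (star (ψ : Mat m) * Z * ψ) * star (ψ : Mat m) ∧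
    origin m * (star (ψ : Mat m) * Z * ψ) + (star (ψ : Mat m) * Z * ψ) * origin m
      = star (ψ : Mat m) * Z * ψ ∧
    origin m * (star (ψ : Mat m) * Z * ψ) * origin m = 0 := by
  obtain ⟨ψ, hψ⟩ := ψ
  have h1 : star ψ * ψ = 1 := (Unitary.mem_iff.1 hψ).1
  have h2 : ψ * star ψ = 1 := (Unitary.mem_iff.1 hψ).2
  have hT := hZ.2
  simp only [uconj] at hT
  have o2 := origin_sq m
  set o := origin m
  have hWo : o * (star ψ * Z * ψ) + (star ψ * Z * ψ) * o = star ψ * Z * ψ := by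
    have := congrArg (fun A => star ψ * A * ψ) hT
    simp only [mul_add, add_mul] at this
    convert this using 2
    · simp only [← mul_assoc, h1, one_mul]
    · simp only [mul_assoc, h1, mul_one]
  refine ⟨?_, hWo, ?_⟩
  · simp only [← mul_assoc, h2, one_mul]
    rw [mul_assoc, h2, mul_one]
  · have := congrArg (fun A => o * A) hWo
    simp only [mul_add, ← mul_assoc, o2] at this
    simpa only [← mul_assoc, add_eq_left] using this

/-- `-⟨e*, e⟩` is the identity of the tangent space. -/
theorem pairing_coframe {m : ℕ} (ψ : UGroup m) (Z : Mat m)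
    (hZ : Z ∈ tangent (uconj ψ (origin m))) : -pairing (ψ : Mat m) (coframe ψ Z) = Z := by
  obtain ⟨hZW, hWo, hoWo⟩ := tangent_pull ψ Z hZ
  have o2 := origin_sq m
  simp only [pairing, coframe, neg_neg, Ring.lie_def]
  set o := origin m
  set W := star (ψ : Mat m) * Z * ψ
  have e : (W * o - o * W) * o - o * (W * o - o * W)
      = (o * W + W * o) + W * (o * o - o) + (o * o - o) * W - 2 * (o * W * o) := by
    noncomm_ring
  rw [e, hWo, hoWo, o2, sub_self, mul_zero, zero_mul, add_zero, add_zero, mul_zero, sub_zero,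
    ← hZW]

theorem re_trace_mul_comm {k : Type*} [Fintype k] (A B : Matrix k k Quat) :
    (Matrix.trace (A * B)).re = (Matrix.trace (B * A)).re := by
  have re_sum : ∀ f : k → Quat, (∑ i, f i).re = ∑ i, (f i).re := fun f =>
    map_sum (AddMonoidHom.mk' (fun q : Quat => q.re) fun _ _ => rfl) f Finset.univ
  simp only [Matrix.trace, Matrix.diag, Matrix.mul_apply, re_sum]
  rw [Finset.sum_comm]
  refine Finset.sum_congr rfl fun i _ => Finset.sum_congr rfl fun j _ => ?_
  simp only [Quaternion.re_mul]
  ring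

/-- The metric is `g(Z, W) = -⟨e_Z, e_W⟩`. -/
theorem metric_eq_killing {m : ℕ} (ψ : UGroup m) (Z W : Mat m)
    (hZ : Z ∈ tangent (uconj ψ (origin m))) (hW : W ∈ tangent (uconj ψ (origin m))) :
    metric Z W = -killing (coframe (ψ : Mat m) Z) (coframe (ψ : Mat m) W) := by
  have aux := tangent_pull ψ
  obtain ⟨ψ, hψ⟩ := ψ
  obtain ⟨-, hZo, hZ0⟩ := aux Z hZ
  obtain ⟨-, hWo, hW0⟩ := aux W hW
  have h2 : ψ * star ψ = 1 := (Unitary.mem_iff.1 hψ).2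
  have hc : star ψ * Z * ψ * (star ψ * W * ψ) = star ψ * (Z * W * ψ) := by
    simp only [mul_assoc]
    rw [← mul_assoc ψ (star ψ), h2, one_mul]
  have hr : (Matrix.trace (Z * W)).re
      = (Matrix.trace (star ψ * Z * ψ * (star ψ * W * ψ))).re := by
    rw [hc, re_trace_mul_comm (star ψ), mul_assoc, h2, mul_one]
  simp only [metric, killing, coframe, Ring.lie_def]
  rw [hr]
  have o2 := origin_sq m
  simp only at hZo hZ0 hWo hW0 ⊢
  set A := star ψ * Z * ψ
  set B := star ψ * W * ψ
  set o := origin m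
  have e : (A * o - o * A) * (B * o - o * B) = -(A * B) := by
    have e1 : (A * o - o * A) * (B * o - o * B)
        = A * (o * B * o) - A * (o * o - o) * B - A * o * B - o * A * B * o
          + (o * A * o) * B := by noncomm_ring
    have e2 : o * A * B * o = o * A * B := by
      have : o * A * B = o * A * (o * B + B * o) := by rw [hWo]
      rw [this]
      have : o * A * (o * B + B * o) = (o * A * o) * B + o * A * B * o := by noncomm_ring
      rw [this, hZ0, zero_mul, zero_add, mul_assoc _ o o, o2]
    have e3 : A * B = o * A * B + A * o * B := by rw [← add_mul, hZo]
    rw [e1, hW0, hZ0, o2, e2, e3]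
    noncomm_ring
  rw [e]
  simp

theorem MHasDerivAt.mul {m : ℕ} {A B : ℝ → Mat m} {A' B' : Mat m} {x : ℝ}
    (hA : MHasDerivAt A A' x) (hB : MHasDerivAt B B' x) :
    MHasDerivAt (fun y => A y * B y) (A' * B x + A x * B') x := by
  intro i j
  have h := HasDerivAt.fun_sum (u := Finset.univ) fun k (_ : k ∈ Finset.univ) =>
    (hA i k).fun_mul (hB k j)
  simpa only [Matrix.mul_apply, Matrix.add_apply, Finset.sum_add_distrib] using h

theorem commutator_aux {R : Type*} [Ring R] (o B W : R) (o2 : o * o = o) (h : o * W + W * o = W)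
    (h0 : o * W * o = 0) :
    (W * B - B * W) * o - o * (W * B - B * W)
      = -((o * B * o + (1 - o) * B * (1 - o)) * (W * o - o * W)
        - (W * o - o * W) * (o * B * o + (1 - o) * B * (1 - o))) := by
  obtain ⟨p, hp⟩ : ∃ p, p = o * W := ⟨_, rfl⟩
  obtain ⟨q, hq⟩ : ∃ q, q = W * o := ⟨_, rfl⟩
  have e1 : o * p = p := by rw [hp, ← mul_assoc, o2]
  have e2 : p * o = 0 := by rw [hp, h0]
  have e3 : o * q = 0 := by rw [hq, ← mul_assoc, h0]
  have e4 : q * o = q := by rw [hq, mul_assoc, o2]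
  have a1 : ∀ X, o * (p * X) = p * X := fun X => by rw [← mul_assoc, e1]
  have a2 : ∀ X, p * (o * X) = 0 := fun X => by rw [← mul_assoc, e2, zero_mul]
  have a3 : ∀ X, o * (q * X) = 0 := fun X => by rw [← mul_assoc, e3, zero_mul]
  have a4 : ∀ X, q * (o * X) = q * X := fun X => by rw [← mul_assoc, e4]
  rw [← hp, ← hq] at h
  rw [← h]
  simp only [mul_add, add_mul, mul_sub, sub_mul, mul_assoc, mul_one, one_mul, e1, e2, e3, e4, a1,
    a2, a3, a4, mul_zero]
  abel

/-- The connection `ω` represents the covariant derivative: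
`e ⌋ ∇_x Z = D_x e_Z + [ω_x, e_Z]`. -/
theorem coframe_covDeriv {m : ℕ} {γ ψ Z : ℝ → Mat m} {x : ℝ} {ψ' Z' : Mat m}
    (hψ : MHasDerivAt ψ ψ' x) (hZ : MHasDerivAt Z Z' x)
    (hu : ∀ᶠ y in nhds x, ψ y ∈ UGroup m)
    (hγ : γ x = ψ x * origin m * star (ψ x)) (hT : Z x ∈ tangent (γ x)) :
    MHasDerivAt (fun y => coframe (ψ y) (Z y))
      (coframe (ψ x) (covDeriv γ Z x) - ⁅connection (ψ x) ψ', coframe (ψ x) (Z x)⁆) x := by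
  have hux := hu.self_of_nhds
  have h1 : star (ψ x) * ψ x = 1 := (Unitary.mem_iff.1 hux).1
  have h2 : ψ x * star (ψ x) = 1 := (Unitary.mem_iff.1 hux).2
  have hT' : Z x ∈ tangent (uconj ⟨ψ x, hux⟩ (origin m)) := by rw [hγ] at hT; exact hT
  obtain ⟨hZW, hWo, hoWo⟩ := tangent_pull ⟨ψ x, hux⟩ (Z x) hT'
  have hs : MHasDerivAt (fun y => star (ψ y)) (star ψ') x := fun i j => (hψ j i).star
  have hsk : star ψ' * ψ x = -(star (ψ x) * ψ') := by
    have e1 := hs.mul hψ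
    have e2 : MHasDerivAt (fun y => star (ψ y) * ψ y) 0 x := fun i j =>
      (hasDerivAt_const x ((1 : Mat m) i j)).congr_of_eventuallyEq
        (hu.mono fun y hy => by
          simp only [(Unitary.mem_iff.1 hy).1])
    refine eq_neg_of_add_eq_zero_left ?_
    ext1 i j
    exact (e1 i j).unique (e2 i j)
  have hW := ((hs.mul hZ).mul hψ)
  have hc : MHasDerivAt (fun _ => origin m) 0 x := fun i j => hasDerivAt_const x _
  have hX := fun i j => ((hW.mul hc) i j).fun_sub ((hc.mul hW) i j)
  have hZ' : mderiv Z x = Z' := by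
    ext1 i j
    exact (hZ i j).deriv
  have hp : coframe (ψ x) (covDeriv γ Z x) = ⁅star (ψ x) * Z' * ψ x, origin m⁆ := by
    have hr : star (ψ x) * tproj (γ x) Z' * ψ x
        = tproj (origin m) (star (ψ x) * Z' * ψ x) := by
      have ha : star (ψ x) * γ x = origin m * star (ψ x) := by
        rw [hγ]; simp only [← mul_assoc, h1, one_mul]
      have hb : γ x * ψ x = ψ x * origin m := by
        rw [hγ]; simp only [mul_assoc, h1, mul_one]
      simp only [tproj, mul_add, add_mul, mul_sub, sub_mul, mul_one, one_mul, mul_assoc, hb]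
      simp only [← mul_assoc, ha]
    rw [coframe, covDeriv, hZ', hr, tproj, Ring.lie_def, Ring.lie_def]
    have o2 := origin_sq m
    set o := origin m
    set A := star (ψ x) * Z' * ψ x
    have e : (o * A * (1 - o) + (1 - o) * A * o) * o - o * (o * A * (1 - o) + (1 - o) * A * o)
        = A * o - o * A - (o * A * (o * o - o) + A * (o - o * o) + o * A * (o * o - o)
          + (o * o - o) * A * (1 - o) + (o - o * o) * A * o) := by
      noncomm_ring
    rw [e, o2, sub_self]
    simp
  have hgoal : coframe (ψ x) (covDeriv γ Z x) - ⁅connection (ψ x) ψ', coframe (ψ x) (Z x)⁆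
      = ((star ψ' * Z x + star (ψ x) * Z') * ψ x + star (ψ x) * Z x * ψ') * origin m
        - origin m * ((star ψ' * Z x + star (ψ x) * Z') * ψ x + star (ψ x) * Z x * ψ') := by
    have hZW' : Z x = ψ x * (star (ψ x) * Z x * ψ x) * star (ψ x) := hZW
    have g1 : star ψ' * Z x * ψ x = -(star (ψ x) * ψ') * (star (ψ x) * Z x * ψ x) := by
      rw [← hsk]
      simp only [mul_assoc]
      rw [← mul_assoc (ψ x) (star (ψ x)), h2, one_mul]
    have g2 : star (ψ x) * Z x * ψ' = (star (ψ x) * Z x * ψ x) * (star (ψ x) * ψ') := by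
      simp only [mul_assoc]
      rw [← mul_assoc (ψ x) (star (ψ x)), h2, one_mul]
    have c := commutator_aux (origin m) (star (ψ x) * ψ') (star (ψ x) * Z x * ψ x)
      (origin_sq m) hWo hoWo
    rw [hp, add_mul (star ψ' * Z x), g1, g2]
    simp only [connection, coframe, Ring.lie_def]
    rw [sub_eq_add_neg (star (ψ x) * Z' * ψ x * origin m - origin m * (star (ψ x) * Z' * ψ x)),
      ← c]
    noncomm_ring
  rw [hgoal]
  intro i j
  have h := hX i j
  simp only [mul_zero, zero_mul, add_zero, zero_add] at h
  exact h

/-- A parallel frame `ψ` along a curve `γ` with `ω_x = (u, 𝐮)`: one has `e ⌋ γ_x = e_x`, and `ω_x` is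
the element of `𝔥_⊥` with components `u`. -/
structure IsParallelFrame {m : ℕ} (I : Set ℝ) (γ ψ : ℝ → Mat m) (u : ℝ → Cov m) : Prop where
  smooth : MSmoothOn ψ I
  mem : ∀ x ∈ I, ψ x ∈ UGroup m
  lift : ∀ x ∈ I, γ x = ψ x * origin m * star (ψ x)
  coframe_x : ∀ x ∈ I, coframe (ψ x) (mderiv γ x) = ex m
  connection_x : ∀ x ∈ I, connection (ψ x) (mderiv ψ x) = perpMat (u x)

/-! ### Equivariant flows and the operators -/

/-- A flow `h^⊥(x, u, u_x, …, ∂_x^k u)` which is equivariant under `U(1, ℍ) × U(n-1, ℍ)`. -/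
structure EquivariantFlow (m : ℕ) (I : Set ℝ) where
  order : ℕ
  fn : ℝ → (Fin (order + 1) → Cov m) → Cov m
  smooth : ContDiffOn ℝ ∞ (fun p : ℝ × (Fin (order + 1) → Cov m) => fn p.1 p.2) (I ×ˢ univ)
  equivariant : ∀ x ∈ I, ∀ a A (j : Fin (order + 1) → Cov m),
    fn x (fun i => act a A (j i)) = act a A (fn x j)

/-- The jet `(u, u_x, …, ∂_x^k u)` at `x`. -/
def jet {m : ℕ} (k : ℕ) (u : ℝ → Cov m) (x : ℝ) : Fin (k + 1) → Cov m :=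
  fun i => iteratedDeriv (i : ℕ) u x

variable {m : ℕ} {I : Set ℝ}

/-- `h^⊥` along `u`. -/
def EquivariantFlow.along (F : EquivariantFlow m I) (u : ℝ → Cov m) (x : ℝ) : Cov m :=
  F.fn x (jet F.order u x)

/-- A determination of the nonlocal term `D_x⁻¹ [u, ad(e_x)⁻¹ h^⊥]_∥`.  As `D_x⁻¹` is a formal
inverse, this is a primitive of `[u, ad(e_x)⁻¹ h^⊥]_∥` whose constant of integration may depend on
`u` in any way compatible with the equivalence group; for example it vanishes at a base point, or at
infinity, or is given by a differential polynomial in `u` if the integrand is a total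
`x`-derivative.  An element of `𝔪_∥` is recorded by its coefficient with respect to `(1, 𝟎)`. -/
structure NonlocalTerm (F : EquivariantFlow m I) where
  prim : (ℝ → Cov m) → ℝ → ℝ
  hasDerivAt : ∀ u, ContDiffOn ℝ ∞ u I → ∀ x ∈ I,
    HasDerivAt (prim u) (mParCoeff ⁅perpMat (u x), adInvH (F.along u x)⁆) x
  invariant : ∀ a A, ∀ u v : ℝ → Cov m, ContDiffOn ℝ ∞ u I → ContDiffOn ℝ ∞ v I →
    (∀ x ∈ I, v x = act a A (u x)) → ∀ x ∈ I, prim v x = prim u x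

/-- The operator `𝒴 = D_x⁻¹ [u, ad(e_x)⁻¹ ·]_∥ - ad(e_x)⁻¹` applied to `h^⊥`. -/
def calY (F : EquivariantFlow m I) (D : NonlocalTerm F) (u : ℝ → Cov m) (x : ℝ) : Mat m :=
  D.prim u x • mMat 1 0 - adInvH (F.along u x)

/-- `h_⊥ = χ⁻¹ ad(e_x)⁻¹ h^⊥`. -/
def flowPerp (F : EquivariantFlow m I) (u : ℝ → Cov m) (x : ℝ) : Mat m :=
  (chi m)⁻¹ • adInvH (F.along u x)

/-- `h_∥ = -D_x⁻¹ [u, h_⊥]_∥`. -/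
def flowPar (F : EquivariantFlow m I) (D : NonlocalTerm F) (u : ℝ → Cov m) (x : ℝ) : Mat m :=
  -(((chi m)⁻¹ * D.prim u x) • mMat 1 0)

/-- `ϖ^⊥ = -ad(e_x)⁻¹ (D_x h_⊥ + [u, h_∥] + [u, h_⊥]_⊥)`. -/
def connPerp (F : EquivariantFlow m I) (D : NonlocalTerm F) (u : ℝ → Cov m) (x : ℝ) : Mat m :=
  -adInvM (mderiv (flowPerp F u) x + ⁅perpMat (u x), flowPar F D u x⁆
    + mPerp ⁅perpMat (u x), flowPerp F u x⁆)

/-- A smooth solution `u(t, x)`, `t ∈ J`, `x ∈ I`, of the evolution of the covariants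
`u_t = D_x ϖ^⊥ + [u, ϖ^∥] + [u, ϖ^⊥]_⊥ + χ⁻¹ h^⊥` with `ϖ^∥ = -D_x⁻¹ [u, ϖ^⊥]_∥`.  The function
`w` consists of the components of `ϖ^∥`. -/
structure IsSolution (F : EquivariantFlow m I) (D : NonlocalTerm F) (J : Set ℝ)
    (u : ℝ → ℝ → Cov m) (w : ℝ → ℝ → ImQuat × UAlg m) : Prop where
  smooth_u : ContDiffOn ℝ ∞ (fun p : ℝ × ℝ => u p.1 p.2) (J ×ˢ I)
  smooth_w : MSmoothOn (fun p : ℝ × ℝ => parMat (w p.1 p.2)) (J ×ˢ I)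
  smooth_prim : ContDiffOn ℝ ∞ (fun p : ℝ × ℝ => D.prim (u p.1) p.2) (J ×ˢ I)
  eq_w : ∀ t ∈ J, ∀ x ∈ I, MHasDerivAt (fun y => parMat (w t y))
    (-hPar ⁅perpMat (u t x), connPerp F D (u t) x⁆) x
  eq_u : ∀ t ∈ J, ∀ x ∈ I, MHasDerivAt (fun s => perpMat (u s x))
    (mderiv (connPerp F D (u t)) x + ⁅perpMat (u t x), parMat (w t x)⁆
      + hPerp ⁅perpMat (u t x), connPerp F D (u t) x⁆
      + (chi m)⁻¹ • perpMat (F.along (u t) x)) t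

/-- A smooth curve flow `γ(t, x)` in `ℍPⁿ` with a framing `ψ(t, x)` which along each curve
`γ(t, ·)` is parallel with covariants `u(t, ·)`, and with `e ⌋ γ_t = h_⊥ + h_∥`,
`ω_t = ϖ^⊥ + ϖ^∥` in the flow direction. -/
structure IsFramedFlow (F : EquivariantFlow m I) (D : NonlocalTerm F) (J : Set ℝ)
    (u : ℝ → ℝ → Cov m) (w : ℝ → ℝ → ImQuat × UAlg m) (γ ψ : ℝ → ℝ → Mat m) : Prop where
  smooth_curve : MSmoothOn (fun p : ℝ × ℝ => γ p.1 p.2) (J ×ˢ I)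
  smooth_frame : MSmoothOn (fun p : ℝ × ℝ => ψ p.1 p.2) (J ×ˢ I)
  parallel : ∀ t ∈ J, IsParallelFrame I (γ t) (ψ t) (u t)
  coframe_t : ∀ t ∈ J, ∀ x ∈ I, coframe (ψ t x) (mderiv (fun s => γ s x) t)
    = flowPerp F (u t) x + flowPar F D (u t) x
  connection_t : ∀ t ∈ J, ∀ x ∈ I, connection (ψ t x) (mderiv (fun s => ψ s x) t)
    = connPerp F D (u t) x + parMat (w t x)

end

end QuatCurve

open QuatCurve

/-! Pulling back the Maurer-Cartan form makes every equation linear. The idempotent `origin m`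
splits ψ⁻¹dψ into its off-diagonal part e and its diagonal part ω. A smooth unitary lift ψ of γ is
therefore a parallel frame with covariants u exactly when ψ' = ψ(e_x + u) with u in 𝔥_⊥.

Existence of parallel frames (`IsUnitSpeed.exists_parallelFrame`): the matrix T = [γ_x, γ] reads e_x
in every adapted frame, and unit speed places T' in 𝔪_⊥ there. A polynomial in ad(T), applied to T',
gives a C which reads as an element of 𝔥_⊥ and satisfies [C, T] = T'. The solution of ψ' = (T + C)ψ
that starts at an adapted frame then stays adapted and has ω_x in 𝔥_⊥. Uniqueness
(`IsParallelFrame.exists_act`): two parallel frames differ by a curve k in the isotropy group of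
e_x, and k⁻¹k' lies in both 𝔥_∥ and 𝔥_⊥, so k is constant. Equivariance of h^⊥ and invariance of the
chosen primitive then make Y independent of the frame (`evolution_eq`).

The nonlocal term in 𝒴 is what cancels the 𝔪_∥-part of D_x𝒴 + [u, 𝒴], which is the stretching.
Multiplying ψ on the left by a constant changes neither e nor ω, whence the U(n+1, ℍ)-invariance.
For the dependence on covariant jets, put E_i = e⌋∇_x^i γ_x. Then E_0 = e_x and E_{i+1} = D_xE_i +
[u, E_i], and E_1 = [u, e_x] determines u. So the covariant jet of γ at a point and an adapted frame
there determine the jet of u, and changing the frame only moves that jet by the isotropy group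
(`exists_act_jet`).

For flows, put A = e_x + u and B = h_⊥ + h_∥ + ϖ^⊥ + ϖ^∥. The definitions of h_∥, ϖ^⊥ and ϖ^∥ and
the evolution equation of u are the 𝔪_∥, 𝔪_⊥, 𝔥_∥ and 𝔥_⊥ components of A_t = B_x + [A, B]
(`IsSolution.hasDerivAt_flowForm`). This flat connection has a global unitary frame
(`IsSolution.exists_frame`). The 𝔪-part of B is -χ⁻¹𝒴, which gives γ_t = Y, and two frames with the
same A and B differ by a constant left factor. -/

namespace QuatCurve

noncomputable section

open MeasureTheory intervalIntegral Topology Filter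

/-! ### Linear differential equations and flat connections in a Banach algebra -/

section LinearODE

variable {R : Type*} [NormedRing R] [NormedAlgebra ℝ R] [CompleteSpace R]

/-- The Picard iterates of the equation `ψ' = ψ A`. -/
def picardTerm (A : ℝ → R) (x₀ : ℝ) (c : R) : ℕ → ℝ → R
  | 0 => fun _ => c
  | n + 1 => fun x => ∫ s in x₀..x, picardTerm A x₀ c n s * A s

theorem hasDerivAt_integral_of_isOpen {E : Type*} [NormedAddCommGroup E] [NormedSpace ℝ E]
    [CompleteSpace E] {I : Set ℝ} (hIo : IsOpen I) (hIc : I.OrdConnected)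
    {f : ℝ → E} (hf : ContinuousOn f I) {x₀ x : ℝ} (h₀ : x₀ ∈ I) (hx : x ∈ I) :
    HasDerivAt (fun y => ∫ s in x₀..y, f s) (f x) x := by
  refine integral_hasDerivAt_right ?_ ?_ (hf.continuousAt (hIo.mem_nhds hx))
  · exact (hf.mono (hIc.uIcc_subset h₀ hx)).intervalIntegrable
  · exact hf.stronglyMeasurableAtFilter hIo x hx

theorem picardTerm_continuousOn {I : Set ℝ} (hIo : IsOpen I) (hIc : I.OrdConnected) {A : ℝ → R}
    (hA : ContinuousOn A I) {x₀ : ℝ} (h₀ : x₀ ∈ I) (c : R) (n : ℕ) :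
    ContinuousOn (picardTerm A x₀ c n) I := by
  induction n with
  | zero => exact continuousOn_const
  | succ n ih =>
    intro x hx
    exact (hasDerivAt_integral_of_isOpen hIo hIc (ih.mul hA) h₀ hx).continuousAt.continuousWithinAt

/-- The n-th iterate is an n-fold integral over an ordered simplex, whose volume supplies the
factorial. This is why the series converges on every compact subinterval, without a smallness
condition on its length. -/
theorem norm_picardTerm_le {I : Set ℝ} (hIo : IsOpen I) (hIc : I.OrdConnected) {A : ℝ → R}
    (hA : ContinuousOn A I) {x₀ : ℝ} (h₀ : x₀ ∈ I) (c : R) {a b K : ℝ} (hab : Icc a b ⊆ I)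
    (h₀' : x₀ ∈ Icc a b) (hK : ∀ x ∈ Icc a b, ‖A x‖ ≤ K) (n : ℕ) {x : ℝ} (hx : x ∈ Icc a b) :
    ‖picardTerm A x₀ c n x‖ ≤ ‖c‖ * (K * |x - x₀|) ^ n / n.factorial := by
  induction n generalizing x with
  | zero => simp [picardTerm]
  | succ n ih =>
    have hsub : uIcc x₀ x ⊆ Icc a b := uIcc_subset_Icc h₀' hx
    have hK0 : 0 ≤ K := (norm_nonneg _).trans (hK x hx)
    have hsub' : uIoc x₀ x ⊆ Icc a b := uIoc_subset_uIcc.trans hsub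
    calc ‖picardTerm A x₀ c (n + 1) x‖
        ≤ ∫ s in uIoc x₀ x, ‖picardTerm A x₀ c n s * A s‖ := norm_integral_le_integral_norm_uIoc
      _ ≤ ∫ s in uIoc x₀ x, (‖c‖ * K ^ (n + 1) / n.factorial) * |s - x₀| ^ n := by
          refine setIntegral_mono_on ?_ ?_ measurableSet_uIoc fun s hs => ?_
          · rw [← intervalIntegrable_iff]
            exact (((picardTerm_continuousOn hIo hIc hA h₀ c n).mul hA).norm.mono
              (hsub.trans hab)).intervalIntegrable
          · rw [← intervalIntegrable_iff]
            exact Continuous.intervalIntegrable (by fun_prop) _ _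
          · calc _ ≤ ‖picardTerm A x₀ c n s‖ * ‖A s‖ := norm_mul_le _ _
              _ ≤ (‖c‖ * (K * |s - x₀|) ^ n / n.factorial) * K := by
                  gcongr
                  · exact ih (hsub' hs)
                  · exact hK s (hsub' hs)
              _ = _ := by ring
      _ = (‖c‖ * K ^ (n + 1) / n.factorial) * (|x - x₀| ^ (n + 1) / (n + 1)) := by
          rw [MeasureTheory.integral_const_mul, integral_pow_abs_sub_uIoc]
      _ = _ := by
          rw [Nat.factorial_succ]; push_cast; rw [mul_pow]; field_simp

/-- Global existence for the linear equation `ψ' = ψ A` on an open interval. -/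
theorem exists_linear_ode {I : Set ℝ} (hIo : IsOpen I) (hIc : I.OrdConnected) {A : ℝ → R}
    (hA : ContinuousOn A I) {x₀ : ℝ} (h₀ : x₀ ∈ I) (c : R) :
    ∃ ψ : ℝ → R, ψ x₀ = c ∧ ∀ x ∈ I, HasDerivAt ψ (ψ x * A x) x := by
  have hterm0 : ∀ n, picardTerm A x₀ c (n + 1) x₀ = 0 := fun n => integral_same
  refine ⟨fun x => ∑' n, picardTerm A x₀ c n x, ?_, fun x hx => ?_⟩
  · show ∑' n, picardTerm A x₀ c n x₀ = c
    rw [tsum_eq_single 0 fun n hn => ?_]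
    · rfl
    · obtain ⟨k, rfl⟩ := Nat.exists_eq_succ_of_ne_zero hn
      exact hterm0 k
  -- Termwise differentiation needs an open interval with uniform bounds. It must contain the base
  -- point too, because convergence is known there.
  obtain ⟨a, b, hab, hx', h₀'⟩ : ∃ a b, Icc a b ⊆ I ∧ x ∈ Ioo a b ∧ x₀ ∈ Ioo a b := by
    have hlo : min x x₀ ∈ I := by rcases min_choice x x₀ with h | h <;> rw [h] <;> assumption
    have hhi : max x x₀ ∈ I := by rcases max_choice x x₀ with h | h <;> rw [h] <;> assumption
    obtain ⟨ε, hε, h1⟩ := Metric.isOpen_iff.1 hIo _ hlo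
    obtain ⟨δ, hδ, h2⟩ := Metric.isOpen_iff.1 hIo _ hhi
    refine ⟨min x x₀ - ε / 2, max x x₀ + δ / 2, hIc.out (h1 ?_) (h2 ?_), ⟨?_, ?_⟩, ⟨?_, ?_⟩⟩
    · rw [Metric.mem_ball, Real.dist_eq, sub_sub_cancel_left, abs_neg, abs_of_pos (by positivity)]
      linarith
    · rw [Metric.mem_ball, Real.dist_eq, add_sub_cancel_left, abs_of_pos (by positivity)]
      linarith
    · linarith [min_le_left x x₀]
    · linarith [le_max_left x x₀]
    · linarith [min_le_right x x₀]
    · linarith [le_max_right x x₀]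
  obtain ⟨K, hK⟩ := isCompact_Icc.exists_bound_of_continuousOn (hA.mono hab)
  have h₀c := Ioo_subset_Icc_self h₀'
  have hK0 : 0 ≤ K := (norm_nonneg _).trans (hK x₀ h₀c)
  have hb : ∀ n, ∀ y ∈ Icc a b,
      ‖picardTerm A x₀ c n y‖ ≤ ‖c‖ * ((K * (b - a)) ^ n / n.factorial) := fun n y hy => by
    refine (norm_picardTerm_le hIo hIc hA h₀ c hab h₀c hK n hy).trans ?_
    rw [← mul_div_assoc]
    gcongr
    exact abs_le.2 ⟨by linarith [hy.1, h₀c.2], by linarith [hy.2, h₀c.1]⟩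
  have hsum : Summable fun n : ℕ => ‖c‖ * ((K * (b - a)) ^ n / n.factorial) :=
    (Real.summable_pow_div_factorial _).mul_left _
  have hps : ∀ y ∈ Icc a b, Summable fun n => picardTerm A x₀ c n y := fun y hy =>
    Summable.of_norm_bounded hsum fun n => hb n y hy
  -- The index shifts by one: differentiating iterate k + 1 gives iterate k times `A`, and iterate 0
  -- is constant.
  let g' : ℕ → ℝ → R := fun n y => Nat.casesOn n 0 fun k => picardTerm A x₀ c k y * A y
  let v : ℕ → ℝ := fun n => Nat.casesOn n 0 fun k =>
    ‖c‖ * ((K * (b - a)) ^ k / k.factorial) * K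
  have hv : Summable v := (summable_nat_add_iff 1).1 (hsum.mul_right K)
  have key := hasDerivAt_tsum_of_isPreconnected (g := picardTerm A x₀ c) (g' := g') hv isOpen_Ioo
    (isPreconnected_Ioo (a := a) (b := b)) (fun n y hy => ?_) (fun n y hy => ?_) h₀'
    (hps x₀ h₀c) hx'
  · have hxc := Ioo_subset_Icc_self hx'
    have hg : Summable fun n => g' n x :=
      (summable_nat_add_iff 1).1 ((hps x hxc).mul_right (A x))
    rwa [hg.tsum_eq_zero_add, show g' 0 x = 0 from rfl, zero_add,
      show (∑' n, g' (n + 1) x) = ∑' n, picardTerm A x₀ c n x * A x from rfl,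
      (hps x hxc).tsum_mul_right] at key
  · cases n with
    | zero => exact hasDerivAt_const _ _
    | succ k =>
      exact hasDerivAt_integral_of_isOpen hIo hIc
        ((picardTerm_continuousOn hIo hIc hA h₀ c k).mul hA) h₀ (hab (Ioo_subset_Icc_self hy))
  · have hyc := Ioo_subset_Icc_self hy
    cases n with
    | zero => simp [g', v]
    | succ k =>
      calc _ ≤ ‖picardTerm A x₀ c k y‖ * ‖A y‖ := norm_mul_le _ _
        _ ≤ _ := mul_le_mul (hb k y hyc) (hK y hyc) (norm_nonneg _) ((norm_nonneg _).trans (hb k y hyc))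

/-- Solutions of `ψ' = ψ A` with smooth `A` are smooth. -/
theorem contDiffOn_of_linear_ode {I : Set ℝ} (hIo : IsOpen I) {A ψ : ℝ → R}
    (hA : ContDiffOn ℝ ∞ A I) (hψ : ∀ x ∈ I, HasDerivAt ψ (ψ x * A x) x) :
    ContDiffOn ℝ ∞ ψ I := by
  have hd : DifferentiableOn ℝ ψ I := fun x hx => (hψ x hx).differentiableAt.differentiableWithinAt
  refine contDiffOn_infty.2 fun n => ?_
  induction n with
  | zero => exact contDiffOn_zero.2 hd.continuousOn
  | succ n ih =>
    rw [Nat.cast_succ]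
    refine (contDiffOn_succ_iff_deriv_of_isOpen hIo).2 ⟨hd, fun h => (WithTop.natCast_ne_top n h).elim, ?_⟩
    exact (ih.mul (hA.of_le (mod_cast le_top))).congr fun x hx => (hψ x hx).deriv

/-- If `ψ_x = ψ A` everywhere and `ψ_t = ψ B` on one line `x = x₀`, then `ψ_t = ψ B` everywhere,
provided that the connection `A dx + B dt` is flat.  Here `φ = ψ⁻¹`. -/
theorem hasDerivAt_of_flat {J I : Set ℝ} (hJo : IsOpen J) (hIc : I.OrdConnected)
    {A At B Bx ψ φ : ℝ → ℝ → R} {C : ℝ} {x₀ : ℝ} (h₀ : x₀ ∈ I)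
    (hA : ∀ t ∈ J, ContinuousOn (A t) I)
    (hAt : ContinuousOn (fun p : ℝ × ℝ => At p.1 p.2) (J ×ˢ I))
    (hAd : ∀ t ∈ J, ∀ x ∈ I, HasDerivAt (fun s => A s x) (At t x) t)
    (hBd : ∀ t ∈ J, ∀ x ∈ I, HasDerivAt (B t) (Bx t x) x)
    (hflat : ∀ t ∈ J, ∀ x ∈ I, At t x = Bx t x + (A t x * B t x - B t x * A t x))
    (hψ : ∀ t ∈ J, ∀ x ∈ I, HasDerivAt (ψ t) (ψ t x * A t x) x)
    (hφ : ∀ t ∈ J, ∀ x ∈ I, HasDerivAt (φ t) (-(A t x * φ t x)) x)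
    (hψφ : ∀ t ∈ J, ∀ x ∈ I, ψ t x * φ t x = 1) (hφψ : ∀ t ∈ J, ∀ x ∈ I, φ t x * ψ t x = 1)
    (hψC : ∀ t ∈ J, ∀ x ∈ I, ‖ψ t x‖ ≤ C) (hφC : ∀ t ∈ J, ∀ x ∈ I, ‖φ t x‖ ≤ C)
    (hbase : ∀ t ∈ J, HasDerivAt (fun s => ψ s x₀) (ψ t x₀ * B t x₀) t)
    {t x : ℝ} (ht : t ∈ J) (hx : x ∈ I) :
    HasDerivAt (fun s => ψ s x) (ψ t x * B t x) t := by
  have hψc : ∀ s ∈ J, ContinuousOn (ψ s) I := fun s hs y hy =>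
    (hψ s hs y hy).continuousAt.continuousWithinAt
  have hφc : ∀ s ∈ J, ContinuousOn (φ s) I := fun s hs y hy =>
    (hφ s hs y hy).continuousAt.continuousWithinAt
  have hC0 : 0 ≤ C := (norm_nonneg _).trans (hψC t ht x hx)
  obtain ⟨δ, hδ, hδJ⟩ : ∃ δ > 0, Metric.closedBall t δ ⊆ J :=
    Metric.nhds_basis_closedBall.mem_iff.1 (hJo.mem_nhds ht)
  have hIy : ∀ y ∈ I, uIcc x₀ y ⊆ I := fun y hy => hIc.uIcc_subset h₀ hy
  -- the integrand
  let G : ℝ → ℝ → R := fun s y => ψ s y * (A s y - A t y) * φ t y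
  have hGc : ∀ s ∈ J, ContinuousOn (G s) I := fun s hs =>
    ((hψc s hs).mul ((hA s hs).sub (hA t ht))).mul (hφc t ht)
  -- Pairing ψ at time s with the inverse at the fixed time t leaves only A s - A t in the
  -- x-derivative. Thus ψ(s, x)φ(t, x) is a base term plus an integral that is differentiable in s
  -- at t.
  have hD : ∀ s ∈ J, ∀ y ∈ I, HasDerivAt (fun z => ψ s z * φ t z) (G s y) y := by
    intro s hs y hy
    refine ((hψ s hs y hy).mul (hφ t ht y hy)).congr_deriv ?_
    dsimp only [G]; noncomm_ring
  have hFTC : ∀ s ∈ J, ∀ y ∈ I,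
      ∫ z in x₀..y, G s z = ψ s y * φ t y - ψ s x₀ * φ t x₀ := fun s hs y hy =>
    integral_eq_sub_of_hasDerivAt (fun z hz => hD s hs z (hIy y hy hz))
      ((hGc s hs).mono (hIy y hy)).intervalIntegrable
  -- a uniform Lipschitz bound
  obtain ⟨M, hM⟩ : ∃ M, ∀ p ∈ Metric.closedBall t δ ×ˢ uIcc x₀ x, ‖At p.1 p.2‖ ≤ M :=
    ((isCompact_closedBall t δ).prod isCompact_uIcc).exists_bound_of_continuousOn
      (hAt.mono (prod_mono hδJ (hIy x hx)))
  have hM0 : 0 ≤ M := (norm_nonneg _).trans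
    (hM (t, x₀) ⟨Metric.mem_closedBall_self hδ.le, left_mem_uIcc⟩)
  have hlipA : ∀ s ∈ Metric.closedBall t δ, ∀ y ∈ uIcc x₀ x, ‖A s y - A t y‖ ≤ M * ‖s - t‖ :=
    fun s hs y hy => (convex_closedBall t δ).norm_image_sub_le_of_norm_hasDerivWithin_le
      (fun r hr => (hAd r (hδJ hr) y (hIy x hx hy)).hasDerivWithinAt) (fun r hr => hM (r, y) ⟨hr, hy⟩)
      (Metric.mem_closedBall_self hδ.le) hs
  -- The uniform bound `C` replaces continuity of ψ in t, which is not yet known away from x₀. The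
  -- estimate gives that continuity and also the domination needed to differentiate under the
  -- integral.
  have hlipG : ∀ s ∈ Metric.closedBall t δ, ∀ y ∈ uIcc x₀ x,
      ‖G s y‖ ≤ C * M * C * ‖s - t‖ := fun s hs y hy => by
    have hyI := hIy x hx hy
    calc ‖G s y‖ ≤ ‖ψ s y‖ * ‖A s y - A t y‖ * ‖φ t y‖ :=
          (norm_mul_le _ _).trans (mul_le_mul_of_nonneg_right (norm_mul_le _ _) (norm_nonneg _))
      _ ≤ C * (M * ‖s - t‖) * C := by
          gcongr
          · exact hψC s (hδJ hs) y hyI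
          · exact hlipA s hs y hy
          · exact hφC t ht y hyI
      _ = _ := by ring
  have hball : Metric.closedBall t δ ∈ 𝓝 t := Metric.closedBall_mem_nhds t hδ
  -- continuity in `t`
  have hcont : ∀ y ∈ uIcc x₀ x, ContinuousAt (fun s => ψ s y) t := by
    intro y hy
    have hyI := hIy x hx hy
    have h1 : Tendsto (fun s => ∫ z in x₀..y, G s z) (𝓝 t) (𝓝 0) := by
      refine squeeze_zero_norm' (a := fun s => C * M * C * ‖s - t‖ * |y - x₀|) ?_ ?_
      · filter_upwards [hball] with s hs
        exact norm_integral_le_of_norm_le_const fun z hz => hlipG s hs z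
          (uIcc_subset_uIcc_left hy (uIoc_subset_uIcc hz))
      · have : Continuous fun s => C * M * C * ‖s - t‖ * |y - x₀| := by fun_prop
        simpa using this.tendsto t
    have h2 : Tendsto (fun s => (∫ z in x₀..y, G s z + 0) + ψ s x₀ * φ t x₀) (𝓝 t)
        (𝓝 (0 + ψ t x₀ * φ t x₀)) := by
      simp only [add_zero]
      exact h1.add (((hbase t ht).continuousAt.tendsto).mul_const _)
    have h3 : Tendsto (fun s => ψ s y * φ t y * ψ t y) (𝓝 t) (𝓝 (1 * ψ t y)) := by
      refine Tendsto.mul_const _ ?_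
      rw [zero_add, hψφ t ht x₀ h₀] at h2
      refine h2.congr' ?_
      filter_upwards [hJo.mem_nhds ht] with s hs
      simp only [add_zero]
      rw [hFTC s hs y hyI, sub_add_cancel]
    rw [one_mul] at h3
    refine h3.congr fun s => ?_
    rw [mul_assoc, hφψ t ht y hyI, mul_one]
  -- differentiation under the integral sign
  let G' : ℝ → R := fun y => ψ t y * At t y * φ t y
  have hAtc : ContinuousOn (At t) I :=
    hAt.comp (continuousOn_const.prodMk continuousOn_id) fun y hy => ⟨ht, hy⟩
  have hG'c : ContinuousOn G' I := ((hψc t ht).mul hAtc).mul (hφc t ht)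
  have hGt : ∀ y, G t y = 0 := fun y => by simp [G]
  have hGd : ∀ y ∈ uIcc x₀ x, HasDerivAt (fun s => G s y) (G' y) t := by
    intro y hy
    refine HasDerivAt.mul_const ?_ _
    rw [hasDerivAt_iff_tendsto_slope]
    have h1 := (hasDerivAt_iff_tendsto_slope.1 (hAd t ht y (hIy x hx hy)))
    have h2 : Tendsto (fun s => ψ s y * slope (fun s => A s y) t s) (𝓝[≠] t)
        (𝓝 (ψ t y * At t y)) := ((hcont y hy).tendsto.mono_left nhdsWithin_le_nhds).mul h1
    refine h2.congr fun s => ?_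
    simp [slope_def_module]
  have hint : HasDerivAt (fun s => ∫ y in x₀..x, G s y) (∫ y in x₀..x, G' y) t := by
    have hsub : uIoc x₀ x ⊆ uIcc x₀ x := uIoc_subset_uIcc
    have hG'i : IntegrableOn G' (uIoc x₀ x) :=
      (intervalIntegrable_iff.1 (hG'c.mono (hIy x hx)).intervalIntegrable)
    have h := hasFDerivAt_integral_of_dominated_loc_of_lip' (bound := fun _ => C * M * C)
      (F := G) (F' := fun y => (1 : ℝ →L[ℝ] ℝ).smulRight (G' y))
      (μ := volume.restrict (uIoc x₀ x)) hball
      (fun s hs => (intervalIntegrable_iff.1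
        ((hGc s (hδJ hs)).mono (hIy x hx)).intervalIntegrable).aestronglyMeasurable)
      (by rw [show G t = fun _ => 0 from funext hGt]; exact integrable_zero _ _ _)
      ((ContinuousLinearMap.smulRightL ℝ ℝ R 1).continuous.comp_aestronglyMeasurable
        hG'i.aestronglyMeasurable)
      ((ae_restrict_iff' measurableSet_uIoc).2 (ae_of_all _ fun y hy s hs => by
        rw [hGt, sub_zero]; exact hlipG s hs y (hsub hy)))
      (intervalIntegrable_iff.1 intervalIntegrable_const)
      ((ae_restrict_iff' measurableSet_uIoc).2 (ae_of_all _ fun y hy =>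
        (hGd y (hsub hy)).hasFDerivAt))
    have h2 := h.2.hasDerivAt
    rw [ContinuousLinearMap.integral_apply h.1] at h2
    simp only [ContinuousLinearMap.smulRight_apply, one_apply_eq_self,
      one_smul] at h2
    simp only [intervalIntegral_eq_integral_uIoc]
    exact h2.fun_const_smul _
  have hfinal : HasDerivAt (fun s => ψ s x * φ t x) (ψ t x * B t x * φ t x) t := by
    -- Flatness says exactly that ψ A_t φ is the x-derivative of ψ B φ. The integral therefore
    -- reduces to boundary terms, and the one at x₀ cancels against the derivative of the base term.
    have hBψ : ∀ y ∈ I, HasDerivAt (fun z => ψ t z * B t z * φ t z) (G' y) y := by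
      intro y hy
      refine (((hψ t ht y hy).mul (hBd t ht y hy)).mul (hφ t ht y hy)).congr_deriv ?_
      dsimp only [G', Pi.mul_apply]; rw [hflat t ht y hy]; noncomm_ring
    have h1 : ∫ y in x₀..x, G' y = ψ t x * B t x * φ t x - ψ t x₀ * B t x₀ * φ t x₀ :=
      integral_eq_sub_of_hasDerivAt (fun z hz => hBψ z (hIy x hx hz))
        (hG'c.mono (hIy x hx)).intervalIntegrable
    have h2 := hint.add ((hbase t ht).mul_const (φ t x₀))
    rw [h1, sub_add_cancel] at h2
    refine h2.congr_of_eventuallyEq ?_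
    filter_upwards [hJo.mem_nhds ht] with s hs
    simp [hFTC s hs x hx]
  have := hfinal.mul_const (ψ t x)
  simpa only [mul_assoc, hφψ t ht x hx, mul_one] using this

/-- A function with smooth logarithmic partial derivatives is smooth. -/
theorem contDiffOn_of_partial {J I : Set ℝ} (hJo : IsOpen J) (hIo : IsOpen I)
    {A B ψ : ℝ → ℝ → R} {C : ℝ}
    (hA : ContDiffOn ℝ ∞ (fun p : ℝ × ℝ => A p.1 p.2) (J ×ˢ I))
    (hB : ContDiffOn ℝ ∞ (fun p : ℝ × ℝ => B p.1 p.2) (J ×ˢ I))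
    (hψC : ∀ t ∈ J, ∀ x ∈ I, ‖ψ t x‖ ≤ C)
    (hψx : ∀ t ∈ J, ∀ x ∈ I, HasDerivAt (ψ t) (ψ t x * A t x) x)
    (hψt : ∀ t ∈ J, ∀ x ∈ I, HasDerivAt (fun s => ψ s x) (ψ t x * B t x) t) :
    ContDiffOn ℝ ∞ (fun p : ℝ × ℝ => ψ p.1 p.2) (J ×ˢ I) := by
  have hJI : IsOpen (J ×ˢ I) := hJo.prod hIo
  have hc : ContinuousOn (fun p : ℝ × ℝ => ψ p.1 p.2) (J ×ˢ I) := by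
    rintro ⟨t, x⟩ ⟨ht, hx⟩
    refine ContinuousAt.continuousWithinAt ?_
    obtain ⟨δ, hδ, hδJ⟩ : ∃ δ > 0, Metric.closedBall x δ ⊆ I :=
      Metric.nhds_basis_closedBall.mem_iff.1 (hIo.mem_nhds hx)
    obtain ⟨ε, hε, hεJ⟩ : ∃ δ > 0, Metric.closedBall t δ ⊆ J :=
      Metric.nhds_basis_closedBall.mem_iff.1 (hJo.mem_nhds ht)
    obtain ⟨M, hM⟩ : ∃ M, ∀ p ∈ Metric.closedBall t ε ×ˢ Metric.closedBall x δ,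
        ‖A p.1 p.2‖ ≤ M :=
      ((isCompact_closedBall t ε).prod (isCompact_closedBall x δ)).exists_bound_of_continuousOn
        (hA.continuousOn.mono (prod_mono hεJ hδJ))
    have hC0 : 0 ≤ C := (norm_nonneg _).trans (hψC t ht x hx)
    -- A Lipschitz constant in x that is uniform in s upgrades separate continuity to joint
    -- continuity.
    have hlip : ∀ s ∈ Metric.closedBall t ε, ∀ y ∈ Metric.closedBall x δ,
        ‖ψ s y - ψ s x‖ ≤ C * M * ‖y - x‖ := fun s hs y hy =>
      (convex_closedBall x δ).norm_image_sub_le_of_norm_hasDerivWithin_le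
        (fun r hr => (hψx s (hεJ hs) r (hδJ hr)).hasDerivWithinAt)
        (fun r hr => (norm_mul_le _ _).trans (mul_le_mul (hψC s (hεJ hs) r (hδJ hr))
          (hM (s, r) ⟨hs, hr⟩) (norm_nonneg _) hC0))
        (Metric.mem_closedBall_self hδ.le) hy
    have h1 : Tendsto (fun p : ℝ × ℝ => ψ p.1 p.2 - ψ p.1 x) (𝓝 (t, x)) (𝓝 0) := by
      refine squeeze_zero_norm' (a := fun p => C * M * ‖p.2 - x‖) ?_ ?_
      · filter_upwards [prod_mem_nhds (Metric.closedBall_mem_nhds t hε)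
          (Metric.closedBall_mem_nhds x hδ)] with p hp
        exact hlip p.1 hp.1 p.2 hp.2
      · have : Continuous fun p : ℝ × ℝ => C * M * ‖p.2 - x‖ := by fun_prop
        simpa using this.tendsto (t, x)
    have h2 : Tendsto (fun p : ℝ × ℝ => ψ p.1 x) (𝓝 (t, x)) (𝓝 (ψ t x)) :=
      (hψt t ht x hx).continuousAt.tendsto.comp (continuous_fst.tendsto (t, x))
    simpa [ContinuousAt] using h1.add h2
  -- With this notation `L (b, a)` is the form b dt + a dx. Since dψ = L(ψB, ψA) with `L` fixed and
  -- linear, each order of smoothness of ψ yields the next.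
  let fst' := ContinuousLinearMap.smulRightL ℝ ℝ R (1 : ℝ →L[ℝ] ℝ)
  let L : R × R →L[ℝ] (ℝ × ℝ →L[ℝ] R) :=
    ((ContinuousLinearMap.compL ℝ (ℝ × ℝ) ℝ R).flip (ContinuousLinearMap.fst ℝ ℝ ℝ) ∘L fst').comp
      (ContinuousLinearMap.fst ℝ R R) +
    ((ContinuousLinearMap.compL ℝ (ℝ × ℝ) ℝ R).flip (ContinuousLinearMap.snd ℝ ℝ ℝ) ∘L fst').comp
      (ContinuousLinearMap.snd ℝ R R)
  have hd : ∀ p ∈ J ×ˢ I, HasFDerivAt (fun p : ℝ × ℝ => ψ p.1 p.2)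
      (L (ψ p.1 p.2 * B p.1 p.2, ψ p.1 p.2 * A p.1 p.2)) p := by
    rintro ⟨t, x⟩ hp
    have := (hasStrictFDerivAt_uncurry_coprod (𝕜 := ℝ) (u := (t, x)) (f := ψ)
      (f₁ := fun t x => fst' (ψ t x * B t x)) (f₂ := fun t x => fst' (ψ t x * A t x))
      ?_ ?_ ?_ ?_).hasFDerivAt
    · refine this.congr_fderiv ?_
      ext <;> simp [L, fst', Function.HasUncurry.uncurry]
    · filter_upwards [hJI.mem_nhds hp] with q hq
      exact (hψt q.1 hq.1 q.2 hq.2).hasFDerivAt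
    · filter_upwards [hJI.mem_nhds hp] with q hq
      exact (hψx q.1 hq.1 q.2 hq.2).hasFDerivAt
    · exact fst'.continuous.continuousAt.comp
        ((hc.mul hB.continuousOn).continuousAt (hJI.mem_nhds hp))
    · exact fst'.continuous.continuousAt.comp
        ((hc.mul hA.continuousOn).continuousAt (hJI.mem_nhds hp))
  have hdo : DifferentiableOn ℝ (fun p : ℝ × ℝ => ψ p.1 p.2) (J ×ˢ I) := fun p hp =>
    (hd p hp).differentiableAt.differentiableWithinAt
  refine contDiffOn_infty.2 fun n => ?_
  induction n with
  | zero => exact contDiffOn_zero.2 hc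
  | succ n ih =>
    rw [Nat.cast_succ]
    refine (contDiffOn_succ_iff_fderiv_of_isOpen hJI).2 ⟨hdo, fun h => (WithTop.natCast_ne_top n h).elim, ?_⟩
    refine ContDiffOn.congr (L.contDiff.comp_contDiffOn
      ((ih.mul (hB.of_le (mod_cast le_top))).prodMk (ih.mul (hA.of_le (mod_cast le_top))))) ?_
    exact fun p hp => (hd p hp).fderiv

end LinearODE

end

end QuatCurve

namespace QuatCurve

noncomputable section

open Topology Filter

attribute [local instance] Matrix.linftyOpNormedRing Matrix.linftyOpNormedAlgebra

/-! ### Entrywise calculus and the operator norm on quaternionic matrices -/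

section MatrixCalculus

variable {m : ℕ}

/-- The entry of a matrix as a continuous linear map. -/
def entryCLM (m : ℕ) (i j : Fin (m + 2)) : Mat m →L[ℝ] Quat :=
  LinearMap.toContinuousLinearMap
    { toFun := fun A => A i j, map_add' := fun _ _ => rfl, map_smul' := fun _ _ => rfl }

/-- The matrix with a single non-zero entry, as a continuous linear map. -/
def singleCLM (m : ℕ) (i j : Fin (m + 2)) : Quat →L[ℝ] Mat m :=
  LinearMap.toContinuousLinearMap (Matrix.singleLinearMap ℝ i j)

@[simp] theorem entryCLM_apply (i j : Fin (m + 2)) (A : Mat m) : entryCLM m i j A = A i j := rfl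

theorem sum_singleCLM (A : Mat m) : ∑ i, ∑ j, singleCLM m i j (A i j) = A :=
  (Matrix.matrix_eq_sum_single A).symm

/-- A matrix is a finite sum of continuous linear images of its entries, so the entrywise notion
agrees with differentiability for the submultiplicative row-sum norm. This gives access to the
Banach algebra results. -/
theorem mhasDerivAt_iff {A : ℝ → Mat m} {A' : Mat m} {x : ℝ} :
    MHasDerivAt A A' x ↔ HasDerivAt A A' x := by
  constructor
  · intro h
    have := HasDerivAt.fun_sum (u := Finset.univ) fun i _ => HasDerivAt.fun_sum (u := Finset.univ)
      fun j (_ : j ∈ Finset.univ) => (singleCLM m i j).hasFDerivAt.comp_hasDerivAt x (h i j)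
    simp only [Function.comp_def, sum_singleCLM] at this
    exact this.congr_deriv (sum_singleCLM A')
  · exact fun h i j => (entryCLM m i j).hasFDerivAt.comp_hasDerivAt x h

theorem msmoothOn_iff {E : Type*} [NormedAddCommGroup E] [NormedSpace ℝ E] {A : E → Mat m}
    {S : Set E} : MSmoothOn A S ↔ ContDiffOn ℝ ∞ A S := by
  constructor
  · intro h
    have : ContDiffOn ℝ ∞ (fun p => ∑ i, ∑ j, singleCLM m i j (A p i j)) S :=
      ContDiffOn.sum fun i _ => ContDiffOn.sum fun j _ =>
        (singleCLM m i j).contDiff.comp_contDiffOn (h i j)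
    simpa only [sum_singleCLM] using this
  · exact fun h i j => (entryCLM m i j).contDiff.comp_contDiffOn h

theorem mderiv_of_hasDerivAt {A : ℝ → Mat m} {A' : Mat m} {x : ℝ} (h : HasDerivAt A A' x) :
    mderiv A x = A' := by
  ext1 i j
  exact (mhasDerivAt_iff.2 h i j).deriv

theorem hasDerivAt_mderiv {A : ℝ → Mat m} {I : Set ℝ} (hI : IsOpen I) (h : ContDiffOn ℝ ∞ A I)
    {x : ℝ} (hx : x ∈ I) : HasDerivAt A (mderiv A x) x := by
  have h1 := ((h.contDiffAt (hI.mem_nhds hx)).differentiableAt (by simp)).hasDerivAt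
  rwa [← mderiv_of_hasDerivAt h1] at h1

theorem contDiffOn_mderiv {A : ℝ → Mat m} {I : Set ℝ} (hI : IsOpen I) (h : ContDiffOn ℝ ∞ A I) :
    ContDiffOn ℝ ∞ (mderiv A) I :=
  (((contDiffOn_infty_iff_deriv_of_isOpen hI).1 h).2).congr fun _ hx =>
    (hasDerivAt_mderiv hI h hx).deriv.symm

theorem mderiv_congr {A B : ℝ → Mat m} {x : ℝ} (h : A =ᶠ[𝓝 x] B) : mderiv A x = mderiv B x := by
  ext1 i j
  exact Filter.EventuallyEq.deriv_eq (h.mono fun y hy => congrFun (congrFun hy i) j)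

/-- The conjugate transpose as a continuous linear map. -/
def starCLM (m : ℕ) : Mat m →L[ℝ] Mat m :=
  LinearMap.toContinuousLinearMap
    { toFun := star, map_add' := star_add, map_smul' := fun r A => by simp }

@[simp] theorem starCLM_apply (A : Mat m) : starCLM m A = star A := rfl

theorem hasDerivAt_star {A : ℝ → Mat m} {A' : Mat m} {x : ℝ} (h : HasDerivAt A A' x) :
    HasDerivAt (fun y => star (A y)) (star A') x :=
  (starCLM m).hasFDerivAt.comp_hasDerivAt x h

theorem contDiffOn_star {E : Type*} [NormedAddCommGroup E] [NormedSpace ℝ E] {A : E → Mat m}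
    {S : Set E} (h : ContDiffOn ℝ ∞ A S) : ContDiffOn ℝ ∞ (fun p => star (A p)) S :=
  (starCLM m).contDiff.comp_contDiffOn h

/-- Left and right multiplication. -/
theorem hasDerivAt_conj {A : ℝ → Mat m} {A' : Mat m} {x : ℝ} (B C : Mat m)
    (h : HasDerivAt A A' x) : HasDerivAt (fun y => B * A y * C) (B * A' * C) x :=
  (h.const_mul B).mul_const C

/-- The columns are unit vectors, so each entry has norm at most 1 and each row sum at most m + 2.
This is the uniform bound that `hasDerivAt_of_flat` and `contDiffOn_of_partial` ask for. -/
theorem norm_le_of_mem_unitary {A : Mat m} (h : A ∈ unitary (Mat m)) : ‖A‖ ≤ m + 2 := by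
  have h1 : ∀ i j, ‖A i j‖ ≤ 1 := by
    intro i j
    have h2 : ∑ k, star (A k j) * A k j = 1 := by
      have := congrFun (congrFun (Unitary.mem_iff.1 h).1 j) j
      simpa [Matrix.mul_apply, Matrix.star_apply] using this
    have h3 : ∀ k, star (A k j) * A k j = ((‖A k j‖ ^ 2 : ℝ) : Quat) := fun k => by
      rw [Quaternion.star_mul_self, Quaternion.normSq_eq_norm_mul_self, sq]
    simp only [h3] at h2
    have h4 : ∑ k, ‖A k j‖ ^ 2 = 1 := by
      have e := map_sum (algebraMap ℝ Quat) (fun k => ‖A k j‖ ^ 2) Finset.univ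
      exact Quaternion.coe_injective (e.trans h2)
    have h5 : ‖A i j‖ ^ 2 ≤ 1 := h4 ▸ Finset.single_le_sum
      (f := fun k => ‖A k j‖ ^ 2) (fun _ _ => sq_nonneg _) (Finset.mem_univ i)
    exact (sq_le_one_iff₀ (norm_nonneg _)).1 h5
  rw [Matrix.linfty_opNorm_def]
  have h2 : ∀ i, ∑ j, ‖A i j‖₊ ≤ (m + 2 : NNReal) := fun i => by
    calc ∑ j, ‖A i j‖₊ ≤ ∑ j : Fin (m + 2), 1 := Finset.sum_le_sum fun j _ => h1 i j
      _ = _ := by simp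
  have h3 : (Finset.univ.sup fun i => ∑ j, ‖A i j‖₊) ≤ (m + 2 : NNReal) :=
    Finset.sup_le fun i _ => h2 i
  exact_mod_cast h3

end MatrixCalculus

end

end QuatCurve

namespace QuatCurve

noncomputable section

/-! ### Block decomposition, linearity and the isotropy group of e_x -/

section BlockAlgebra

variable {m : ℕ}

/-- For an idempotent o, ad(o)² is the projection to the off-diagonal blocks, so this is the Peirce
decomposition. It is the reason why `coframe` and `connection` add up to ψ⁻¹ψ'. -/
theorem lie_lie_add_diag {R : Type*} [Ring R] {o : R} (o2 : o * o = o) (X : R) :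
    ⁅⁅X, o⁆, o⁆ + (o * X * o + (1 - o) * X * (1 - o)) = X := by
  simp only [Ring.lie_def, mul_sub, sub_mul, mul_assoc, mul_one, one_mul, o2]
  simp only [← mul_assoc, o2]
  abel

theorem lie_lie_of_offDiag {R : Type*} [Ring R] {o X : R} (o2 : o * o = o)
    (h : o * X + X * o = X) : ⁅⁅X, o⁆, o⁆ = X := by
  have h0 : o * X * o = 0 := by
    have := congrArg (fun A => o * A) h
    simpa only [mul_add, ← mul_assoc, o2, add_eq_left] using this
  have : ⁅⁅X, o⁆, o⁆ = o * (o * X) + X * o * o - 2 * (o * X * o) := by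
    simp only [Ring.lie_def]; noncomm_ring
  rw [this, h0, ← mul_assoc, mul_assoc X, o2, mul_zero, sub_zero, h]

theorem diag_of_offDiag {R : Type*} [Ring R] {o X : R} (o2 : o * o = o)
    (h : o * X + X * o = X) : o * X * o + (1 - o) * X * (1 - o) = 0 := by
  have := lie_lie_add_diag o2 X
  rwa [lie_lie_of_offDiag o2 h, add_eq_left] at this

theorem lie_lie_of_diag {R : Type*} [Ring R] {o X : R} (h : o * X = X * o) : ⁅⁅X, o⁆, o⁆ = 0 := by
  have : ⁅X, o⁆ = 0 := by rw [Ring.lie_def, h, sub_self]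
  rw [this, Ring.lie_def, zero_mul, mul_zero, sub_zero]

theorem diag_of_diag {R : Type*} [Ring R] {o X : R} (o2 : o * o = o) (h : o * X = X * o) :
    o * X * o + (1 - o) * X * (1 - o) = X := by
  have := lie_lie_add_diag o2 X
  rwa [lie_lie_of_diag h, zero_add] at this

@[simp] theorem mMat_zero_zero (a : Quat) (b : Fin m → Quat) : mMat a b 0 0 = 0 := rfl
@[simp] theorem mMat_zero_one (a : Quat) (b : Fin m → Quat) : mMat a b 0 1 = a := rfl
@[simp] theorem mMat_zero_succ (a : Quat) (b : Fin m → Quat) (l : Fin m) :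
    mMat a b 0 l.succ.succ = b l := rfl
@[simp] theorem mMat_one_zero (a : Quat) (b : Fin m → Quat) : mMat a b 1 0 = -star a := rfl
@[simp] theorem mMat_one_one (a : Quat) (b : Fin m → Quat) : mMat a b 1 1 = 0 := rfl
@[simp] theorem mMat_one_succ (a : Quat) (b : Fin m → Quat) (l : Fin m) :
    mMat a b 1 l.succ.succ = 0 := rfl
@[simp] theorem mMat_succ_zero (a : Quat) (b : Fin m → Quat) (l : Fin m) :
    mMat a b l.succ.succ 0 = -star (b l) := rfl
@[simp] theorem mMat_succ_one (a : Quat) (b : Fin m → Quat) (l : Fin m) :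
    mMat a b l.succ.succ 1 = 0 := rfl
@[simp] theorem mMat_succ_succ (a : Quat) (b : Fin m → Quat) (l k : Fin m) :
    mMat a b l.succ.succ k.succ.succ = 0 := rfl

@[simp] theorem hMat_zero_zero (p q : Quat) (h : Fin m → Quat) (H : Matrix (Fin m) (Fin m) Quat) :
    hMat p q h H 0 0 = p := rfl
@[simp] theorem hMat_zero_one (p q : Quat) (h : Fin m → Quat) (H : Matrix (Fin m) (Fin m) Quat) :
    hMat p q h H 0 1 = 0 := rfl
@[simp] theorem hMat_zero_succ (p q : Quat) (h : Fin m → Quat) (H : Matrix (Fin m) (Fin m) Quat)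
    (l : Fin m) : hMat p q h H 0 l.succ.succ = 0 := rfl
@[simp] theorem hMat_one_zero (p q : Quat) (h : Fin m → Quat) (H : Matrix (Fin m) (Fin m) Quat) :
    hMat p q h H 1 0 = 0 := rfl
@[simp] theorem hMat_one_one (p q : Quat) (h : Fin m → Quat) (H : Matrix (Fin m) (Fin m) Quat) :
    hMat p q h H 1 1 = q := rfl
@[simp] theorem hMat_one_succ (p q : Quat) (h : Fin m → Quat) (H : Matrix (Fin m) (Fin m) Quat)
    (l : Fin m) : hMat p q h H 1 l.succ.succ = h l := rfl
@[simp] theorem hMat_succ_zero (p q : Quat) (h : Fin m → Quat) (H : Matrix (Fin m) (Fin m) Quat)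
    (l : Fin m) : hMat p q h H l.succ.succ 0 = 0 := rfl
@[simp] theorem hMat_succ_one (p q : Quat) (h : Fin m → Quat) (H : Matrix (Fin m) (Fin m) Quat)
    (l : Fin m) : hMat p q h H l.succ.succ 1 = -star (h l) := rfl
@[simp] theorem hMat_succ_succ (p q : Quat) (h : Fin m → Quat) (H : Matrix (Fin m) (Fin m) Quat)
    (l k : Fin m) : hMat p q h H l.succ.succ k.succ.succ = H l k := rfl

theorem fin_cases_two {P : Fin (m + 2) → Prop} (h0 : P 0) (h1 : P 1)
    (h2 : ∀ l : Fin m, P l.succ.succ) (i : Fin (m + 2)) : P i :=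
  Fin.cases h0 (fun i => Fin.cases h1 h2 i) i

theorem mat_ext {X Y : Mat m} (h00 : X 0 0 = Y 0 0) (h01 : X 0 1 = Y 0 1)
    (h0 : ∀ l : Fin m, X 0 l.succ.succ = Y 0 l.succ.succ)
    (h10 : X 1 0 = Y 1 0) (h11 : X 1 1 = Y 1 1)
    (h1 : ∀ l : Fin m, X 1 l.succ.succ = Y 1 l.succ.succ)
    (hl0 : ∀ l : Fin m, X l.succ.succ 0 = Y l.succ.succ 0)
    (hl1 : ∀ l : Fin m, X l.succ.succ 1 = Y l.succ.succ 1)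
    (hl : ∀ l k : Fin m, X l.succ.succ k.succ.succ = Y l.succ.succ k.succ.succ) : X = Y := by
  ext1 i j
  revert i j
  exact fin_cases_two (fin_cases_two h00 h01 h0) (fin_cases_two h10 h11 h1)
    fun l => fin_cases_two (hl0 l) (hl1 l) (hl l)

theorem mul_apply_two (X Y : Mat m) (i j : Fin (m + 2)) :
    (X * Y) i j = X i 0 * Y 0 j + X i 1 * Y 1 j + ∑ l : Fin m, X i l.succ.succ * Y l.succ.succ j := by
  rw [Matrix.mul_apply, Fin.sum_univ_succ, Fin.sum_univ_succ, ← add_assoc]; rfl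

theorem origin_mul_apply (X : Mat m) (i j : Fin (m + 2)) :
    (origin m * X) i j = if i = 0 then X 0 j else 0 := by
  by_cases h : i = 0
  · subst h; simp [origin]
  · simp [origin, h]

theorem mul_origin_apply (X : Mat m) (i j : Fin (m + 2)) :
    (X * origin m) i j = if j = 0 then X i 0 else 0 := by
  by_cases h : j = 0
  · subst h; simp [origin]
  · simp [origin, h]

theorem mMat_offDiag (a : Quat) (b : Fin m → Quat) :
    origin m * mMat a b + mMat a b * origin m = mMat a b := by
  apply mat_ext <;> intros <;> simp [origin_mul_apply, mul_origin_apply]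

theorem hMat_diag (p q : Quat) (h : Fin m → Quat) (H : Matrix (Fin m) (Fin m) Quat) :
    origin m * hMat p q h H = hMat p q h H * origin m := by
  apply mat_ext <;> intros <;> simp [origin_mul_apply, mul_origin_apply]

theorem ex_offDiag : origin m * ex m + ex m * origin m = ex m := by
  rw [ex, mul_smul_comm, smul_mul_assoc, ← smul_add, mMat_offDiag]

theorem star_mMat (a : Quat) (b : Fin m → Quat) : star (mMat a b) = -mMat a b := by
  apply mat_ext <;> intros <;> simp [Matrix.star_apply]

theorem star_ex : star (ex m) = -ex m := by rw [ex, star_smul, star_mMat, smul_neg]; simp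

theorem star_perpMat (v : Cov m) : star (perpMat v) = -perpMat v := by
  have hq : star (v.1 : Quat) = -(v.1 : Quat) := skewAdjoint.mem_iff.1 v.1.2
  apply mat_ext <;> intros <;> simp [Matrix.star_apply, perpMat, hq]

theorem star_parMat (w : ImQuat × UAlg m) : star (parMat w) = -parMat w := by
  have hq : star (w.1 : Quat) = -(w.1 : Quat) := skewAdjoint.mem_iff.1 w.1.2
  have hW : star (w.2 : Matrix (Fin m) (Fin m) Quat) = -(w.2 : Matrix (Fin m) (Fin m) Quat) :=
    skewAdjoint.mem_iff.1 w.2.2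
  have hW' : ∀ l k, star ((w.2 : Matrix (Fin m) (Fin m) Quat) k l)
      = -(w.2 : Matrix (Fin m) (Fin m) Quat) l k := fun l k => congrFun (congrFun hW l) k
  apply mat_ext <;> intros <;> simp [Matrix.star_apply, parMat, hq, hW']

theorem star_adInvH (v : Cov m) : star (adInvH v) = -adInvH v := by
  rw [adInvH, star_smul, star_mMat, smul_neg]; simp

/-! ### Linearity -/

/-- `perpMat` as a linear map. -/
def perpLin (m : ℕ) : Cov m →ₗ[ℝ] Mat m where
  toFun := perpMat
  map_add' v w := by apply mat_ext <;> intros <;> simp [perpMat] <;> abel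
  map_smul' r v := by apply mat_ext <;> intros <;> simp [perpMat]

@[simp] theorem perpLin_apply (v : Cov m) : perpLin m v = perpMat v := rfl

/-- `adInvH` as a linear map. -/
def adInvHLin (m : ℕ) : Cov m →ₗ[ℝ] Mat m where
  toFun := adInvH
  map_add' v w := by apply mat_ext <;> intros <;> simp [adInvH] <;> abel
  map_smul' r v := by
    apply mat_ext <;> intros <;> simp [adInvH] <;>
    simp only [smul_smul] <;> congr 1 <;> try ring

/-- The imaginary part of a quaternion. -/
def imLin : Quat →ₗ[ℝ] ImQuat where
  toFun q := ⟨(1 / 2 : ℝ) • (q - star q), skewAdjoint.mem_iff.2 (by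
    rw [star_smul, star_sub, star_star, ← smul_neg, neg_sub]; simp)⟩
  map_add' p q := Subtype.ext (by
    change (1 / 2 : ℝ) • (p + q - star (p + q)) = (1 / 2 : ℝ) • (p - star p) + (1 / 2 : ℝ) • (q - star q)
    rw [star_add, ← smul_add]; congr 1; abel)
  map_smul' r q := Subtype.ext (by
    change (1 / 2 : ℝ) • (r • q - star (r • q)) = r • ((1 / 2 : ℝ) • (q - star q))
    rw [Quaternion.star_smul, ← smul_sub, smul_comm])

theorem imLin_coe (v : ImQuat) : imLin (v : Quat) = v := Subtype.ext (by
  have hq : star (v : Quat) = -(v : Quat) := skewAdjoint.mem_iff.1 v.2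
  change (1 / 2 : ℝ) • ((v : Quat) - star (v : Quat)) = v
  rw [hq, sub_neg_eq_add, ← two_smul ℝ (v : Quat), smul_smul]
  norm_num)

/-- The components in `Im ℍ ⊕ ℍⁿ⁻¹` of the `𝔥_⊥`-part of a matrix. -/
def compLin (m : ℕ) : Mat m →ₗ[ℝ] Cov m where
  toFun X := (imLin (X 0 0), fun l => X 1 l.succ.succ)
  map_add' X Y := by
    refine Prod.ext ?_ rfl
    exact map_add imLin _ _
  map_smul' r X := by
    refine Prod.ext ?_ rfl
    exact map_smul imLin _ _

@[simp] theorem compLin_perpMat (v : Cov m) : compLin m (perpMat v) = v :=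
  Prod.ext (imLin_coe v.1) rfl

/-- `adInvM` as a linear map. -/
def adInvMLin (m : ℕ) : Mat m →ₗ[ℝ] Mat m where
  toFun := adInvM
  map_add' X Y := by apply mat_ext <;> intros <;> simp [adInvM] <;> abel
  map_smul' r X := by
    apply mat_ext <;> intros <;> simp [adInvM] <;>
    simp only [smul_smul] <;> congr 1 <;> try ring

@[simp] theorem adInvMLin_apply (X : Mat m) : adInvMLin m X = adInvM X := rfl

theorem perpMat_injective : Function.Injective (perpMat : Cov m → Mat m) := fun v w h => by
  rw [← compLin_perpMat v, h, compLin_perpMat]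

theorem sqrt_chi_pos : 0 < Real.sqrt (chi m) := Real.sqrt_pos.2 (chi_pos m)

theorem sqrt_chi_ne : Real.sqrt (chi m) ≠ 0 := sqrt_chi_pos.ne'

/-- The element of `𝔥_⊥` that `adInvM` gives. -/
theorem adInvM_mMat (a : ImQuat) (b : Fin m → Quat) :
    adInvM (mMat (a : Quat) b) =
      perpMat (Real.sqrt (chi m) • (-((1 / 2 : ℝ) • a)), Real.sqrt (chi m) • b) := by
  apply mat_ext <;> intros <;> simp [adInvM, perpMat]

/-- Since e⌋∇_xγ_x = [u, e_x] in a parallel frame, this recovers the covariants from the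
second-order data of the curve. -/
theorem adInvM_lie_ex (v : Cov m) : -adInvM ⁅perpMat v, ex m⁆ = perpMat v := by
  have h : perpMat v = adInvM (mMat ((-(2 * (Real.sqrt (chi m))⁻¹) • v.1 : ImQuat) : Quat)
      ((Real.sqrt (chi m))⁻¹ • v.2)) := by
    rw [adInvM_mMat]
    congr 1
    ext1
    · simp only [smul_smul, ← neg_smul]
      rw [show Real.sqrt (chi m) * -(1 / 2 * -(2 * (Real.sqrt (chi m))⁻¹)) = 1 by
        field_simp [sqrt_chi_ne], one_smul]
    · simp [smul_smul, mul_inv_cancel₀ (sqrt_chi_ne (m := m))]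
  have h2 : ⁅perpMat v, ex m⁆ = -⁅ex m, perpMat v⁆ := by
    rw [Ring.lie_def, Ring.lie_def, neg_sub]
  rw [h2, h, ad_adInvM, ← adInvMLin_apply, map_neg, neg_neg, adInvMLin_apply]

theorem mMat_eq_smul_ex : mMat 1 (0 : Fin m → Quat) = Real.sqrt (chi m) • ex m := by
  rw [ex, smul_smul, mul_inv_cancel₀ sqrt_chi_ne, one_smul]

/-! ### The isotropy group of `e_x` -/

/-- The element `(a, a, 𝟎, A)` of `U(1, ℍ) × U(n-1, ℍ)`. -/
def isoMat (a : Quat) (A : Matrix (Fin m) (Fin m) Quat) : Mat m := hMat a a 0 A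

theorem star_isoMat (a : Quat) (A : Matrix (Fin m) (Fin m) Quat) :
    star (isoMat a A) = isoMat (star a) (star A) := by
  apply mat_ext <;> intros <;> simp [Matrix.star_apply, isoMat]

theorem isoMat_mul (a b : Quat) (A B : Matrix (Fin m) (Fin m) Quat) :
    isoMat a A * isoMat b B = isoMat (a * b) (A * B) := by
  apply mat_ext <;> intros <;> simp only [mul_apply_two] <;> simp [isoMat, Matrix.mul_apply]

theorem isoMat_one : isoMat (1 : Quat) (1 : Matrix (Fin m) (Fin m) Quat) = 1 := by
  apply mat_ext <;> intros <;> simp [isoMat, Matrix.one_apply, Fin.ext_iff]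

theorem isoMat_injective {a b : Quat} {A B : Matrix (Fin m) (Fin m) Quat}
    (h : isoMat a A = isoMat b B) : a = b ∧ A = B :=
  ⟨congrFun (congrFun h 0) 0, by
    ext1 l k; exact congrFun (congrFun h l.succ.succ) k.succ.succ⟩

theorem isoMat_mem (a : unitary Quat) (A : unitary (Matrix (Fin m) (Fin m) Quat)) :
    isoMat (a : Quat) (A : Matrix (Fin m) (Fin m) Quat) ∈ UGroup m := by
  rw [Unitary.mem_iff, star_isoMat, isoMat_mul, isoMat_mul, (Unitary.mem_iff.1 a.2).1,
    (Unitary.mem_iff.1 a.2).2, (Unitary.mem_iff.1 A.2).1, (Unitary.mem_iff.1 A.2).2, isoMat_one]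
  exact ⟨rfl, rfl⟩

theorem mem_of_isoMat {a : Quat} {A : Matrix (Fin m) (Fin m) Quat} (h : isoMat a A ∈ UGroup m) :
    a ∈ unitary Quat ∧ A ∈ unitary (Matrix (Fin m) (Fin m) Quat) := by
  rw [Unitary.mem_iff, star_isoMat, isoMat_mul, isoMat_mul, ← isoMat_one] at h
  have h1 := isoMat_injective h.1
  have h2 := isoMat_injective h.2
  exact ⟨Unitary.mem_iff.2 ⟨h1.1, h2.1⟩, Unitary.mem_iff.2 ⟨h1.2, h2.2⟩⟩

theorem isoMat_origin (a : Quat) (A : Matrix (Fin m) (Fin m) Quat) :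
    origin m * isoMat a A = isoMat a A * origin m := hMat_diag _ _ _ _

theorem isoMat_ex (a : Quat) (A : Matrix (Fin m) (Fin m) Quat) :
    isoMat a A * ex m = ex m * isoMat a A := by
  rw [ex, mul_smul_comm, smul_mul_assoc]
  congr 1
  apply mat_ext <;> intros <;> simp [mul_apply_two, isoMat]

/-- The centraliser of `o` and `e_x`. -/
theorem exists_isoMat {X : Mat m} (ho : origin m * X = X * origin m)
    (he : X * ex m = ex m * X) :
    X = isoMat (X 0 0) (Matrix.of fun i j => X i.succ.succ j.succ.succ) := by
  have ho' : ∀ i j, (if i = 0 then X 0 j else 0) = if j = 0 then X i 0 else 0 := fun i j => by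
    rw [← origin_mul_apply, ho, mul_origin_apply]
  have he' : X * mMat 1 0 = mMat 1 0 * X := by
    rw [mMat_eq_smul_ex, mul_smul_comm, he, smul_mul_assoc]
  have h01 : X 0 1 = 0 := by simpa using ho' 0 1
  have h0 : ∀ l : Fin m, X 0 l.succ.succ = 0 := fun l => by simpa using ho' 0 l.succ.succ
  have h10 : X 1 0 = 0 := by simpa using (ho' 1 0).symm
  have hl0 : ∀ l : Fin m, X l.succ.succ 0 = 0 := fun l => by simpa using (ho' l.succ.succ 0).symm
  -- Commuting with o has removed the off-diagonal blocks. Commuting with (1, 0) identifies the two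
  -- corner entries and removes the rest of row and column 1.
  have e : ∀ i j : Fin (m + 2), (X * mMat 1 0 : Mat m) i j = (mMat 1 0 * X : Mat m) i j := fun i j => by rw [he']
  simp only [mul_apply_two] at e
  have h11 : X 1 1 = X 0 0 := by simpa using (e 0 1).symm
  have h1 : ∀ l : Fin m, X 1 l.succ.succ = 0 := fun l => by simpa using (e 0 l.succ.succ).symm
  have hl1 : ∀ l : Fin m, X l.succ.succ 1 = 0 := fun l => by simpa using e l.succ.succ 0
  apply mat_ext <;> intros <;> simp [isoMat, *]

/-- The block is star A because `act` multiplies the vector part by A on the right, and conjugation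
puts the adjoint of the block there. -/
theorem isoMat_conj_perpMat (a : unitary Quat) (A : unitary (Matrix (Fin m) (Fin m) Quat))
    (v : Cov m) :
    isoMat (a : Quat) (star (A : Matrix (Fin m) (Fin m) Quat)) * perpMat v
      * star (isoMat (a : Quat) (star (A : Matrix (Fin m) (Fin m) Quat))) = perpMat (act a A v) := by
  rw [star_isoMat]
  apply mat_ext <;> intros <;>
    simp [mul_apply_two, isoMat, perpMat, act, Matrix.vecMul, dotProduct, Matrix.star_apply,
      Finset.sum_mul, mul_assoc]

theorem isoMat_conj_adInvH (a : unitary Quat) (A : unitary (Matrix (Fin m) (Fin m) Quat))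
    (v : Cov m) :
    isoMat (a : Quat) (star (A : Matrix (Fin m) (Fin m) Quat)) * adInvH v
      * star (isoMat (a : Quat) (star (A : Matrix (Fin m) (Fin m) Quat))) = adInvH (act a A v) := by
  rw [star_isoMat, adInvH, adInvH, mul_smul_comm, smul_mul_assoc]
  congr 1
  apply mat_ext <;> intros <;>
    simp [mul_apply_two, isoMat, mMat, act, Matrix.vecMul, dotProduct, Matrix.star_apply,
      Finset.sum_mul, mul_assoc]

/-- Conjugation by a unit quaternion preserves the real part. Hence the integrand of the nonlocal
term does not see the choice of frame. -/
theorem mParCoeff_isoMat_conj (a : unitary Quat) (A : Matrix (Fin m) (Fin m) Quat) (X : Mat m) :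
    mParCoeff (isoMat (a : Quat) A * X * star (isoMat (a : Quat) A)) = mParCoeff X := by
  have h : (isoMat (a : Quat) A * X * star (isoMat (a : Quat) A)) 0 1
      = (a : Quat) * X 0 1 * star (a : Quat) := by
    rw [star_isoMat]; simp [mul_apply_two, isoMat]
  have h2 : ∀ p q : Quat, (p * q).re = (q * p).re := fun p q => by
    simp only [Quaternion.re_mul]; ring
  rw [mParCoeff, h, h2, ← mul_assoc, (Unitary.mem_iff.1 a.2).1, one_mul, mParCoeff]

theorem exists_conj_act (a : unitary Quat) (A : unitary (Matrix (Fin m) (Fin m) Quat)) :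
    ∃ B C : Mat m, ∀ v : Cov m, perpMat (act a A v) = B * perpMat v * C :=
  ⟨_, _, fun v => (isoMat_conj_perpMat a A v).symm⟩

/-- The action on covariants as a linear map. -/
def actLin (a : unitary Quat) (A : unitary (Matrix (Fin m) (Fin m) Quat)) : Cov m →ₗ[ℝ] Cov m where
  toFun := act a A
  map_add' v w := perpMat_injective (by
    obtain ⟨B, C, h⟩ := exists_conj_act a A
    have hadd : ∀ v w : Cov m, perpMat (v + w) = perpMat v + perpMat w := (perpLin m).map_add
    rw [hadd, h, h, h, hadd, mul_add, add_mul])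
  map_smul' r v := perpMat_injective (by
    obtain ⟨B, C, h⟩ := exists_conj_act a A
    have hsmul : ∀ (r : ℝ) (v : Cov m), perpMat (r • v) = r • perpMat v := (perpLin m).map_smul
    rw [RingHom.id_apply, hsmul, h, h, hsmul, mul_smul_comm, smul_mul_assoc])

theorem isoMat_conj_mMat_one {a : Quat} {A : Matrix (Fin m) (Fin m) Quat}
    (h : isoMat a A ∈ UGroup m) : isoMat a A * mMat 1 0 * star (isoMat a A) = mMat 1 0 := by
  rw [mMat_eq_smul_ex, mul_smul_comm, isoMat_ex, smul_mul_assoc, mul_assoc,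
    (Unitary.mem_iff.1 h).2, mul_one]

/-- `𝔥_⊥ ∩ 𝔥_∥ = 0`. -/
theorem perpMat_eq_isoMat {v : Cov m} {p : Quat} {P : Matrix (Fin m) (Fin m) Quat}
    (h : perpMat v = isoMat p P) : isoMat p P = 0 := by
  have h00 : (v.1 : Quat) = p := congrFun (congrFun h 0) 0
  have h11 : -(v.1 : Quat) = p := congrFun (congrFun h 1) 1
  have hP : 0 = P := by ext1 l k; exact congrFun (congrFun h l.succ.succ) k.succ.succ
  have hp : p = 0 := by
    rw [← h00] at h11 ⊢
    have h2 : (2 : ℝ) • (v.1 : Quat) = 0 := by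
      rw [two_smul]; nth_rewrite 1 [← h11]; exact neg_add_cancel _
    exact (smul_eq_zero.1 h2).resolve_left two_ne_zero
  rw [hp, ← hP]
  apply mat_ext <;> intros <;> simp [isoMat]

end BlockAlgebra

end

end QuatCurve

namespace QuatCurve

noncomputable section

/-! ### Completing a quaternionic unit vector to a unitary matrix -/

section UnitaryCompletion

theorem star_mul_self_eq (q : Quat) : star q * q = ((‖q‖ ^ 2 : ℝ) : Quat) := by
  rw [Quaternion.star_mul_self, Quaternion.normSq_eq_norm_mul_self, sq]

theorem self_mul_star_eq (q : Quat) : q * star q = ((‖q‖ ^ 2 : ℝ) : Quat) := by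
  rw [Quaternion.self_mul_star, Quaternion.normSq_eq_norm_mul_self, sq]

theorem sum_star_mul_self {k : Type*} [Fintype k] (x : k → Quat) :
    ∑ i, star (x i) * x i = ((∑ i, ‖x i‖ ^ 2 : ℝ) : Quat) := by
  simp only [star_mul_self_eq]
  exact (map_sum (algebraMap ℝ Quat) (fun i => ‖x i‖ ^ 2) Finset.univ).symm

/-- Over ℍ a reflection can exchange q e_k and x only if their inner product is real, so the phase
of x_k has to be absorbed in q. The minus sign keeps q e_k - x away from zero and avoids a case
distinction. -/
theorem exists_unit_phase (p : Quat) : ∃ q : Quat, star q * q = 1 ∧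
    star q * p = ((-‖p‖ : ℝ) : Quat) := by
  by_cases hp : p = 0
  · exact ⟨1, by simp, by simp [hp]⟩
  · have hp' : ‖p‖ ≠ 0 := norm_ne_zero_iff.2 hp
    refine ⟨-(‖p‖⁻¹ • p), ?_, ?_⟩
    · rw [star_neg, neg_mul_neg, Quaternion.star_smul, smul_mul_smul_comm, star_mul_self_eq,
        Quaternion.smul_coe, ← Quaternion.coe_one]
      congr 1; field_simp
    · rw [star_neg, neg_mul, Quaternion.star_smul, smul_mul_assoc, star_mul_self_eq,
        Quaternion.smul_coe, ← Quaternion.coe_neg]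
      congr 1; field_simp

/-- A unit vector `x ∈ ℍᴺ` is the `k`-th column of a unitary matrix which fixes the basis vectors
`e_j`, `j ≠ k`, with `x_j = 0`. -/
theorem exists_unitary_col {N : ℕ} (k : Fin N) (x : Fin N → Quat) (hx : ∑ i, ‖x i‖ ^ 2 = 1) :
    ∃ U ∈ unitary (Matrix (Fin N) (Fin N) Quat), (∀ i, U i k = x i) ∧
      ∀ j, j ≠ k → x j = 0 → ∀ i, U i j = (1 : Matrix (Fin N) (Fin N) Quat) i j := by
  obtain ⟨q, hq1, hq2⟩ := exists_unit_phase (x k)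
  have hq3 : q * star q = 1 := mul_eq_one_comm.1 hq1
  have hq4 : star (x k) * q = ((-‖x k‖ : ℝ) : Quat) := by
    have := congrArg star hq2
    simpa using this
  set r := ‖x k‖
  have hr : 0 ≤ r := norm_nonneg _
  -- Householder vector: the reflection in the hyperplane orthogonal to z exchanges q e_k and x.
  -- Where x_j = 0 and j ≠ k, z_j vanishes, so e_j is fixed.
  let z : Fin N → Quat := fun i => (if i = k then q else 0) - x i
  have hz : ∑ i, star (z i) * z i = ((2 * (1 + r) : ℝ) : Quat) := by
    have h1 : ∀ i, star (z i) * z i = (if i = k then star q * q - star q * x k - star (x k) * q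
        else 0) + star (x i) * x i := by
      intro i
      by_cases h : i = k
      · subst h; simp only [z, if_true, star_sub]; noncomm_ring
      · simp [z, h]
    simp only [h1]
    rw [Finset.sum_add_distrib, Finset.sum_ite_eq' Finset.univ k, if_pos (Finset.mem_univ k),
      sum_star_mul_self, hx, hq1, hq2, hq4]
    rw [← Quaternion.coe_one, ← Quaternion.coe_sub, ← Quaternion.coe_sub, ← Quaternion.coe_add]
    congr 1; ring
  -- This is 2 / |z|², since |z|² = 2(1 + r).
  let c : ℝ := (1 + r)⁻¹
  have hc : c * (1 + r) = 1 := inv_mul_cancel₀ (by positivity)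
  let V : Matrix (Fin N) (Fin N) Quat := Matrix.vecMulVec z (star z)
  have hVs : star V = V := by
    ext1 i j; simp [V, Matrix.star_apply, Matrix.vecMulVec_apply]
  have hVV : V * V = (2 * (1 + r) : ℝ) • V := by
    ext1 i j
    have : ∀ l, z i * star (z l) * (z l * star (z j)) = z i * (star (z l) * z l) * star (z j) :=
      fun l => by simp only [mul_assoc]
    simp only [V, Matrix.mul_apply, Matrix.vecMulVec_apply, Pi.star_apply, Matrix.smul_apply, this]
    rw [← Finset.sum_mul, ← Finset.mul_sum, hz, Quaternion.mul_coe_eq_smul, smul_mul_assoc]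
  let H : Matrix (Fin N) (Fin N) Quat := 1 - c • V
  have hHs : star H = H := by
    simp only [H, star_sub, star_one, star_smul, hVs]; simp
  have hHH : H * H = 1 := by
    have : H * H = 1 - (2 * c) • V + (c * c) • (V * V) := by
      simp only [H, mul_sub, sub_mul, mul_one, one_mul, smul_mul_smul_comm, two_mul, add_smul]
      abel
    rw [this, hVV, smul_smul, show c * c * (2 * (1 + r)) = 2 * c * (c * (1 + r)) by ring, hc,
      mul_one, sub_add_cancel]
  -- The reflection sends q e_k, not e_k, to x; the diagonal factor turns e_k into q e_k first.
  let D : Matrix (Fin N) (Fin N) Quat := Matrix.diagonal fun i => if i = k then q else 1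
  have hDs : star D = Matrix.diagonal fun i => if i = k then star q else 1 := by
    rw [Matrix.star_eq_conjTranspose, Matrix.diagonal_conjTranspose]
    congr 1; funext i; simp only [Pi.star_apply]; split_ifs <;> simp
  have hD1 : star D * D = 1 := by
    rw [hDs, Matrix.diagonal_mul_diagonal, ← Matrix.diagonal_one]
    congr 1; funext i; split_ifs <;> simp [hq1]
  have hD2 : D * star D = 1 := by
    rw [hDs, Matrix.diagonal_mul_diagonal, ← Matrix.diagonal_one]
    congr 1; funext i; split_ifs <;> simp [hq3]
  have hHu : H ∈ unitary (Matrix (Fin N) (Fin N) Quat) :=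
    Unitary.mem_iff.2 ⟨by rw [hHs, hHH], by rw [hHs, hHH]⟩
  refine ⟨H * D, mul_mem hHu (Unitary.mem_iff.2 ⟨hD1, hD2⟩), fun i => ?_, fun j hj hxj i => ?_⟩
  · have h1 : star (z k) * q = ((1 + r : ℝ) : Quat) := by
      simp only [z, if_true, star_sub, sub_mul, hq1, hq4]
      rw [← Quaternion.coe_one, ← Quaternion.coe_sub]; congr 1; ring
    rw [Matrix.mul_diagonal, if_pos rfl]
    simp only [H, V, Matrix.sub_apply, Matrix.smul_apply, Matrix.vecMulVec_apply, Pi.star_apply]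
    rw [sub_mul, smul_mul_assoc, mul_assoc, h1, Quaternion.mul_coe_eq_smul, smul_smul, hc, one_smul]
    by_cases h : i = k
    · subst h; simp [z]
    · simp [z, h]
  · have hzj : z j = 0 := by simp [z, hj, hxj]
    rw [Matrix.mul_diagonal, if_neg hj, mul_one]
    simp [H, V, Matrix.vecMulVec_apply, hzj]

end UnitaryCompletion

/-! ### Frames at a point adapted to a unit tangent vector -/

section InitialFrame

variable {m : ℕ}

theorem re_sum {k : Type*} (s : Finset k) (f : k → Quat) : (∑ i ∈ s, f i).re = ∑ i ∈ s, (f i).re :=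
  map_sum (AddMonoidHom.mk' (fun q : Quat => q.re) fun _ _ => rfl) f s

theorem conj_mul_conj {U : Mat m} (hU : U ∈ UGroup m) (A B : Mat m) :
    star U * A * U * (star U * B * U) = star U * (A * B) * U := by
  have h2 : U * star U = 1 := (Unitary.mem_iff.1 hU).2
  calc _ = star U * A * (U * star U) * B * U := by simp only [mul_assoc]
    _ = _ := by rw [h2, mul_one]; simp only [mul_assoc]

theorem metric_conj {U : Mat m} (hU : U ∈ UGroup m) (A B : Mat m) :
    metric (star U * A * U) (star U * B * U) = metric A B := by
  have h2 : U * star U = 1 := (Unitary.mem_iff.1 hU).2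
  rw [metric, metric, conj_mul_conj hU, re_trace_mul_comm, ← mul_assoc U, h2, one_mul]

/-- At the origin, the metric in terms of the first columns. -/
theorem metric_self_of_offDiag {W : Mat m} (hs : star W = W)
    (h : origin m * W + W * origin m = W) (h0 : origin m * W * origin m = 0) :
    metric W W = chi m * ∑ i, ‖W i 0‖ ^ 2 := by
  have h00 : W 0 0 = 0 := by
    have := congrFun (congrFun h0 0) 0
    simpa [mul_origin_apply, origin_mul_apply] using this
  have hst : ∀ i j, star (W j i) = W i j := fun i j => congrFun (congrFun hs i) j
  have hij : ∀ i j, i ≠ 0 → j ≠ 0 → W i j = 0 := fun i j hi hj => by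
    have := congrFun (congrFun h i) j
    simpa [mul_origin_apply, origin_mul_apply, hi, hj] using this.symm
  have h1 : (Matrix.trace (W * W)).re = ∑ i, ∑ j, ‖W i j‖ ^ 2 := by
    simp only [Matrix.trace, Matrix.diag, Matrix.mul_apply, re_sum]
    refine Finset.sum_congr rfl fun i _ => Finset.sum_congr rfl fun j _ => ?_
    rw [← hst j i, self_mul_star_eq, Quaternion.re_coe]
  have h2 : ∑ i, ∑ j, ‖W i j‖ ^ 2 = 2 * ∑ i, ‖W i 0‖ ^ 2 := by
    have hrow : ∀ i : Fin (m + 1), ∑ j, ‖W i.succ j‖ ^ 2 = ‖W i.succ 0‖ ^ 2 := fun i => by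
      rw [Fin.sum_univ_succ, Finset.sum_eq_zero fun j _ => by
        rw [hij _ _ (Fin.succ_ne_zero i) (Fin.succ_ne_zero j)]; simp, add_zero]
    have hcol : ∀ j, ‖W 0 j‖ = ‖W j 0‖ := fun j => by rw [← hst 0 j, norm_star]
    rw [Fin.sum_univ_succ (fun i => ∑ j, ‖W i j‖ ^ 2), Fin.sum_univ_succ (fun i => ‖W i 0‖ ^ 2)]
    simp only [hrow, hcol]
    rw [Fin.sum_univ_succ, h00]
    simp; ring
  rw [metric, h1, h2, chi]; ring

/-- Existence of a unitary frame at a point which is adapted to a unit tangent vector. -/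
theorem exists_adapted_frame {P Z : Mat m} (hP : P ∈ HP m) (hZ : Z ∈ tangent P)
    (hu : metric Z Z = 1) :
    ∃ ψ ∈ UGroup m, P = ψ * origin m * star ψ ∧ coframe ψ Z = ex m := by
  obtain ⟨v, hv, rfl⟩ := hP
  -- U₁ moves the origin to P. A second factor U₂ that fixes the origin will then rotate the tangent
  -- vector to the direction of e_x.
  obtain ⟨U₁, hU₁, hU₁v, -⟩ := exists_unitary_col (0 : Fin (m + 2)) v hv
  have horig : ∀ (U : Mat m) (x : Fin (m + 2) → Quat), (∀ i, U i 0 = x i) →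
      Matrix.vecMulVec x (star x) = U * origin m * star U := fun U x hx => by
    ext1 i j
    rw [Matrix.mul_assoc, Matrix.mul_apply, Finset.sum_eq_single 0]
    · simp [origin_mul_apply, Matrix.vecMulVec_apply, hx]
    · intro k _ hk; simp [origin_mul_apply, hk]
    · simp
  have hP1 := horig U₁ v hU₁v
  rw [hP1] at hZ ⊢
  obtain ⟨-, hWo, hW0⟩ := tangent_pull ⟨U₁, hU₁⟩ Z hZ
  have hWm := metric_conj hU₁ Z Z
  simp only at hWo hW0 hWm
  have hWs : star (star U₁ * Z * U₁) = star U₁ * Z * U₁ := by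
    simp only [star_mul, star_star, hZ.1, mul_assoc]
  rw [hu, metric_self_of_offDiag hWs hWo hW0] at hWm
  generalize hW : star U₁ * Z * U₁ = W at *
  have hW00 : W 0 0 = 0 := by
    have := congrFun (congrFun hW0 0) 0
    simpa [mul_origin_apply, origin_mul_apply] using this
  let s := Real.sqrt (chi m)
  have hs : s ≠ 0 := sqrt_chi_ne
  -- The first column w of W satisfies χ|w|² = 1, so √χ w is a unit vector. The sign makes the (0,
  -- 1) entry of [V, o] = Vo - oV positive, as in e_x. Since w_0 = 0, U₂ fixes e_0.
  obtain ⟨U₂, hU₂, hU₂1, hU₂0⟩ := exists_unitary_col (1 : Fin (m + 2)) (fun i => -(s • W i 0)) (by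
    simp only [norm_neg, norm_smul, mul_pow, ← Finset.mul_sum]
    rw [Real.norm_eq_abs, sq_abs, Real.sq_sqrt (chi_pos m).le, hWm])
  have hU₂0' := hU₂0 0 (by simp) (by simp [hW00])
  have h1 : star U₂ * U₂ = 1 := (Unitary.mem_iff.1 hU₂).1
  have ho2 : U₂ * origin m * star U₂ = origin m := by
    rw [← horig U₂ (fun i => (1 : Mat m) i 0) hU₂0', horig 1 (fun i => (1 : Mat m) i 0) fun _ => rfl]
    simp
  have hoc : origin m * U₂ = U₂ * origin m := by
    conv_lhs => rw [← ho2]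
    rw [mul_assoc, h1, mul_one]
  have hoc' : star U₂ * origin m = origin m * star U₂ := by
    have := congrArg star hoc
    simpa [star_mul, star_origin] using this
  refine ⟨U₁ * U₂, mul_mem hU₁ hU₂, ?_, ?_⟩
  · rw [star_mul, show U₁ * U₂ * origin m * (star U₂ * star U₁)
      = U₁ * (U₂ * origin m * star U₂) * star U₁ by simp only [mul_assoc], ho2]
  · have hV : star (U₁ * U₂) * Z * (U₁ * U₂) = star U₂ * W * U₂ := by
      rw [← hW, star_mul]; simp only [mul_assoc]
    have hVo : origin m * (star U₂ * W * U₂) + star U₂ * W * U₂ * origin m = star U₂ * W * U₂ := by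
      conv_rhs => rw [← hWo]
      rw [← mul_assoc, ← mul_assoc, ← hoc', mul_assoc _ U₂ (origin m), ← hoc]
      simp only [mul_add, add_mul, mul_assoc]
    have hVs : star (star U₂ * W * U₂) = star U₂ * W * U₂ := by
      simp only [star_mul, star_star, hWs, mul_assoc]
    have hVc : ∀ i, (star U₂ * W * U₂) i 0 = -(s⁻¹ • (1 : Mat m) i 1) := fun i => by
      have e1 : (star U₂ * W * U₂) i 0 = (star U₂ * W) i 0 := by
        rw [Matrix.mul_apply]
        simp only [hU₂0', Matrix.one_apply]
        simp
      have e2 : ∀ k, W k 0 = -(s⁻¹ • U₂ k 1) := fun k => by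
        rw [hU₂1, smul_neg, neg_neg, smul_smul, inv_mul_cancel₀ hs, one_smul]
      rw [e1, Matrix.mul_apply]
      simp only [e2, mul_neg, mul_smul_comm, Finset.sum_neg_distrib, ← Finset.smul_sum]
      rw [← Matrix.mul_apply, h1]
    rw [coframe, hV, Ring.lie_def]
    generalize star U₂ * W * U₂ = V at *
    have hVr : ∀ j, V 0 j = -(s⁻¹ • (1 : Mat m) j 1) := fun j => by
      rw [← hVs, Matrix.star_apply, hVc, star_neg, Quaternion.star_smul]
      congr 2
      by_cases hj : j = 1 <;> simp [Matrix.one_apply, hj]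
    apply mat_ext <;> intros <;>
      simp [mul_origin_apply, origin_mul_apply, hVc, hVr, ex, s, Fin.ext_iff]

end InitialFrame

end

end QuatCurve

namespace QuatCurve

noncomputable section

open Topology Filter

attribute [local instance] Matrix.linftyOpNormedRing Matrix.linftyOpNormedAlgebra

/-! ### Moving frames as solutions of linear equations -/

section Frames

variable {m : ℕ}

theorem eq_of_hasDerivAt_zero {I : Set ℝ} (hIc : I.OrdConnected) {f : ℝ → Mat m}
    (h : ∀ x ∈ I, HasDerivAt f 0 x) {x y : ℝ} (hx : x ∈ I) (hy : y ∈ I) : f x = f y := by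
  have := hIc.convex.norm_image_sub_le_of_norm_hasDerivWithin_le (f := f) (f' := fun _ => 0)
    (C := 0) (fun z hz => (h z hz).hasDerivWithinAt) (fun _ _ => by simp) hy hx
  rw [zero_mul] at this
  exact sub_eq_zero.1 (norm_le_zero_iff.1 this)

/-- The derivative of ψψ* is ψ(A + A*)ψ*, which vanishes. -/
theorem mem_unitary_of_linear_ode {I : Set ℝ} (hIc : I.OrdConnected) {ψ A : ℝ → Mat m}
    (hψ : ∀ x ∈ I, HasDerivAt ψ (ψ x * A x) x) (hA : ∀ x ∈ I, star (A x) = -A x) {x₀ : ℝ}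
    (h₀ : x₀ ∈ I) (hψ₀ : ψ x₀ ∈ UGroup m) {x : ℝ} (hx : x ∈ I) : ψ x ∈ UGroup m := by
  have h1 : ψ x * star (ψ x) = 1 := by
    rw [eq_of_hasDerivAt_zero (f := fun y => ψ y * star (ψ y)) hIc (fun y hy => ?_) hx h₀]
    · exact (Unitary.mem_iff.1 hψ₀).2
    · refine ((hψ y hy).mul (hasDerivAt_star (hψ y hy))).congr_deriv ?_
      rw [star_mul, hA y hy]; noncomm_ring
  exact Unitary.mem_iff.2 ⟨mul_eq_one_comm.1 h1, h1⟩

theorem conj_lie_conj {U : Mat m} (hU : U ∈ UGroup m) (A B : Mat m) :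
    ⁅star U * A * U, star U * B * U⁆ = star U * ⁅A, B⁆ * U := by
  rw [Ring.lie_def, Ring.lie_def, conj_mul_conj hU, conj_mul_conj hU, mul_sub, sub_mul]

theorem conj_injective {U : Mat m} (hU : U ∈ UGroup m) {A B : Mat m}
    (h : star U * A * U = star U * B * U) : A = B := by
  have h2 : U * star U = 1 := (Unitary.mem_iff.1 hU).2
  have e : ∀ A, U * (star U * A * U) * star U = A := fun A => by
    simp only [← mul_assoc, h2, one_mul]; rw [mul_assoc, h2, mul_one]
  rw [← e A, h, e]

theorem conj_conj {U : Mat m} (hU : U ∈ UGroup m) (A : Mat m) :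
    star U * (U * A * star U) * U = A := by
  have h1 : star U * U = 1 := (Unitary.mem_iff.1 hU).1
  simp only [← mul_assoc, h1, one_mul]; rw [mul_assoc, h1, mul_one]

theorem conj_conj' {U : Mat m} (hU : U ∈ UGroup m) (A : Mat m) :
    U * (star U * A * U) * star U = A := by
  have h2 : U * star U = 1 := (Unitary.mem_iff.1 hU).2
  simp only [← mul_assoc, h2, one_mul]; rw [mul_assoc, h2, mul_one]

theorem coframe_conj {U : Mat m} (hU : U ∈ UGroup m) (W : Mat m) :
    coframe U (U * W * star U) = ⁅W, origin m⁆ := by rw [coframe, conj_conj hU]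

/-- The derivative of a curve in terms of a lift. -/
theorem hasDerivAt_of_lift {ψ γ : ℝ → Mat m} {ψ' : Mat m} {x : ℝ} (hψ : HasDerivAt ψ ψ' x)
    (hu : ∀ᶠ y in 𝓝 x, ψ y ∈ UGroup m)
    (hγ : ∀ᶠ y in 𝓝 x, γ y = ψ y * origin m * star (ψ y)) :
    HasDerivAt γ (ψ x * ⁅star (ψ x) * ψ', origin m⁆ * star (ψ x)) x := by
  have h1 : star (ψ x) * ψ x = 1 := (Unitary.mem_iff.1 hu.self_of_nhds).1
  have h2 : ψ x * star (ψ x) = 1 := (Unitary.mem_iff.1 hu.self_of_nhds).2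
  have h3 : ψ' * star (ψ x) + ψ x * star ψ' = 0 := by
    refine (hψ.mul (hasDerivAt_star hψ)).unique ?_
    exact (hasDerivAt_const x (1 : Mat m)).congr_of_eventuallyEq
      (hu.mono fun y hy => (Unitary.mem_iff.1 hy).2)
  have h4 : star ψ' = -(star (ψ x) * ψ' * star (ψ x)) := by
    have := congrArg (fun A => star (ψ x) * A) h3
    simp only [mul_add, ← mul_assoc, h1, one_mul, mul_zero] at this
    exact eq_neg_of_add_eq_zero_right this
  have h5 := ((hψ.mul_const (origin m)).mul (hasDerivAt_star hψ)).congr_of_eventuallyEq hγ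
  refine h5.congr_deriv ?_
  have h6 : ∀ A, ψ x * (star (ψ x) * A) = A := fun A => by rw [← mul_assoc, h2, one_mul]
  simp only [h4, Ring.lie_def, mul_add, add_mul, neg_mul, mul_assoc, h6, mul_neg, sub_eq_add_neg]

theorem coframe_add_connection {ψ γ : ℝ → Mat m} {ψ' : Mat m} {x : ℝ} (hψ : HasDerivAt ψ ψ' x)
    (hu : ∀ᶠ y in 𝓝 x, ψ y ∈ UGroup m)
    (hγ : ∀ᶠ y in 𝓝 x, γ y = ψ y * origin m * star (ψ y)) :
    ψ x * (coframe (ψ x) (mderiv γ x) + connection (ψ x) ψ') = ψ' := by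
  have h2 : ψ x * star (ψ x) = 1 := (Unitary.mem_iff.1 hu.self_of_nhds).2
  rw [mderiv_of_hasDerivAt (hasDerivAt_of_lift hψ hu hγ), coframe_conj hu.self_of_nhds, connection,
    lie_lie_add_diag (origin_sq m), ← mul_assoc, h2, one_mul]

theorem coframe_connection_of_hasDerivAt {ψ γ : ℝ → Mat m} {X Y : Mat m} {x : ℝ}
    (hψ : HasDerivAt ψ (ψ x * (X + Y)) x) (hu : ∀ᶠ y in 𝓝 x, ψ y ∈ UGroup m)
    (hγ : ∀ᶠ y in 𝓝 x, γ y = ψ y * origin m * star (ψ y))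
    (hX : origin m * X + X * origin m = X) (hY : origin m * Y = Y * origin m) :
    coframe (ψ x) (mderiv γ x) = X ∧ connection (ψ x) (mderiv ψ x) = Y := by
  have h1 : star (ψ x) * ψ x = 1 := (Unitary.mem_iff.1 hu.self_of_nhds).1
  have o2 := origin_sq m
  rw [mderiv_of_hasDerivAt (hasDerivAt_of_lift hψ hu hγ), coframe_conj hu.self_of_nhds, connection,
    mderiv_of_hasDerivAt hψ, ← mul_assoc, h1, one_mul]
  have hl : ⁅⁅X + Y, origin m⁆, origin m⁆
      = ⁅⁅X, origin m⁆, origin m⁆ + ⁅⁅Y, origin m⁆, origin m⁆ := by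
    simp only [Ring.lie_def]; noncomm_ring
  refine ⟨by rw [hl, lie_lie_of_offDiag o2 hX, lie_lie_of_diag hY, add_zero], ?_⟩
  rw [mul_add, mul_add, add_mul, add_mul, add_add_add_comm, diag_of_offDiag o2 hX,
    diag_of_diag o2 hY, zero_add]

variable {I : Set ℝ} {γ ψ : ℝ → Mat m} {u : ℝ → Cov m}

theorem perpMat_diag (v : Cov m) : origin m * perpMat v = perpMat v * origin m := hMat_diag _ _ _ _

theorem IsParallelFrame.eventually_mem (h : IsParallelFrame I γ ψ u) (hI : IsOpen I) {x : ℝ}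
    (hx : x ∈ I) : ∀ᶠ y in 𝓝 x, ψ y ∈ UGroup m := by
  filter_upwards [hI.mem_nhds hx] with y hy using h.mem y hy

theorem IsParallelFrame.eventually_lift (h : IsParallelFrame I γ ψ u) (hI : IsOpen I) {x : ℝ}
    (hx : x ∈ I) : ∀ᶠ y in 𝓝 x, γ y = ψ y * origin m * star (ψ y) := by
  filter_upwards [hI.mem_nhds hx] with y hy using h.lift y hy

/-- With `isParallelFrame_of_hasDerivAt` this turns the geometric conditions on e and ω into one
linear equation, the form in which frames are used from here on. -/
theorem IsParallelFrame.hasDerivAt (h : IsParallelFrame I γ ψ u) (hI : IsOpen I) {x : ℝ}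
    (hx : x ∈ I) : HasDerivAt ψ (ψ x * (ex m + perpMat (u x))) x := by
  have h1 := hasDerivAt_mderiv hI (msmoothOn_iff.1 h.smooth) hx
  have h2 := coframe_add_connection h1 (h.eventually_mem hI hx) (h.eventually_lift hI hx)
  rw [h.coframe_x x hx, h.connection_x x hx] at h2
  rwa [h2]

theorem isParallelFrame_of_hasDerivAt (hI : IsOpen I) (hs : ContDiffOn ℝ ∞ ψ I)
    (hm : ∀ x ∈ I, ψ x ∈ UGroup m) (hl : ∀ x ∈ I, γ x = ψ x * origin m * star (ψ x))
    (hd : ∀ x ∈ I, HasDerivAt ψ (ψ x * (ex m + perpMat (u x))) x) : IsParallelFrame I γ ψ u where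
  smooth := msmoothOn_iff.2 hs
  mem := hm
  lift := hl
  coframe_x x hx := (coframe_connection_of_hasDerivAt (hd x hx)
    (by filter_upwards [hI.mem_nhds hx] with y hy using hm y hy)
    (by filter_upwards [hI.mem_nhds hx] with y hy using hl y hy) ex_offDiag (perpMat_diag _)).1
  connection_x x hx := (coframe_connection_of_hasDerivAt (hd x hx)
    (by filter_upwards [hI.mem_nhds hx] with y hy using hm y hy)
    (by filter_upwards [hI.mem_nhds hx] with y hy using hl y hy) ex_offDiag (perpMat_diag _)).2

theorem contDiffOn_perpMat_iff {E : Type*} [NormedAddCommGroup E] [NormedSpace ℝ E] {S : Set E}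
    {u : E → Cov m} : ContDiffOn ℝ ∞ (fun p => perpMat (u p)) S ↔ ContDiffOn ℝ ∞ u S := by
  constructor
  · intro h
    have := (LinearMap.toContinuousLinearMap (compLin m)).contDiff.comp_contDiffOn h
    refine this.congr fun p _ => ?_
    exact (compLin_perpMat (u p)).symm
  · exact fun h => (LinearMap.toContinuousLinearMap (perpLin m)).contDiff.comp_contDiffOn h

theorem IsParallelFrame.contDiffOn_covariants (h : IsParallelFrame I γ ψ u) (hI : IsOpen I) :
    ContDiffOn ℝ ∞ u I := by
  rw [← contDiffOn_perpMat_iff]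
  have hs := msmoothOn_iff.1 h.smooth
  have h1 : ContDiffOn ℝ ∞ (fun x => star (ψ x) * mderiv ψ x - ex m) I :=
    ((contDiffOn_star hs).mul (contDiffOn_mderiv hI hs)).sub contDiffOn_const
  refine h1.congr fun x hx => ?_
  rw [mderiv_of_hasDerivAt (h.hasDerivAt hI hx), ← mul_assoc, (Unitary.mem_iff.1 (h.mem x hx)).1, one_mul,
    add_sub_cancel_left]

end Frames

/-! ### Existence of parallel frames -/

section Existence

variable {m : ℕ}

theorem mem_HP_star {P : Mat m} (h : P ∈ HP m) : star P = P := by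
  obtain ⟨v, -, rfl⟩ := h
  ext1 i j; simp [Matrix.star_apply, Matrix.vecMulVec_apply]

theorem mem_HP_sq {P : Mat m} (h : P ∈ HP m) : P * P = P := by
  obtain ⟨v, hv, rfl⟩ := h
  ext1 i j
  have : ∀ l, v i * star (v l) * (v l * star (v j)) = v i * (star (v l) * v l) * star (v j) :=
    fun l => by simp only [mul_assoc]
  simp only [Matrix.mul_apply, Matrix.vecMulVec_apply, Pi.star_apply, this]
  rw [← Finset.sum_mul, ← Finset.mul_sum, sum_star_mul_self, hv, Quaternion.coe_one, mul_one]

variable {I : Set ℝ} {γ : ℝ → Mat m}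

theorem IsUnitSpeed.hasDerivAt (h : IsUnitSpeed I γ) (hI : IsOpen I) {x : ℝ} (hx : x ∈ I) :
    HasDerivAt γ (mderiv γ x) x := hasDerivAt_mderiv hI (msmoothOn_iff.1 h.smooth) hx

theorem IsUnitSpeed.mderiv_mem_tangent (h : IsUnitSpeed I γ) (hI : IsOpen I) {x : ℝ}
    (hx : x ∈ I) : mderiv γ x ∈ tangent (γ x) := by
  have hd := h.hasDerivAt hI hx
  have hev : ∀ᶠ y in 𝓝 x, y ∈ I := hI.mem_nhds hx
  constructor
  · exact ((hasDerivAt_star hd).congr_of_eventuallyEq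
      (hev.mono fun y hy => (mem_HP_star (h.mem y hy)).symm)).unique hd
  · have := ((hd.mul hd).congr_of_eventuallyEq
      (hev.mono fun y hy => (mem_HP_sq (h.mem y hy)).symm)).unique hd
    exact (add_comm _ _).trans this

/-- The generator `[γ_x, γ]` of parallel transport in the tautological bundle. -/
def transport (γ : ℝ → Mat m) (x : ℝ) : Mat m := ⁅mderiv γ x, γ x⁆

/-- The correction to `transport` which makes it a parallel vector field along the frame. -/
def transportCorr (γ : ℝ → Mat m) (x : ℝ) : Mat m :=
  (5 * chi m / 4) • ⁅transport γ x, mderiv (transport γ) x⁆ +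
    (chi m ^ 2 / 4) • ⁅transport γ x, ⁅transport γ x, ⁅transport γ x, mderiv (transport γ) x⁆⁆⁆

/-- Equivalently, ad(e_x)² has eigenvalue -4/χ on the scalar part of 𝔥_⊥ and -1/χ on its vector
part. -/
theorem lie_ex_perpMat (w : Cov m) : ⁅ex m, perpMat w⁆
    = -adInvH ((4 / chi m) • w.1, (1 / chi m) • w.2) := by
  have hs : (Real.sqrt (chi m))⁻¹ = Real.sqrt (chi m) * (1 / chi m) := by
    have h1 := Real.mul_self_sqrt (chi_pos m).le
    have h2 := sqrt_chi_ne (m := m)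
    have h3 := (chi_pos m).ne'
    field_simp
    rw [sq, h1]
  have hq : star (w.1 : Quat) = -(w.1 : Quat) := skewAdjoint.mem_iff.1 w.1.2
  have h4 : (4 / chi m) = 4 * (1 / chi m) := by ring
  rw [ex, adInvH, Ring.lie_def, smul_mul_assoc, mul_smul_comm, ← smul_sub, hs, ← smul_neg, mul_smul]
  congr 1
  have h5 : ∀ q : Quat, (1 / chi m) • (-q - q) = -((1 / 2 : ℝ) • ((4 / chi m) • q)) := fun q => by
    rw [h4, smul_smul, ← neg_add', ← two_smul ℝ q, smul_neg, smul_smul]; congr 2; ring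
  apply mat_ext <;> intros <;> simp only [Matrix.smul_apply, Matrix.sub_apply, Matrix.neg_apply,
    mul_apply_two] <;> simp [perpMat, hq]
  · simpa using h5 w.1
  · simpa using h5 w.1

/-- The element sought is w = -ad(e_x)⁻¹v. It equals p(ad(e_x))v for the odd polynomial p(λ) =
(5χ/4)λ + (χ²/4)λ³, fixed by -λp(λ) = 1 at λ² = -4/χ and λ² = -1/χ. As a polynomial it transfers to
any adapted frame, so `transportCorr` is defined and smooth without a choice of frame. -/
theorem transport_poly (v : Cov m) : ∃ w : Cov m,
    (5 * chi m / 4) • ⁅ex m, adInvH v⁆ +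
      (chi m ^ 2 / 4) • ⁅ex m, ⁅ex m, ⁅ex m, adInvH v⁆⁆⁆ = perpMat w ∧
    ⁅perpMat w, ex m⁆ = adInvH v := by
  have hχ := (chi_pos m).ne'
  refine ⟨((chi m / 4) • v.1, chi m • v.2), ?_, ?_⟩
  · have hneg : ∀ X : Mat m, ⁅ex m, -X⁆ = -⁅ex m, X⁆ := fun X => by
      simp only [Ring.lie_def]; noncomm_ring
    rw [ad_adInvH, lie_ex_perpMat, hneg, ad_adInvH, ← perpLin_apply, ← perpLin_apply,
      ← perpLin_apply, ← map_neg, ← map_smul, ← map_smul, ← map_add]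
    congr 1
    ext1
    · change (5 * chi m / 4) • v.1 + (chi m ^ 2 / 4) • -((4 / chi m) • v.1) = (chi m / 4) • v.1
      match_scalars; field_simp; ring
    · change (5 * chi m / 4) • v.2 + (chi m ^ 2 / 4) • -((1 / chi m) • v.2) = chi m • v.2
      match_scalars; field_simp; ring
  · have : ∀ X : Mat m, ⁅X, ex m⁆ = -⁅ex m, X⁆ := fun X => by
      simp only [Ring.lie_def, neg_sub]
    rw [this, lie_ex_perpMat, neg_neg]
    congr 1
    ext1
    · simp only [smul_smul]
      rw [show 4 / chi m * (chi m / 4) = 1 by field_simp, one_smul]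
    · simp only [smul_smul]
      rw [show 1 / chi m * chi m = 1 by field_simp, one_smul]

theorem exists_eq_adInvH {X : Mat m} (hs : star X = -X) (ho : origin m * X + X * origin m = X)
    (hr : (X 0 1).re = 0) : ∃ v : Cov m, X = adInvH v := by
  have hst : ∀ i j, star (X j i) = -X i j := fun i j => congrFun (congrFun hs i) j
  have hoij : ∀ i j, (if i = 0 then X 0 j else 0) + (if j = 0 then X i 0 else 0) = X i j :=
    fun i j => by
      have := congrFun (congrFun ho i) j
      rwa [Matrix.add_apply, origin_mul_apply, mul_origin_apply] at this
  have hc := sqrt_chi_ne (m := m)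
  have him : star (X 0 1) = -X 0 1 := by
    ext <;> simp [hr]
  refine ⟨((2 * (Real.sqrt (chi m))⁻¹) • ⟨X 0 1, skewAdjoint.mem_iff.2 him⟩,
    fun l => -((Real.sqrt (chi m))⁻¹ • X 0 l.succ.succ)), ?_⟩
  have h2 : ∀ q : Quat, Real.sqrt (chi m) • (1 / 2 : ℝ) • (2 * (Real.sqrt (chi m))⁻¹) • q = q :=
    fun q => by
      rw [smul_smul, smul_smul, show Real.sqrt (chi m) * (1 / 2) * (2 * (Real.sqrt (chi m))⁻¹) = 1 by
        field_simp, one_smul]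
  have h3 : ∀ q : Quat, Real.sqrt (chi m) • (Real.sqrt (chi m))⁻¹ • q = q := fun q => by
    rw [smul_smul, mul_inv_cancel₀ hc, one_smul]
  have h00 : X 0 0 = 0 := by simpa using hoij 0 0
  have h10 : X 1 0 = X 0 1 := neg_injective ((hst 1 0).symm.trans him)
  have hl0 : ∀ l : Fin m, X l.succ.succ 0 = -star (X 0 l.succ.succ) := fun l => by
    rw [hst l.succ.succ 0, neg_neg]
  apply mat_ext
  · simp [adInvH, h00]
  · simpa [adInvH] using (h2 (X 0 1)).symm
  · intro l; simp [adInvH, h3]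
  · have := h2 (X 0 1)
    simp only [one_div] at this
    simp [adInvH, him, h10, this]
  · simpa [adInvH] using (hoij 1 1).symm
  · intro l; simpa [adInvH] using (hoij 1 l.succ.succ).symm
  · intro l
    simp [adInvH, h3, hl0]
  · intro l; simpa [adInvH] using (hoij l.succ.succ 1).symm
  · intro l k; simpa [adInvH] using (hoij l.succ.succ k.succ.succ).symm

theorem transport_contDiffOn (hI : IsOpen I) (h : IsUnitSpeed I γ) :
    ContDiffOn ℝ ∞ (transport γ) I := by
  have h1 := msmoothOn_iff.1 h.smooth
  have h2 := contDiffOn_mderiv hI h1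
  exact (h2.mul h1).sub (h1.mul h2)

theorem transportCorr_contDiffOn (hI : IsOpen I) (h : IsUnitSpeed I γ) :
    ContDiffOn ℝ ∞ (transportCorr γ) I := by
  have h1 := transport_contDiffOn hI h
  have h2 := contDiffOn_mderiv hI h1
  have hl : ∀ B : ℝ → Mat m, ContDiffOn ℝ ∞ B I →
      ContDiffOn ℝ ∞ (fun x => ⁅transport γ x, B x⁆) I := fun B hB => (h1.mul hB).sub (hB.mul h1)
  exact ((hl _ h2).const_smul _).add ((hl _ (hl _ (hl _ h2))).const_smul _)

theorem conj_transport {ψ : Mat m} {x : ℝ} (hψ : ψ ∈ UGroup m)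
    (hl : γ x = ψ * origin m * star ψ) (hc : coframe ψ (mderiv γ x) = ex m) :
    star ψ * transport γ x * ψ = ex m := by
  rw [transport, ← conj_lie_conj hψ, hl, conj_conj hψ, ← hc, coframe]

/-- One has T' = [γ_xx, γ]. Differentiating |γ_x|² = 1 shows that γ_xx is trace-orthogonal to γ_x,
so T' has no e_x component in an adapted frame and lies in 𝔪_⊥. -/
theorem IsUnitSpeed.conj_transport_deriv (hI : IsOpen I) (h : IsUnitSpeed I γ) {x : ℝ} (hx : x ∈ I)
    {ψ : Mat m} (hψ : ψ ∈ UGroup m) (hl : γ x = ψ * origin m * star ψ)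
    (hc : coframe ψ (mderiv γ x) = ex m) :
    ∃ v : Cov m, star ψ * mderiv (transport γ) x * ψ = adInvH v := by
  have hs := msmoothOn_iff.1 h.smooth
  have h1 := hasDerivAt_mderiv hI (contDiffOn_mderiv hI hs) hx
  have h0 := h.hasDerivAt hI hx
  have hev : ∀ᶠ y in 𝓝 x, y ∈ I := hI.mem_nhds hx
  set Z := mderiv (mderiv γ) x
  have hK : mderiv (transport γ) x = ⁅Z, γ x⁆ := by
    refine mderiv_of_hasDerivAt (((h1.mul h0).sub (h0.mul h1)).congr_deriv ?_)
    rw [Ring.lie_def]; abel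
  have hZs : star Z = Z := ((hasDerivAt_star h1).congr_of_eventuallyEq
    (hev.mono fun y hy => (h.mderiv_mem_tangent hI hy).1.symm)).unique h1
  have hT := h.mderiv_mem_tangent hI hx
  have hZr : (Matrix.trace (Z * mderiv γ x)).re = 0 := by
    let tr : Mat m →L[ℝ] ℝ := LinearMap.toContinuousLinearMap
      { toFun := fun A => (Matrix.trace A).re
        map_add' := fun A B => by rw [Matrix.trace_add]; rfl
        map_smul' := fun r A => by rw [Matrix.trace_smul]; rfl }
    have e1 : HasDerivAt (fun y => tr (mderiv γ y * mderiv γ y))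
        (tr (Z * mderiv γ x + mderiv γ x * Z)) x :=
      tr.hasFDerivAt.comp_hasDerivAt x (h1.mul h1)
    have e2 : ∀ y ∈ I, tr (mderiv γ y * mderiv γ y) = (4 * (((m : ℝ) + 1) + 2))⁻¹ := fun y hy =>
      eq_inv_of_mul_eq_one_right (h.unit y hy)
    have e3 := e1.unique ((hasDerivAt_const x _).congr_of_eventuallyEq (hev.mono e2))
    have e4 : tr (Z * mderiv γ x) = tr (mderiv γ x * Z) := re_trace_mul_comm _ _
    rw [map_add, ← e4] at e3
    have e5 : tr (Z * mderiv γ x) = 0 := by linarith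
    exact e5
  have hW : ⁅star ψ * Z * ψ, origin m⁆ = star ψ * mderiv (transport γ) x * ψ := by
    rw [hK, ← conj_lie_conj hψ, hl, conj_conj hψ]
  have hWs : star (star ψ * Z * ψ) = star ψ * Z * ψ := by
    simp only [star_mul, star_star, hZs, mul_assoc]
  have hWr : (Matrix.trace (star ψ * Z * ψ * (star ψ * mderiv γ x * ψ))).re = 0 := by
    rw [conj_mul_conj hψ, re_trace_mul_comm, ← mul_assoc, (Unitary.mem_iff.1 hψ).2, one_mul, hZr]
  have hγ' : star ψ * mderiv γ x * ψ = ⁅ex m, origin m⁆ := by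
    have hT' : mderiv γ x ∈ tangent (uconj ⟨ψ, hψ⟩ (origin m)) := by
      rw [hl] at hT; exact hT
    rw [← hc, coframe, lie_lie_of_offDiag (origin_sq m) (tangent_pull ⟨ψ, hψ⟩ _ hT').2.1]
  rw [hγ'] at hWr
  rw [← hW]
  generalize star ψ * Z * ψ = W at *
  have hst : ∀ i j, star (W j i) = W i j := fun i j => congrFun (congrFun hWs i) j
  refine exists_eq_adInvH ?_ ?_ ?_
  · simp only [Ring.lie_def, star_sub, star_mul, hWs, star_origin]; abel
  · have o2 := origin_sq m
    simp only [Ring.lie_def, mul_sub, sub_mul, ← mul_assoc, o2]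
    rw [mul_assoc W, o2]; abel
  · have e : (Matrix.trace (W * ⁅ex m, origin m⁆)).re
        = -((Real.sqrt (chi m))⁻¹ * ((W 0 1).re + (W 1 0).re)) := by
      have e' : Matrix.trace (W * ⁅ex m, origin m⁆)
          = -((Real.sqrt (chi m))⁻¹ • (W 0 1 + W 1 0)) := by
        have hL : ∀ i j, (⁅ex m, origin m⁆ : Mat m) i j
            = (if j = 0 then ex m i 0 else 0) - (if i = 0 then ex m 0 j else 0) := fun i j => by
          rw [Ring.lie_def, Matrix.sub_apply, mul_origin_apply, origin_mul_apply]
        simp only [Matrix.trace, Matrix.diag, Fin.sum_univ_succ (n := m + 1),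
          Fin.sum_univ_succ (n := m), Fin.succ_zero_eq_one, mul_apply_two, hL]
        simp [ex]
        abel
      rw [e']; rfl
    rw [e, ← hst 1 0, Quaternion.re_star] at hWr
    have h3 : (W 0 1).re = 0 := by
      have := inv_ne_zero (sqrt_chi_ne (m := m))
      have h4 := (mul_eq_zero.1 (neg_eq_zero.1 hWr)).resolve_left this
      linarith
    simp [Ring.lie_def, mul_origin_apply, origin_mul_apply, h3]

theorem IsUnitSpeed.conj_transportCorr (hI : IsOpen I) (h : IsUnitSpeed I γ) {x : ℝ} (hx : x ∈ I)
    {ψ : Mat m} (hψ : ψ ∈ UGroup m) (hl : γ x = ψ * origin m * star ψ)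
    (hc : coframe ψ (mderiv γ x) = ex m) :
    ∃ w : Cov m, star ψ * transportCorr γ x * ψ = perpMat w ∧
      ⁅perpMat w, ex m⁆ = star ψ * mderiv (transport γ) x * ψ := by
  obtain ⟨v, hv⟩ := h.conj_transport_deriv hI hx hψ hl hc
  obtain ⟨w, hw1, hw2⟩ := transport_poly v
  refine ⟨w, ?_, by rw [hv, hw2]⟩
  rw [← hw1, ← hv, ← conj_transport hψ hl hc]
  simp only [conj_lie_conj hψ, transportCorr, mul_add, add_mul, mul_smul_comm, smul_mul_assoc]

/-- Every unit speed curve has a parallel frame. -/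
theorem IsUnitSpeed.exists_parallelFrame (hI : IsOpen I) (hIc : I.OrdConnected)
    (h : IsUnitSpeed I γ) : ∃ ψ u, IsParallelFrame I γ ψ u := by
  rcases I.eq_empty_or_nonempty with rfl | ⟨x₀, h₀⟩
  · refine ⟨fun _ => 1, fun _ => 0, ⟨fun _ _ => contDiffOn_const, ?_, ?_, ?_, ?_⟩⟩ <;>
    exact fun _ h => h.elim
  have hadapt : ∀ x ∈ I, ∃ ψ ∈ UGroup m, γ x = ψ * origin m * star ψ ∧
      coframe ψ (mderiv γ x) = ex m := fun x hx =>
    exists_adapted_frame (h.mem x hx) (h.mderiv_mem_tangent hI hx) (h.unit x hx)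
  -- The generator reads e_x + w with w in 𝔥_⊥ in every adapted frame. It is built so that both γ
  -- and T satisfy B' = [M, B].
  let M : ℝ → Mat m := fun x => transport γ x + transportCorr γ x
  have hMs : ContDiffOn ℝ ∞ M I := (transport_contDiffOn hI h).add (transportCorr_contDiffOn hI h)
  have hMγ : ∀ x ∈ I, ⁅M x, γ x⁆ = mderiv γ x ∧ ⁅M x, transport γ x⁆ = mderiv (transport γ) x ∧
      star (M x) = -M x := by
    intro x hx
    obtain ⟨ψ, hψ, hl, hc⟩ := hadapt x hx
    obtain ⟨w, hw1, hw2⟩ := h.conj_transportCorr hI hx hψ hl hc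
    have hM : star ψ * M x * ψ = ex m + perpMat w := by
      simp only [M, mul_add, add_mul, hw1, conj_transport hψ hl hc]
    have hγ' : star ψ * mderiv γ x * ψ = ⁅ex m, origin m⁆ := by
      have hT' : mderiv γ x ∈ tangent (uconj ⟨ψ, hψ⟩ (origin m)) := by
        have hT := h.mderiv_mem_tangent hI hx
        rw [hl] at hT; exact hT
      rw [← hc, coframe, lie_lie_of_offDiag (origin_sq m) (tangent_pull ⟨ψ, hψ⟩ _ hT').2.1]
    refine ⟨conj_injective hψ ?_, conj_injective hψ ?_, conj_injective hψ ?_⟩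
    · rw [← conj_lie_conj hψ, hM, hγ', hl, conj_conj hψ, Ring.lie_def, Ring.lie_def, add_mul, mul_add,
        perpMat_diag]
      abel
    · rw [← conj_lie_conj hψ, hM, conj_transport hψ hl hc, ← hw2, Ring.lie_def, Ring.lie_def]
      noncomm_ring
    · have : star (star ψ * M x * ψ) = star ψ * star (M x) * ψ := by
        simp only [star_mul, star_star, mul_assoc]
      rw [← this, hM, mul_neg, neg_mul, hM, star_add, star_ex, star_perpMat, neg_add]
  obtain ⟨ψ₀, hψ₀, hl₀, hc₀⟩ := hadapt x₀ h₀
  -- The frame should solve ψ' = Mψ, with M on the left; since M is skew-Hermitian, its adjoint φ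
  -- solves φ' = -φM, the form treated above.
  obtain ⟨φ, hφ₀, hφ⟩ := exists_linear_ode hI hIc (A := fun x => -M x) hMs.continuousOn.neg h₀
    (star ψ₀)
  have hφu : ∀ x ∈ I, φ x ∈ UGroup m := fun x hx =>
    mem_unitary_of_linear_ode hIc hφ (fun y hy => by rw [star_neg, (hMγ y hy).2.2]) h₀
      (by rw [hφ₀]; exact Unitary.star_mem hψ₀) hx
  let ψ : ℝ → Mat m := fun x => star (φ x)
  have hψu : ∀ x ∈ I, ψ x ∈ UGroup m := fun x hx => Unitary.star_mem (hφu x hx)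
  have hψd : ∀ x ∈ I, HasDerivAt ψ (M x * ψ x) x := fun x hx =>
    (hasDerivAt_star (hφ x hx)).congr_deriv (by
      rw [star_mul, star_neg, (hMγ x hx).2.2, neg_neg])
  -- A solution of the Lax equation B' = [M, B] is constant when read in the frame. With B = γ this
  -- gives the lift condition, with B = T the condition e⌋γ_x = e_x.
  have hconst : ∀ B : ℝ → Mat m, (∀ x ∈ I, HasDerivAt B ⁅M x, B x⁆ x) → ∀ x ∈ I,
      φ x * B x * ψ x = star ψ₀ * B x₀ * ψ₀ := by
    intro B hB x hx
    have e := eq_of_hasDerivAt_zero (f := fun y => φ y * B y * ψ y) hIc (fun y hy => ?_) hx h₀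
    · rw [e, hφ₀, show ψ x₀ = star (φ x₀) from rfl, hφ₀, star_star]
    · refine (((hφ y hy).mul (hB y hy)).mul (hψd y hy)).congr_deriv ?_
      simp only [Pi.mul_apply, Ring.lie_def]; noncomm_ring
  have hlift : ∀ x ∈ I, γ x = ψ x * origin m * star (ψ x) := fun x hx => by
    have e := hconst γ (fun y hy => by rw [(hMγ y hy).1]; exact h.hasDerivAt hI hy) x hx
    rw [hl₀, conj_conj hψ₀] at e
    rw [← e, show φ x = star (ψ x) from (star_star _).symm, conj_conj' (hψu x hx)]
  have hco : ∀ x ∈ I, coframe (ψ x) (mderiv γ x) = ex m := fun x hx => by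
    have e := hconst (transport γ) (fun y hy => by
      rw [(hMγ y hy).2.1]; exact hasDerivAt_mderiv hI (transport_contDiffOn hI h) hy) x hx
    rw [conj_transport hψ₀ hl₀ hc₀, show φ x = star (ψ x) from (star_star _).symm, transport,
      ← conj_lie_conj (hψu x hx), hlift x hx, conj_conj (hψu x hx)] at e
    rw [coframe, e]
  have hexu : ∀ x, ∃ w : Cov m, x ∈ I → star (ψ x) * transportCorr γ x * ψ x = perpMat w :=
    fun x => by
      by_cases hx : x ∈ I
      · obtain ⟨w, hw, -⟩ := h.conj_transportCorr hI hx (hψu x hx) (hlift x hx) (hco x hx)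
        exact ⟨w, fun _ => hw⟩
      · exact ⟨0, fun hx' => (hx hx').elim⟩
  choose u hu using hexu
  refine ⟨ψ, u, isParallelFrame_of_hasDerivAt hI
    (contDiffOn_star (contDiffOn_of_linear_ode hI hMs.neg hφ)) hψu hlift fun x hx =>
    (hψd x hx).congr_deriv ?_⟩
  rw [← hu x hx, ← conj_transport (hψu x hx) (hlift x hx) (hco x hx), ← add_mul, ← mul_add,
    ← mul_assoc, ← mul_assoc, (Unitary.mem_iff.1 (hψu x hx)).2, one_mul]

end Existence

end

end QuatCurve

namespace QuatCurve

noncomputable section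

open Topology Filter

attribute [local instance] Matrix.linftyOpNormedRing Matrix.linftyOpNormedAlgebra

/-! ### Uniqueness of parallel frames up to the isotropy group -/

section Uniqueness

variable {m : ℕ} {I : Set ℝ}

/-- The element of the isotropy group of `e_x` whose adjoint action on `𝔥_⊥` is `act a A`. -/
def actMat (a : unitary Quat) (A : unitary (Matrix (Fin m) (Fin m) Quat)) : Mat m :=
  isoMat (a : Quat) (star (A : Matrix (Fin m) (Fin m) Quat))

theorem actMat_mem (a : unitary Quat) (A : unitary (Matrix (Fin m) (Fin m) Quat)) :
    actMat a A ∈ UGroup m := isoMat_mem a (star A)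

theorem actMat_origin (a : unitary Quat) (A : unitary (Matrix (Fin m) (Fin m) Quat)) :
    origin m * actMat a A = actMat a A * origin m := isoMat_origin _ _

theorem star_actMat_origin (a : unitary Quat) (A : unitary (Matrix (Fin m) (Fin m) Quat)) :
    origin m * star (actMat a A) = star (actMat a A) * origin m := by
  have := congrArg star (actMat_origin a A)
  simpa only [star_mul, star_origin] using this.symm

theorem actMat_conj_ex (a : unitary Quat) (A : unitary (Matrix (Fin m) (Fin m) Quat)) :
    actMat a A * ex m * star (actMat a A) = ex m := by
  have h := (Unitary.mem_iff.1 (actMat_mem a A)).2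
  rw [actMat] at h ⊢
  rw [isoMat_ex, mul_assoc, h, mul_one]

theorem actMat_conj_perpMat (a : unitary Quat) (A : unitary (Matrix (Fin m) (Fin m) Quat))
    (v : Cov m) : actMat a A * perpMat v * star (actMat a A) = perpMat (act a A v) :=
  isoMat_conj_perpMat a A v

theorem actMat_conj_adInvH (a : unitary Quat) (A : unitary (Matrix (Fin m) (Fin m) Quat))
    (v : Cov m) : actMat a A * adInvH v * star (actMat a A) = adInvH (act a A v) :=
  isoMat_conj_adInvH a A v

theorem actMat_conj_lie (a : unitary Quat) (A : unitary (Matrix (Fin m) (Fin m) Quat))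
    (X Y : Mat m) : ⁅actMat a A * X * star (actMat a A), actMat a A * Y * star (actMat a A)⁆
      = actMat a A * ⁅X, Y⁆ * star (actMat a A) := by
  have := conj_lie_conj (Unitary.star_mem (actMat_mem a A)) X Y
  simpa only [star_star] using this

theorem IsParallelFrame.change {γ ψ : ℝ → Mat m} {u : ℝ → Cov m} (h : IsParallelFrame I γ ψ u)
    (hI : IsOpen I) (a : unitary Quat) (A : unitary (Matrix (Fin m) (Fin m) Quat)) :
    IsParallelFrame I γ (fun x => ψ x * star (actMat a A)) (fun x => act a A (u x)) := by
  have h1 := (Unitary.mem_iff.1 (actMat_mem a A)).1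
  refine isParallelFrame_of_hasDerivAt hI ((msmoothOn_iff.1 h.smooth).mul contDiffOn_const)
    (fun x hx => mul_mem (h.mem x hx) (Unitary.star_mem (actMat_mem a A))) (fun x hx => ?_)
    fun x hx => ((h.hasDerivAt hI hx).mul_const (star (actMat a A))).congr_deriv ?_
  · have e : star (actMat a A) * origin m * actMat a A = origin m := by
      rw [← star_actMat_origin, mul_assoc, h1, mul_one]
    calc γ x = ψ x * (star (actMat a A) * origin m * actMat a A) * star (ψ x) := by
          rw [e, h.lift x hx]
      _ = _ := by rw [star_mul, star_star]; simp only [mul_assoc]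
  · have e : ex m + perpMat (act a A (u x))
        = actMat a A * (ex m + perpMat (u x)) * star (actMat a A) := by
      rw [mul_add, add_mul, actMat_conj_ex, actMat_conj_perpMat]
    calc ψ x * (ex m + perpMat (u x)) * star (actMat a A)
        = ψ x * (star (actMat a A) * actMat a A) * (ex m + perpMat (u x)) * star (actMat a A) := by
          rw [h1, mul_one]
      _ = _ := by rw [e]; simp only [mul_assoc]

/-- Two unitary frames at a point which are adapted to the same unit tangent vector. -/
theorem exists_actMat {P Z ψ₁ ψ₂ : Mat m} (h₁ : ψ₁ ∈ UGroup m) (h₂ : ψ₂ ∈ UGroup m)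
    (hl₁ : P = ψ₁ * origin m * star ψ₁) (hl₂ : P = ψ₂ * origin m * star ψ₂)
    (hc₁ : coframe ψ₁ Z = ex m) (hc₂ : coframe ψ₂ Z = ex m) :
    ∃ a A, ψ₁ = ψ₂ * star (actMat a A) := by
  have e2 : ψ₂ * star ψ₂ = 1 := (Unitary.mem_iff.1 h₂).2
  obtain ⟨X, hX⟩ : ∃ X, X = star ψ₂ * ψ₁ := ⟨_, rfl⟩
  have hXu : X ∈ UGroup m := hX ▸ mul_mem (Unitary.star_mem h₂) h₁
  have hX1 := (Unitary.mem_iff.1 hXu).2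
  have h12 : ψ₁ = ψ₂ * X := by rw [hX, ← mul_assoc, e2, one_mul]
  have hcomm : ∀ B, star X * B * X = B → B * X = X * B := fun B hB => by
    have : X * (star X * B * X) = X * B := by rw [hB]
    rwa [← mul_assoc, ← mul_assoc, hX1, one_mul] at this
  have ho : star X * origin m * X = origin m := by
    have e1 : star ψ₁ * P * ψ₁ = origin m := by rw [hl₁, conj_conj h₁]
    have e2 : star ψ₂ * P * ψ₂ = origin m := by rw [hl₂, conj_conj h₂]
    calc star X * origin m * X = star X * (star ψ₂ * P * ψ₂) * X := by rw [e2]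
      _ = star ψ₁ * P * ψ₁ := by rw [h12, star_mul]; simp only [mul_assoc]
      _ = origin m := e1
  have he : star X * ex m * X = ex m := by
    calc star X * ex m * X = star X * ⁅star ψ₂ * Z * ψ₂, origin m⁆ * X := by rw [← hc₂, coframe]
      _ = ⁅star X * (star ψ₂ * Z * ψ₂) * X, star X * origin m * X⁆ := (conj_lie_conj hXu _ _).symm
      _ = ⁅star ψ₁ * Z * ψ₁, origin m⁆ := by rw [ho, h12, star_mul]; simp only [mul_assoc]
      _ = ex m := by rw [← hc₁, coframe]
  have hiso := exists_isoMat (hcomm _ ho) (hcomm _ he).symm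
  obtain ⟨ha, hA⟩ := mem_of_isoMat (hiso ▸ hXu)
  refine ⟨star ⟨_, ha⟩, ⟨_, hA⟩, ?_⟩
  rw [h12, actMat, star_isoMat]
  conv_lhs => rw [hiso]
  simp

/-- The projection of matrices to the block diagonal ones which centralise `e_x`. -/
def isoProj (m : ℕ) : Mat m →L[ℝ] Mat m :=
  LinearMap.toContinuousLinearMap
    { toFun := fun X => isoMat (X 0 0) (Matrix.of fun i j => X i.succ.succ j.succ.succ)
      map_add' := fun X Y => by apply mat_ext <;> intros <;> simp [isoMat]
      map_smul' := fun r X => by apply mat_ext <;> intros <;> simp [isoMat] }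

theorem isoProj_apply (X : Mat m) : isoProj m X
    = isoMat (X 0 0) (Matrix.of fun i j => X i.succ.succ j.succ.succ) := rfl

/-- The transition matrix k = ψ₂*ψ₁ stays in the isotropy group of e_x, so k*k' is of 𝔥_∥ type. The
frame equations show it to be the difference of u₁ and a rotated u₂, hence in 𝔥_⊥. These spaces meet
in zero, so k is constant. -/
theorem IsParallelFrame.eq_of_eq {γ ψ₁ ψ₂ : ℝ → Mat m} {u₁ u₂ : ℝ → Cov m} (hI : IsOpen I)
    (hIc : I.OrdConnected) (h₁ : IsParallelFrame I γ ψ₁ u₁) (h₂ : IsParallelFrame I γ ψ₂ u₂)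
    {x₀ : ℝ} (h₀ : x₀ ∈ I) (h : ψ₁ x₀ = ψ₂ x₀) :
    ∀ x ∈ I, ψ₁ x = ψ₂ x ∧ u₁ x = u₂ x := by
  let k : ℝ → Mat m := fun x => star (ψ₂ x) * ψ₁ x
  have hex : ∀ x ∈ I, ∃ a A, k x = star (actMat a A) := fun x hx => by
    obtain ⟨a, A, h⟩ := exists_actMat (h₁.mem x hx) (h₂.mem x hx) (h₁.lift x hx) (h₂.lift x hx)
      (h₁.coframe_x x hx) (h₂.coframe_x x hx)
    refine ⟨a, A, ?_⟩
    simp only [k]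
    rw [h, ← mul_assoc, (Unitary.mem_iff.1 (h₂.mem x hx)).1, one_mul]
  have hkd : ∀ x ∈ I, HasDerivAt k (k x * perpMat (u₁ x) - perpMat (u₂ x) * k x) x := by
    intro x hx
    refine ((hasDerivAt_star (h₂.hasDerivAt hI hx)).mul (h₁.hasDerivAt hI hx)).congr_deriv ?_
    obtain ⟨a, A, hk⟩ := hex x hx
    have hke : k x * ex m = ex m * k x := by rw [hk, actMat, star_isoMat, isoMat_ex]
    have : star (ψ₂ x * (ex m + perpMat (u₂ x))) * ψ₁ x +
        star (ψ₂ x) * (ψ₁ x * (ex m + perpMat (u₁ x)))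
        = -(ex m * k x) - perpMat (u₂ x) * k x + (k x * ex m + k x * perpMat (u₁ x)) := by
      rw [star_mul, star_add, star_ex, star_perpMat]
      simp only [k]; noncomm_ring
    rw [this, hke]; abel
  have hk0 : ∀ x ∈ I, HasDerivAt k 0 x := by
    intro x hx
    have hd := hkd x hx
    obtain ⟨a, A, hk⟩ := hex x hx
    have hku : star (k x) * k x = 1 := by
      rw [hk, star_star]; exact (Unitary.mem_iff.1 (actMat_mem a A)).2
    have hku' : k x * star (k x) = 1 := mul_eq_one_comm.1 hku
    -- Near x the curve k takes values in a fixed linear subspace, the fixed space of `isoProj`, so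
    -- its derivative lies there as well.
    have hE : isoProj m (k x * perpMat (u₁ x) - perpMat (u₂ x) * k x)
        = k x * perpMat (u₁ x) - perpMat (u₂ x) * k x := by
      refine ((isoProj m).hasFDerivAt.comp_hasDerivAt x hd).unique (hd.congr_of_eventuallyEq ?_)
      filter_upwards [hI.mem_nhds hx] with y hy
      obtain ⟨b, B, hb⟩ := hex y hy
      simp only [Function.comp, isoProj_apply, hb, actMat, star_isoMat]
      rfl
    have hp : perpMat (u₁ x - act a A (u₂ x))
        = star (k x) * (k x * perpMat (u₁ x) - perpMat (u₂ x) * k x) := by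
      rw [← perpLin_apply, map_sub, perpLin_apply, perpLin_apply, ← actMat_conj_perpMat, hk,
        star_star, mul_sub, ← mul_assoc, (Unitary.mem_iff.1 (actMat_mem a A)).2, one_mul, mul_assoc]
    have hz := hp
    rw [← hE, isoProj_apply, hk, star_star, actMat, isoMat_mul] at hz
    have hz0 := perpMat_eq_isoMat hz
    rw [hz0, hp] at hz
    have := congrArg (fun A => k x * A) hz
    simp only [← mul_assoc, hku', one_mul, mul_zero] at this
    rwa [this] at hd
  have hψ : ∀ x ∈ I, ψ₁ x = ψ₂ x := fun x hx => by
    have e := eq_of_hasDerivAt_zero hIc hk0 hx h₀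
    simp only [k] at e
    rw [h, (Unitary.mem_iff.1 (h₂.mem x₀ h₀)).1] at e
    have := congrArg (fun A => ψ₂ x * A) e
    simpa only [← mul_assoc, (Unitary.mem_iff.1 (h₂.mem x hx)).2, one_mul, mul_one] using this
  refine fun x hx => ⟨hψ x hx, perpMat_injective ?_⟩
  rw [← h₁.connection_x x hx, ← h₂.connection_x x hx, hψ x hx, mderiv_congr]
  filter_upwards [hI.mem_nhds hx] with y hy using hψ y hy

/-- Parallel frames are unique up to a constant element of the isotropy group of `e_x`. -/
theorem IsParallelFrame.exists_act {γ ψ₁ ψ₂ : ℝ → Mat m} {u₁ u₂ : ℝ → Cov m} (hI : IsOpen I)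
    (hIc : I.OrdConnected) (h₁ : IsParallelFrame I γ ψ₁ u₁) (h₂ : IsParallelFrame I γ ψ₂ u₂) :
    ∃ a A, ∀ x ∈ I, ψ₁ x = ψ₂ x * star (actMat a A) ∧ u₁ x = act a A (u₂ x) := by
  rcases I.eq_empty_or_nonempty with rfl | ⟨x₀, h₀⟩
  · exact ⟨1, 1, fun x hx => hx.elim⟩
  obtain ⟨a, A, h⟩ := exists_actMat (h₁.mem x₀ h₀) (h₂.mem x₀ h₀) (h₁.lift x₀ h₀) (h₂.lift x₀ h₀)
      (h₁.coframe_x x₀ h₀) (h₂.coframe_x x₀ h₀)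
  exact ⟨a, A, h₁.eq_of_eq hI hIc (h₂.change hI a A) h₀ h⟩

end Uniqueness

/-! ### The evolution vector, its frame independence and the non-stretching property -/

section Evolution

variable {m : ℕ} {I : Set ℝ}

theorem iteratedDeriv_clm {E G : Type*} [NormedAddCommGroup E] [NormedSpace ℝ E]
    [NormedAddCommGroup G] [NormedSpace ℝ G] (hI : IsOpen I) (L : E →L[ℝ] G) {u : ℝ → E}
    {v : ℝ → G} (hu : ContDiffOn ℝ ∞ u I) (hv : ∀ x ∈ I, v x = L (u x)) (n : ℕ) {x : ℝ}
    (hx : x ∈ I) : iteratedDeriv n v x = L (iteratedDeriv n u x) := by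
  have h1 : v =ᶠ[𝓝 x] L ∘ u := by filter_upwards [hI.mem_nhds hx] with y hy using hv y hy
  rw [h1.iteratedDeriv_eq, iteratedDeriv_eq_iteratedFDeriv, iteratedDeriv_eq_iteratedFDeriv,
    L.iteratedFDeriv_comp_left ((hu.contDiffAt (hI.mem_nhds hx))) (mod_cast le_top)]
  rfl

theorem jet_act (hI : IsOpen I) (a : unitary Quat) (A : unitary (Matrix (Fin m) (Fin m) Quat))
    {u v : ℝ → Cov m} (hu : ContDiffOn ℝ ∞ u I) (hv : ∀ x ∈ I, v x = act a A (u x)) (k : ℕ) {x : ℝ}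
    (hx : x ∈ I) : jet k v x = fun i => act a A (jet k u x i) :=
  funext fun i => iteratedDeriv_clm hI (LinearMap.toContinuousLinearMap (actLin a A)) hu hv i hx

theorem contDiffOn_act (a : unitary Quat) (A : unitary (Matrix (Fin m) (Fin m) Quat))
    {u : ℝ → Cov m} (hu : ContDiffOn ℝ ∞ u I) : ContDiffOn ℝ ∞ (fun x => act a A (u x)) I :=
  (LinearMap.toContinuousLinearMap (actLin a A)).contDiff.comp_contDiffOn hu

theorem EquivariantFlow.along_act (F : EquivariantFlow m I) (hI : IsOpen I) (a : unitary Quat)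
    (A : unitary (Matrix (Fin m) (Fin m) Quat)) {u v : ℝ → Cov m} (hu : ContDiffOn ℝ ∞ u I)
    (hv : ∀ x ∈ I, v x = act a A (u x)) {x : ℝ} (hx : x ∈ I) :
    F.along v x = act a A (F.along u x) := by
  rw [EquivariantFlow.along, jet_act hI a A hu hv _ hx, F.equivariant x hx]; rfl

theorem contDiffOn_iteratedDeriv {E : Type*} [NormedAddCommGroup E] [NormedSpace ℝ E]
    (hI : IsOpen I) {u : ℝ → E} (hu : ContDiffOn ℝ ∞ u I) (n : ℕ) :
    ContDiffOn ℝ ∞ (iteratedDeriv n u) I := by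
  induction n with
  | zero => simpa using hu
  | succ n ih =>
    rw [iteratedDeriv_succ]
    exact ((contDiffOn_infty_iff_deriv_of_isOpen hI).1 ih).2

theorem EquivariantFlow.contDiffOn_along (F : EquivariantFlow m I) (hI : IsOpen I)
    {u : ℝ → Cov m} (hu : ContDiffOn ℝ ∞ u I) : ContDiffOn ℝ ∞ (F.along u) I := by
  refine F.smooth.comp (contDiffOn_id.prodMk (contDiffOn_pi.2 fun i =>
    contDiffOn_iteratedDeriv hI hu i)) fun x hx => ⟨hx, mem_univ _⟩

theorem contDiffOn_adInvH {E : Type*} [NormedAddCommGroup E] [NormedSpace ℝ E] {S : Set E}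
    {v : E → Cov m} (hv : ContDiffOn ℝ ∞ v S) : ContDiffOn ℝ ∞ (fun p => adInvH (v p)) S :=
  (LinearMap.toContinuousLinearMap (adInvHLin m)).contDiff.comp_contDiffOn hv

/-- `mParCoeff` as a continuous linear map. -/
def mParCLM (m : ℕ) : Mat m →L[ℝ] ℝ :=
  LinearMap.toContinuousLinearMap
    { toFun := mParCoeff, map_add' := fun _ _ => rfl, map_smul' := fun _ _ => rfl }

@[simp] theorem mParCLM_apply (X : Mat m) : mParCLM m X = mParCoeff X := rfl

theorem NonlocalTerm.contDiffOn_prim {F : EquivariantFlow m I} (D : NonlocalTerm F)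
    (hI : IsOpen I) {u : ℝ → Cov m} (hu : ContDiffOn ℝ ∞ u I) : ContDiffOn ℝ ∞ (D.prim u) I := by
  have hd := D.hasDerivAt u hu
  refine (contDiffOn_infty_iff_deriv_of_isOpen hI).2
    ⟨fun x hx => (hd x hx).differentiableAt.differentiableWithinAt, ?_⟩
  have h1 := contDiffOn_perpMat_iff.2 hu
  have h2 := contDiffOn_adInvH (F.contDiffOn_along hI hu)
  have h3 : ContDiffOn ℝ ∞ (fun x => mParCLM m ⁅perpMat (u x), adInvH (F.along u x)⁆) I :=
    (mParCLM m).contDiff.comp_contDiffOn ((h1.mul h2).sub (h2.mul h1))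
  exact h3.congr fun x hx => (hd x hx).deriv

theorem contDiffOn_calY (F : EquivariantFlow m I) (D : NonlocalTerm F)
    (hI : IsOpen I) {u : ℝ → Cov m} (hu : ContDiffOn ℝ ∞ u I) : ContDiffOn ℝ ∞ (calY F D u) I :=
  ((D.contDiffOn_prim hI hu).smul contDiffOn_const).sub
    (contDiffOn_adInvH (F.contDiffOn_along hI hu))

/-- The flow is equivariant, ad(e_x)⁻¹ commutes with the isotropy group of e_x, the primitive is
invariant by assumption, and (1, 0) is fixed. -/
theorem calY_act (F : EquivariantFlow m I) (D : NonlocalTerm F) (hI : IsOpen I) (a : unitary Quat)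
    (A : unitary (Matrix (Fin m) (Fin m) Quat)) {u v : ℝ → Cov m} (hu : ContDiffOn ℝ ∞ u I)
    (hv : ∀ x ∈ I, v x = act a A (u x)) {x : ℝ} (hx : x ∈ I) :
    calY F D v x = actMat a A * calY F D u x * star (actMat a A) := by
  have hv' : ContDiffOn ℝ ∞ v I := (contDiffOn_act a A hu).congr hv
  rw [calY, calY, D.invariant a A u v hu hv' hv x hx, F.along_act hI a A hu hv hx,
    ← actMat_conj_adInvH, mul_sub, sub_mul, mul_smul_comm, smul_mul_assoc]
  congr 2
  exact (isoMat_conj_mMat_one (actMat_mem a A)).symm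

theorem pairing_change (a : unitary Quat) (A : unitary (Matrix (Fin m) (Fin m) Quat))
    (ψ X : Mat m) :
    pairing (ψ * star (actMat a A)) (actMat a A * X * star (actMat a A)) = pairing ψ X := by
  have h1 := (Unitary.mem_iff.1 (actMat_mem a A)).1
  have ho : actMat a A * origin m * star (actMat a A) = origin m := by
    rw [← actMat_origin, mul_assoc, (Unitary.mem_iff.1 (actMat_mem a A)).2, mul_one]
  have h2 : ∀ B, star (actMat a A) * (actMat a A * B) = B := fun B => by
    rw [← mul_assoc, h1, one_mul]
  have h3 := actMat_conj_lie a A X (origin m)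
  rw [ho] at h3
  rw [pairing, pairing, h3, star_mul, star_star]
  simp only [mul_assoc, h2]

open Classical in
/-- The evolution vector `χ⁻¹ ⟨e*, 𝒴(h^⊥)⟩` along a curve. -/
def evolution (F : EquivariantFlow m I) (D : NonlocalTerm F) (γ : ℝ → Mat m) (x : ℝ) : Mat m :=
  if h : ∃ p : (ℝ → Mat m) × (ℝ → Cov m), IsParallelFrame I γ p.1 p.2 then
    (chi m)⁻¹ • pairing (h.choose.1 x) (calY F D h.choose.2 x)
  else 0

variable {F : EquivariantFlow m I} {D : NonlocalTerm F} {γ ψ : ℝ → Mat m} {u : ℝ → Cov m}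

/-- The chosen frame and the given one differ by a constant isotropy element. That element rotates 𝒴
and the dual frame oppositely, and the pairing does not change. -/
theorem evolution_eq (hI : IsOpen I) (hIc : I.OrdConnected) (h : IsParallelFrame I γ ψ u) {x : ℝ}
    (hx : x ∈ I) : evolution F D γ x = (chi m)⁻¹ • pairing (ψ x) (calY F D u x) := by
  have hex : ∃ p : (ℝ → Mat m) × (ℝ → Cov m), IsParallelFrame I γ p.1 p.2 := ⟨(ψ, u), h⟩
  rw [evolution, dif_pos hex]
  obtain ⟨a, A, hA⟩ := hex.choose_spec.exists_act hI hIc h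
  rw [(hA x hx).1, calY_act F D hI a A (h.contDiffOn_covariants hI) (fun y hy => (hA y hy).2) hx,
    pairing_change]

theorem evolution_contDiffOn (hI : IsOpen I) (hIc : I.OrdConnected) (h : IsParallelFrame I γ ψ u) :
    ContDiffOn ℝ ∞ (evolution F D γ) I := by
  have hψ := msmoothOn_iff.1 h.smooth
  have hY := contDiffOn_calY F D hI (h.contDiffOn_covariants hI)
  have h1 : ContDiffOn ℝ ∞ (fun x => (chi m)⁻¹ • pairing (ψ x) (calY F D u x)) I :=
    ((hψ.mul ((hY.mul contDiffOn_const).sub (contDiffOn_const.mul hY))).mul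
      (contDiffOn_star hψ)).neg.const_smul _
  exact h1.congr fun x hx => evolution_eq hI hIc h hx

theorem calY_offDiag (x : ℝ) :
    origin m * calY F D u x + calY F D u x * origin m = calY F D u x := by
  rw [calY, adInvH]
  conv_rhs => rw [← mMat_offDiag 1 0, ← mMat_offDiag _ (-(F.along u x).2)]
  simp only [mul_sub, sub_mul, mul_smul_comm, smul_mul_assoc, smul_add]
  abel

theorem star_calY (x : ℝ) : star (calY F D u x) = -calY F D u x := by
  rw [calY, star_sub, star_smul, star_mMat, star_adInvH]; simp; abel

theorem conj_mem_tangent {U W : Mat m} (hU : U ∈ UGroup m) (hW : star W = W)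
    (ho : origin m * W + W * origin m = W) :
    U * W * star U ∈ tangent (U * origin m * star U) := by
  have h1 : star U * U = 1 := (Unitary.mem_iff.1 hU).1
  have h2 : ∀ A, star U * (U * A) = A := fun A => by rw [← mul_assoc, h1, one_mul]
  constructor
  · simp only [star_mul, star_star, hW, mul_assoc]
  · conv_rhs => rw [← ho]
    simp only [mul_assoc, h2, mul_add, add_mul]

theorem pairing_mem_tangent {U X : Mat m} (hU : U ∈ UGroup m) (hX : star X = -X) :
    pairing U X ∈ tangent (U * origin m * star U) := by
  have o2 := origin_sq m
  have : pairing U X = U * -⁅X, origin m⁆ * star U := by rw [pairing, mul_neg, neg_mul]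
  rw [this]
  refine conj_mem_tangent hU ?_ ?_
  · simp only [Ring.lie_def, star_neg, star_sub, star_mul, star_origin, hX]; noncomm_ring
  · simp only [Ring.lie_def, mul_neg, neg_mul, mul_sub, sub_mul, ← mul_assoc, o2]
    rw [mul_assoc X, o2]; abel

theorem coframe_pairing {U X : Mat m} (hU : U ∈ UGroup m)
    (ho : origin m * X + X * origin m = X) : coframe U (pairing U X) = -X := by
  have h1 := coframe_conj hU (-⁅X, origin m⁆)
  rw [mul_neg, neg_mul] at h1
  rw [pairing, h1]
  have := lie_lie_of_offDiag (origin_sq m) ho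
  have h2 : ⁅-⁅X, origin m⁆, origin m⁆ = -⁅⁅X, origin m⁆, origin m⁆ := by
    simp only [Ring.lie_def]; noncomm_ring
  rw [h2, this]

theorem smul_mem_tangent {P Z : Mat m} (r : ℝ) (h : Z ∈ tangent P) : r • Z ∈ tangent P := by
  refine ⟨by rw [star_smul, h.1]; simp, ?_⟩
  rw [mul_smul_comm, smul_mul_assoc, ← smul_add, h.2]

theorem evolution_mem_tangent (hI : IsOpen I) (hIc : I.OrdConnected)
    (h : IsParallelFrame I γ ψ u) {x : ℝ} (hx : x ∈ I) :
    evolution F D γ x ∈ tangent (γ x) := by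
  rw [evolution_eq hI hIc h hx, h.lift x hx]
  exact smul_mem_tangent _ (pairing_mem_tangent (h.mem x hx) (star_calY x))

theorem killing_ex {X : Mat m} (hX : star X = -X) :
    killing X (ex m) = -(8 * (((m : ℝ) + 1) + 2) * (Real.sqrt (chi m))⁻¹) * mParCoeff X := by
  have h10 : X 1 0 = -star (X 0 1) := by
    have := congrFun (congrFun hX 1) 0
    rw [Matrix.star_apply] at this
    rw [this, Matrix.neg_apply, neg_neg]
  have e : Matrix.trace (X * ex m) = (Real.sqrt (chi m))⁻¹ • (X 1 0 - X 0 1) := by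
    simp only [Matrix.trace, Matrix.diag, Fin.sum_univ_succ (n := m + 1),
      Fin.sum_univ_succ (n := m), Fin.succ_zero_eq_one, mul_apply_two]
    simp [ex, smul_sub]
    abel
  have e2 : (Matrix.trace (X * ex m)).re = (Real.sqrt (chi m))⁻¹ * ((X 1 0).re - (X 0 1).re) := by
    rw [e]; rfl
  have e3 : (X 1 0).re = -(X 0 1).re := by rw [h10]; simp
  rw [killing, e2, e3, mParCoeff]; ring

theorem tproj_mem_tangent {P A : Mat m} (hP : star P = P) (hP2 : P * P = P) (hA : star A = A) :
    tproj P A ∈ tangent P := by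
  constructor
  · simp only [tproj, star_add, star_mul, star_sub, star_one, hP, hA, ← mul_assoc]
    abel
  · simp only [tproj, mul_add, add_mul, mul_sub, sub_mul, mul_one, one_mul]
    simp only [← mul_assoc, hP2]
    simp only [mul_assoc, hP2]
    abel

theorem mParCoeff_adInvH (v : Cov m) : mParCoeff (adInvH v) = 0 := by
  have hq : star (v.1 : Quat) = -(v.1 : Quat) := skewAdjoint.mem_iff.1 v.1.2
  have h0 : (v.1 : Quat).re = 0 := by
    have := congrArg (fun q : Quat => q.re) hq
    simp only [Quaternion.re_star, Quaternion.re_neg] at this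
    linarith
  simp [mParCoeff, adInvH, h0]

theorem mParCoeff_lie_perpMat_mMat_one (v : Cov m) : mParCoeff ⁅perpMat v, (mMat 1 0 : Mat m)⁆ = 0 := by
  have hq : star (v.1 : Quat) = -(v.1 : Quat) := skewAdjoint.mem_iff.1 v.1.2
  have h0 : (v.1 : Quat).re = 0 := by
    have := congrArg (fun q : Quat => q.re) hq
    simp only [Quaternion.re_star, Quaternion.re_neg] at this
    linarith
  rw [mParCoeff, Ring.lie_def, Matrix.sub_apply, mul_apply_two, mul_apply_two]
  simp [perpMat, h0]

/-- In the frame, ∇_xY is -χ⁻¹(D_x𝒴 + [u, 𝒴]). Its inner product with γ_x sees only the 𝔪_∥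
coefficient. There D_x of the primitive gives [u, ad(e_x)⁻¹h^⊥]_∥, and [u, 𝒴]_∥ gives its negative
because [u, (1, 0)] has no 𝔪_∥ part. -/
theorem metric_covDeriv_evolution (hI : IsOpen I) (hIc : I.OrdConnected) (hγ : IsUnitSpeed I γ)
    (h : IsParallelFrame I γ ψ u) {x : ℝ} (hx : x ∈ I) :
    metric (covDeriv γ (evolution F D γ) x) (mderiv γ x) = 0 := by
  have hu := h.contDiffOn_covariants hI
  have hev : ∀ᶠ y in 𝓝 x, y ∈ I := hI.mem_nhds hx
  have hYd := hasDerivAt_mderiv hI (evolution_contDiffOn (F := F) (D := D) hI hIc h) hx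
  have hcov : covDeriv γ (evolution F D γ) x ∈ tangent (γ x) := by
    refine tproj_mem_tangent (mem_HP_star (hγ.mem x hx)) (mem_HP_sq (hγ.mem x hx)) ?_
    exact ((hasDerivAt_star hYd).congr_of_eventuallyEq
      (hev.mono fun y hy => (evolution_mem_tangent hI hIc h hy).1.symm)).unique hYd
  have hT := hγ.mderiv_mem_tangent hI hx
  have hψd := hasDerivAt_mderiv hI (msmoothOn_iff.1 h.smooth) hx
  have key := mhasDerivAt_iff.1 (coframe_covDeriv (mhasDerivAt_iff.2 hψd) (mhasDerivAt_iff.2 hYd)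
    (h.eventually_mem hI hx) (h.lift x hx) (evolution_mem_tangent hI hIc h hx))
  have hco : ∀ y ∈ I, coframe (ψ y) (evolution F D γ y) = -((chi m)⁻¹ • calY F D u y) := by
    intro y hy
    have : ∀ (r : ℝ) (Z : Mat m), coframe (ψ y) (r • Z) = r • coframe (ψ y) Z := fun r Z => by
      simp only [coframe, Ring.lie_def, mul_smul_comm, smul_mul_assoc, smul_sub]
    rw [evolution_eq hI hIc h hy, this, coframe_pairing (h.mem y hy) (calY_offDiag y), smul_neg]
  rw [h.connection_x x hx, hco x hx] at key
  have hYc := hasDerivAt_mderiv hI (contDiffOn_calY F D hI hu) hx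
  have h1 := key.unique ((hYc.const_smul (chi m)⁻¹).neg.congr_of_eventuallyEq
    (hev.mono fun y hy => hco y hy))
  have hpar : mParCoeff (mderiv (calY F D u) x) = mParCoeff ⁅perpMat (u x), adInvH (F.along u x)⁆ := by
    refine ((mParCLM m).hasFDerivAt.comp_hasDerivAt x hYc).unique
      ((D.hasDerivAt u hu x hx).congr_of_eventuallyEq (Eventually.of_forall fun y => ?_))
    simp only [Function.comp, calY, map_sub, map_smul, mParCLM_apply, mParCoeff_adInvH, sub_zero]
    exact mul_one _
  have hlie : mParCoeff ⁅perpMat (u x), calY F D u x⁆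
      = -mParCoeff ⁅perpMat (u x), adInvH (F.along u x)⁆ := by
    have : ⁅perpMat (u x), calY F D u x⁆ = D.prim u x • ⁅perpMat (u x), mMat 1 0⁆
        - ⁅perpMat (u x), adInvH (F.along u x)⁆ := by
      simp only [calY, Ring.lie_def, mul_sub, sub_mul, mul_smul_comm, smul_mul_assoc, smul_sub]
      abel
    rw [this, ← mParCLM_apply, map_sub, map_smul, mParCLM_apply, mParCLM_apply,
      mParCoeff_lie_perpMat_mMat_one, smul_zero, zero_sub]
  have h2 : mParCoeff (coframe (ψ x) (covDeriv γ (evolution F D γ) x)) = 0 := by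
    have h3 : coframe (ψ x) (covDeriv γ (evolution F D γ) x)
        = -((chi m)⁻¹ • mderiv (calY F D u) x) - (chi m)⁻¹ • ⁅perpMat (u x), calY F D u x⁆ := by
      rw [← h1]
      simp only [Ring.lie_def, mul_neg, neg_mul, mul_smul_comm, smul_mul_assoc, smul_sub]
      abel
    rw [h3, ← mParCLM_apply, map_sub, map_neg, map_smul, map_smul, mParCLM_apply, mParCLM_apply,
      hpar, hlie]
    simp
  have hm : metric _ _ = _ := metric_eq_killing ⟨ψ x, h.mem x hx⟩ (covDeriv γ (evolution F D γ) x)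
    (mderiv γ x) (by rw [h.lift x hx] at hcov; exact hcov) (by rw [h.lift x hx] at hT; exact hT)
  have hsk : star (coframe (ψ x) (covDeriv γ (evolution F D γ) x))
      = -coframe (ψ x) (covDeriv γ (evolution F D γ) x) := by
    simp only [coframe, Ring.lie_def, star_sub, star_mul, star_star, hcov.1, star_origin, mul_assoc]
    abel
  rw [hm]
  simp only
  rw [h.coframe_x x hx, killing_ex hsk, h2]
  simp

end Evolution

end

end QuatCurve

namespace QuatCurve

noncomputable section

open Topology Filter

attribute [local instance] Matrix.linftyOpNormedRing Matrix.linftyOpNormedAlgebra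

/-! ### Jets determined by the covariant recursion -/

section Jets

/-- Two solutions of the recursion `E_{i+1} = D_x E_i + [L E_1, E_i]` with the same values at a
point have the same jets there. -/
theorem iteratedDeriv_eq_of_recursion {R : Type*} [NormedRing R] [NormedAlgebra ℝ R] {I : Set ℝ}
    (hI : IsOpen I) (L : R →L[ℝ] R) {E G : ℕ → ℝ → R} (hE : ∀ i, ContDiffOn ℝ ∞ (E i) I)
    (hG : ∀ i, ContDiffOn ℝ ∞ (G i) I)
    (hE' : ∀ i, ∀ y ∈ I, HasDerivAt (E i) (E (i + 1) y - (L (E 1 y) * E i y - E i y * L (E 1 y))) y)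
    (hG' : ∀ i, ∀ y ∈ I, HasDerivAt (G i) (G (i + 1) y - (L (G 1 y) * G i y - G i y * L (G 1 y))) y)
    (h0 : ∀ y ∈ I, E 0 y = G 0 y) {x : ℝ} (hx : x ∈ I) {N : ℕ} (h : ∀ i ≤ N, E i x = G i x)
    (r : ℕ) : ∀ i, i + r ≤ N → iteratedDeriv r (E i) x = iteratedDeriv r (G i) x := by
  -- The induction is on the number of derivatives, for all indices of weight i + r at most N. The
  -- recursion trades one derivative for one index, and each factor in the Leibniz sums again has
  -- weight at most N.
  induction r using Nat.strong_induction_on with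
  | _ r ih =>
  intro i hi
  rcases i with _ | i
  · refine Filter.EventuallyEq.iteratedDeriv_eq r ?_
    filter_upwards [hI.mem_nhds hx] with y hy using h0 y hy
  rcases r with _ | r
  · simpa using h _ hi
  have hat : ∀ {f : ℝ → R}, ContDiffOn ℝ ∞ f I → ContDiffAt ℝ r f x := fun hf =>
    (hf.contDiffAt (hI.mem_nhds hx)).of_le (mod_cast le_top)
  have expand : ∀ {H : ℕ → ℝ → R}, (∀ i, ContDiffOn ℝ ∞ (H i) I) →
      (∀ i, ∀ y ∈ I, HasDerivAt (H i) (H (i + 1) y - (L (H 1 y) * H i y - H i y * L (H 1 y))) y) →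
      iteratedDeriv (r + 1) (H (i + 1)) x = iteratedDeriv r (H (i + 2)) x -
        (∑ j ∈ Finset.range (r + 1), r.choose j * L (iteratedDeriv j (H 1) x)
            * iteratedDeriv (r - j) (H (i + 1)) x -
          ∑ j ∈ Finset.range (r + 1), r.choose j * iteratedDeriv j (H (i + 1)) x
            * L (iteratedDeriv (r - j) (H 1) x)) := by
    intro H hH hH'
    have hL : ContDiffOn ℝ ∞ (fun y => L (H 1 y)) I := L.contDiff.comp_contDiffOn (hH 1)
    have hLj : ∀ j, iteratedDeriv j (fun y => L (H 1 y)) x = L (iteratedDeriv j (H 1) x) := fun j =>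
      iteratedDeriv_clm hI L (hH 1) (fun y _ => rfl) j hx
    have e1 : deriv (H (i + 1)) =ᶠ[𝓝 x]
        (H (i + 2) - ((fun y => L (H 1 y)) * H (i + 1) - H (i + 1) * fun y => L (H 1 y))) := by
      filter_upwards [hI.mem_nhds hx] with y hy using (hH' (i + 1) y hy).deriv
    have s1 : ContDiffAt ℝ r ((fun y => L (H 1 y)) * H (i + 1)) x := hat (hL.mul (hH _))
    have s2 : ContDiffAt ℝ r (H (i + 1) * fun y => L (H 1 y)) x := hat ((hH _).mul hL)
    have s3 : ContDiffAt ℝ r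
        ((fun y => L (H 1 y)) * H (i + 1) - H (i + 1) * fun y => L (H 1 y)) x := s1.sub s2
    rw [iteratedDeriv_succ', e1.iteratedDeriv_eq, iteratedDeriv_sub (hat (hH _)) s3,
      iteratedDeriv_sub s1 s2,
      iteratedDeriv_mul (hat hL) (hat (hH _)), iteratedDeriv_mul (hat (hH _)) (hat hL)]
    simp only [hLj]
  rw [expand hE hE', expand hG hG', ih r (by omega) (i + 2) (by omega)]
  congr 2
  · refine Finset.sum_congr rfl fun j hj => ?_
    have hj' := Finset.mem_range.1 hj
    rw [ih j (by omega) 1 (by omega), ih (r - j) (by omega) (i + 1) (by omega)]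
  · refine Finset.sum_congr rfl fun j hj => ?_
    have hj' := Finset.mem_range.1 hj
    rw [ih j (by omega) (i + 1) (by omega), ih (r - j) (by omega) 1 (by omega)]

end Jets

/-! ### Invariance under the unitary group and dependence on covariant jets -/

section Invariance

variable {m : ℕ} {I : Set ℝ} {γ ψ : ℝ → Mat m} {u : ℝ → Cov m}

theorem IsParallelFrame.contDiffOn_curve (h : IsParallelFrame I γ ψ u) : ContDiffOn ℝ ∞ γ I := by
  have hψ := msmoothOn_iff.1 h.smooth
  exact ((hψ.mul contDiffOn_const).mul (contDiffOn_star hψ)).congr fun x hx => h.lift x hx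

theorem mem_HP_of_mem_unitary {U : Mat m} (hU : U ∈ UGroup m) : U * origin m * star U ∈ HP m := by
  refine ⟨fun i => U i 0, ?_, ?_⟩
  · have h1 := congrFun (congrFun (Unitary.mem_iff.1 hU).1 0) 0
    rw [Matrix.mul_apply] at h1
    simp only [Matrix.star_apply] at h1
    rw [sum_star_mul_self] at h1
    exact Quaternion.coe_injective (h1.trans (by simp))
  · ext1 i j
    rw [Matrix.mul_assoc, Matrix.mul_apply, Finset.sum_eq_single 0]
    · simp [origin_mul_apply, Matrix.vecMulVec_apply]
    · intro k _ hk; simp [origin_mul_apply, hk]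
    · simp

theorem IsParallelFrame.isUnitSpeed (hI : IsOpen I) (h : IsParallelFrame I γ ψ u) :
    IsUnitSpeed I γ where
  mem x hx := by rw [h.lift x hx]; exact mem_HP_of_mem_unitary (h.mem x hx)
  smooth := msmoothOn_iff.2 h.contDiffOn_curve
  unit x hx := by
    have hd := hasDerivAt_of_lift (h.hasDerivAt hI hx) (h.eventually_mem hI hx)
      (h.eventually_lift hI hx)
    have h1 : star (ψ x) * ψ x = 1 := (Unitary.mem_iff.1 (h.mem x hx)).1
    have hlie : ⁅ex m + perpMat (u x), origin m⁆ = ⁅ex m, origin m⁆ := by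
      simp only [Ring.lie_def, add_mul, mul_add, perpMat_diag]; abel
    have hT : mderiv γ x ∈ tangent (uconj ⟨ψ x, h.mem x hx⟩ (origin m)) := by
      rw [mderiv_of_hasDerivAt hd, ← mul_assoc, h1, one_mul, hlie]
      refine conj_mem_tangent (h.mem x hx) ?_ ?_
      · simp only [Ring.lie_def, star_sub, star_mul, star_origin, star_ex]; noncomm_ring
      · have o2 := origin_sq m
        simp only [Ring.lie_def, mul_sub, sub_mul, ← mul_assoc, o2]
        rw [mul_assoc (ex m), o2]; abel
    rw [metric_eq_killing ⟨ψ x, h.mem x hx⟩ _ _ hT hT]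
    simp only
    rw [h.coframe_x x hx, killing_ex star_ex]
    have e : mParCoeff (ex m) = (Real.sqrt (chi m))⁻¹ := by
      have : mParCoeff (ex m) = (Real.sqrt (chi m))⁻¹ * 1 := rfl
      rw [this, mul_one]
    have hs := Real.mul_self_sqrt (chi_pos m).le
    have hc := sqrt_chi_ne (m := m)
    rw [e, show 8 * ((m : ℝ) + 1 + 2) = chi m from rfl]
    generalize Real.sqrt (chi m) = s at hs hc ⊢
    rw [← hs]
    field_simp

/-- A constant left factor drops out of ψ⁻¹ψ', so congruent curves share their covariants. -/
theorem IsParallelFrame.uconj (hI : IsOpen I) (h : IsParallelFrame I γ ψ u) (g : UGroup m) :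
    IsParallelFrame I (fun y => uconj g (γ y)) (fun y => (g : Mat m) * ψ y) u := by
  refine isParallelFrame_of_hasDerivAt hI (contDiffOn_const.mul (msmoothOn_iff.1 h.smooth))
    (fun x hx => mul_mem g.2 (h.mem x hx)) (fun x hx => ?_) fun x hx => ?_
  · rw [QuatCurve.uconj, h.lift x hx, star_mul]; simp only [mul_assoc]
  · rw [mul_assoc]; exact (h.hasDerivAt hI hx).const_mul (g : Mat m)

theorem pairing_uconj (g : UGroup m) (U X : Mat m) :
    pairing ((g : Mat m) * U) X = uconj g (pairing U X) := by
  rw [pairing, pairing, uconj, star_mul, mul_neg, neg_mul]; simp only [mul_assoc]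

theorem uconj_smul (g : UGroup m) (r : ℝ) (Z : Mat m) : uconj g (r • Z) = r • uconj g Z := by
  rw [uconj, uconj, mul_smul_comm, smul_mul_assoc]

theorem evolution_uconj {F : EquivariantFlow m I} {D : NonlocalTerm F} (hI : IsOpen I)
    (hIc : I.OrdConnected) (h : IsParallelFrame I γ ψ u) (g : UGroup m) {x : ℝ} (hx : x ∈ I) :
    evolution F D (fun y => uconj g (γ y)) x = uconj g (evolution F D γ x) := by
  rw [evolution_eq hI hIc h hx, evolution_eq hI hIc (h.uconj hI g) hx, pairing_uconj, uconj_smul]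

theorem hasDerivAt_uconj (g : UGroup m) {Z : ℝ → Mat m} {Z' : Mat m} {x : ℝ}
    (h : HasDerivAt Z Z' x) : HasDerivAt (fun y => uconj g (Z y)) (uconj g Z') x :=
  hasDerivAt_conj _ _ h

theorem contDiffOn_covIter (hI : IsOpen I) (hγ : ContDiffOn ℝ ∞ γ I) (i : ℕ) :
    ContDiffOn ℝ ∞ (covIter γ i) I := by
  induction i with
  | zero => exact contDiffOn_mderiv hI hγ
  | succ i ih =>
    have h1 := contDiffOn_mderiv hI ih
    have h2 : ContDiffOn ℝ ∞ (fun x => 1 - γ x) I := contDiffOn_const.sub hγ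
    exact ((hγ.mul h1).mul h2).add ((h2.mul h1).mul hγ)

theorem covIter_mem_tangent (hI : IsOpen I) (hγ : IsUnitSpeed I γ) (i : ℕ) :
    ∀ x ∈ I, covIter γ i x ∈ tangent (γ x) := by
  induction i with
  | zero => exact fun x hx => hγ.mderiv_mem_tangent hI hx
  | succ i ih =>
    intro x hx
    have hd := hasDerivAt_mderiv hI (contDiffOn_covIter hI (msmoothOn_iff.1 hγ.smooth) i) hx
    refine tproj_mem_tangent (mem_HP_star (hγ.mem x hx)) (mem_HP_sq (hγ.mem x hx)) ?_
    refine ((hasDerivAt_star hd).congr_of_eventuallyEq ?_).unique hd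
    filter_upwards [hI.mem_nhds hx] with y hy using (ih y hy).1.symm

theorem covIter_uconj (hI : IsOpen I) (hγ : ContDiffOn ℝ ∞ γ I) (g : UGroup m) (i : ℕ) :
    ∀ x ∈ I, covIter (fun y => uconj g (γ y)) i x = uconj g (covIter γ i x) := by
  have hg : star (g : Mat m) * g = 1 := (Unitary.mem_iff.1 g.2).1
  have hg' : (g : Mat m) * star (g : Mat m) = 1 := (Unitary.mem_iff.1 g.2).2
  induction i with
  | zero =>
    exact fun x hx => mderiv_of_hasDerivAt (hasDerivAt_uconj g (hasDerivAt_mderiv hI hγ hx))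
  | succ i ih =>
    intro x hx
    have hd := hasDerivAt_uconj g (hasDerivAt_mderiv hI (contDiffOn_covIter hI hγ i) hx)
    have e : mderiv (covIter (fun y => uconj g (γ y)) i) x = uconj g (mderiv (covIter γ i) x) := by
      refine mderiv_of_hasDerivAt (hd.congr_of_eventuallyEq ?_)
      filter_upwards [hI.mem_nhds hx] with y hy using ih y hy
    have h2 : ∀ A B : Mat m, uconj g A * uconj g B = uconj g (A * B) := fun A B => by
      simp only [uconj]
      calc _ = (g : Mat m) * A * (star (g : Mat m) * g) * B * star (g : Mat m) := by
            simp only [mul_assoc]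
        _ = _ := by rw [hg, mul_one]; simp only [mul_assoc]
    have h3 : ∀ A : Mat m, 1 - uconj g A = uconj g (1 - A) := fun A => by
      simp only [uconj, mul_sub, sub_mul, mul_one, hg']
    have h4 : ∀ A B : Mat m, uconj g A + uconj g B = uconj g (A + B) := fun A B => by
      simp only [uconj, mul_add, add_mul]
    change tproj _ (mderiv (covIter (fun y => uconj g (γ y)) i) x)
      = uconj g (tproj _ (mderiv (covIter γ i) x))
    rw [e]
    simp only [tproj, h2, h3, h4]

/-- The covariants of two aligned frames have the same jets at a point where the curves have the
same covariant jets. -/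
theorem iteratedDeriv_covariants_eq (hI : IsOpen I) {γ₁ γ₂ ψ₁ ψ₂ : ℝ → Mat m} {u₁ u₂ : ℝ → Cov m}
    (h₁ : IsParallelFrame I γ₁ ψ₁ u₁) (h₂ : IsParallelFrame I γ₂ ψ₂ u₂) {x : ℝ} (hx : x ∈ I)
    (hψ : ψ₁ x = ψ₂ x) {k : ℕ} (hk : ∀ i ≤ k + 1, covIter γ₁ i x = covIter γ₂ i x) :
    ∀ i ≤ k, iteratedDeriv i u₁ x = iteratedDeriv i u₂ x := by
  -- L sends E_1 = [u, e_x] back to u. The recursion for E_i = e⌋∇_x^iγ_x thereby closes up and no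
  -- longer mentions u.
  let L : Mat m →L[ℝ] Mat m := LinearMap.toContinuousLinearMap (-adInvMLin m)
  have hL : ∀ X, L X = -adInvM X := fun X => rfl
  have hE : ∀ {γ ψ : ℝ → Mat m} {u : ℝ → Cov m}, IsParallelFrame I γ ψ u → ∀ i,
      ContDiffOn ℝ ∞ (fun y => coframe (ψ y) (covIter γ i y)) I := fun {γ ψ u} h i => by
    have hψ := msmoothOn_iff.1 h.smooth
    have h1 := ((contDiffOn_star hψ).mul (contDiffOn_covIter hI h.contDiffOn_curve i)).mul hψ
    exact (h1.mul contDiffOn_const).sub (contDiffOn_const.mul h1)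
  have hd : ∀ {γ ψ : ℝ → Mat m} {u : ℝ → Cov m}, IsParallelFrame I γ ψ u → ∀ i, ∀ y ∈ I,
      HasDerivAt (fun y => coframe (ψ y) (covIter γ i y))
        (coframe (ψ y) (covIter γ (i + 1) y) - ⁅perpMat (u y), coframe (ψ y) (covIter γ i y)⁆) y := by
    intro γ ψ u h i y hy
    have hus := h.isUnitSpeed hI
    have := mhasDerivAt_iff.1 (coframe_covDeriv
      (mhasDerivAt_iff.2 (hasDerivAt_mderiv hI (msmoothOn_iff.1 h.smooth) hy))
      (mhasDerivAt_iff.2 (hasDerivAt_mderiv hI (contDiffOn_covIter hI h.contDiffOn_curve i) hy))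
      (h.eventually_mem hI hy) (h.lift y hy) (covIter_mem_tangent hI hus i y hy))
    rwa [h.connection_x y hy] at this
  have hu : ∀ {γ ψ : ℝ → Mat m} {u : ℝ → Cov m}, IsParallelFrame I γ ψ u → ∀ y ∈ I,
      perpMat (u y) = L (coframe (ψ y) (covIter γ 1 y)) := by
    intro γ ψ u h y hy
    -- E_0 is the constant e_x, so its recursion reads 0 = E_1 - [u, e_x].
    have e := (hd h 0 y hy).unique ((hasDerivAt_const y (ex m)).congr_of_eventuallyEq (by
      filter_upwards [hI.mem_nhds hy] with z hz using h.coframe_x z hz))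
    have e0 : coframe (ψ y) (covIter γ 0 y) = ex m := h.coframe_x y hy
    rw [e0] at e
    rw [sub_eq_zero.1 e, hL, adInvM_lie_ex]
  have hd' : ∀ {γ ψ : ℝ → Mat m} {u : ℝ → Cov m}, IsParallelFrame I γ ψ u → ∀ i, ∀ y ∈ I,
      HasDerivAt (fun y => coframe (ψ y) (covIter γ i y))
        (coframe (ψ y) (covIter γ (i + 1) y) -
          (L (coframe (ψ y) (covIter γ 1 y)) * coframe (ψ y) (covIter γ i y)
            - coframe (ψ y) (covIter γ i y) * L (coframe (ψ y) (covIter γ 1 y)))) y := by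
    intro γ ψ u h i y hy
    rw [← hu h y hy]
    exact hd h i y hy
  -- The weight is k + 1 because the i-th derivative of u comes from the i-th derivative of E_1.
  have key := iteratedDeriv_eq_of_recursion hI L
    (E := fun i y => coframe (ψ₁ y) (covIter γ₁ i y))
    (G := fun i y => coframe (ψ₂ y) (covIter γ₂ i y)) (hE h₁) (hE h₂) (hd' h₁) (hd' h₂)
    (fun y hy => (h₁.coframe_x y hy).trans (h₂.coframe_x y hy).symm) hx (N := k + 1)
    (fun i hi => by simp only [hψ, hk i hi])
  let T : Mat m →L[ℝ] Cov m := (LinearMap.toContinuousLinearMap (compLin m)).comp L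
  have hT : ∀ {γ ψ : ℝ → Mat m} {u : ℝ → Cov m}, IsParallelFrame I γ ψ u → ∀ i,
      iteratedDeriv i u x = T (iteratedDeriv i (fun y => coframe (ψ y) (covIter γ 1 y)) x) :=
    fun {γ ψ u} h i => iteratedDeriv_clm hI T (hE h 1) (fun y hy => by
      change u y = compLin m (L (coframe (ψ y) (covIter γ 1 y)))
      rw [← hu h y hy, compLin_perpMat]) i hx
  intro i hi
  rw [hT h₁, hT h₂, key i 1 (by omega)]

/-- The curves agree only to finite order at one point. Their frames there are adapted to the same
tangent vector, so a constant isotropy change aligns them at x, after which the recursion compares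
the jets. -/
theorem exists_act_jet (hI : IsOpen I) {γ₁ γ₂ ψ₁ ψ₂ : ℝ → Mat m} {u₁ u₂ : ℝ → Cov m}
    (h₁ : IsParallelFrame I γ₁ ψ₁ u₁) (h₂ : IsParallelFrame I γ₂ ψ₂ u₂) {x : ℝ} (hx : x ∈ I)
    {k : ℕ} (hγ : γ₁ x = γ₂ x) (hk : curveJet (k + 1) γ₁ x = curveJet (k + 1) γ₂ x) :
    ∃ a A, ψ₁ x = ψ₂ x * star (actMat a A) ∧
      ∀ l ≤ k, jet l u₁ x = jet l (fun y => act a A (u₂ y)) x := by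
  have hk' : ∀ i ≤ k + 1, covIter γ₁ i x = covIter γ₂ i x := fun i hi =>
    congrFun hk ⟨i, by omega⟩
  obtain ⟨a, A, h⟩ := exists_actMat (h₁.mem x hx) (h₂.mem x hx) (h₁.lift x hx)
    (by rw [hγ]; exact h₂.lift x hx) (h₁.coframe_x x hx)
    (by rw [show mderiv γ₁ x = mderiv γ₂ x from hk' 0 (by omega)]; exact h₂.coframe_x x hx)
  refine ⟨a, A, h, fun l hl => funext fun i => ?_⟩
  exact iteratedDeriv_covariants_eq hI h₁ (h₂.change hI a A) hx h hk' i (by omega)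

open Classical in
/-- A functional equivariant relation extends to an equivariant function. -/
theorem exists_equivariant_fn {k : ℕ} {X : Type*} (op : UGroup m → X → X) (d : X)
    (hd : ∀ g, op g d = d) (R : ℝ → Mat m → (Fin k → Mat m) → X → Prop)
    (hfun : ∀ x P Z V W, R x P Z V → R x P Z W → V = W)
    (hequiv : ∀ g x P Z V, R x P Z V → R x (uconj g P) (fun i => uconj g (Z i)) (op g V)) :
    ∃ N : ℝ → Mat m → (Fin k → Mat m) → X,
      (∀ g x P Z, N x (uconj g P) (fun i => uconj g (Z i)) = op g (N x P Z)) ∧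
      ∀ x P Z V, R x P Z V → N x P Z = V := by
  -- Data related to no value get the default `d`. Equivariance survives because `d` is fixed by the
  -- group and, by applying g⁻¹, the set of such data is invariant.
  let N : ℝ → Mat m → (Fin k → Mat m) → X := fun x P Z =>
    if h : ∃ V, R x P Z V then h.choose else d
  have hN : ∀ x P Z V, R x P Z V → N x P Z = V := fun x P Z V hV => by
    have h : ∃ V, R x P Z V := ⟨V, hV⟩
    simp only [N, dif_pos h]
    exact hfun x P Z _ _ h.choose_spec hV
  refine ⟨N, fun g x P Z => ?_, hN⟩
  by_cases h : ∃ V, R x P Z V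
  · obtain ⟨V, hV⟩ := h
    rw [hN x P Z V hV, hN _ _ _ _ (hequiv g x P Z V hV)]
  · have h' : ¬∃ V, R x (uconj g P) (fun i => uconj g (Z i)) V := by
      rintro ⟨V, hV⟩
      have hc : ∀ A : Mat m, uconj (star g) (uconj g A) = A := fun A => by
        simp only [uconj, Unitary.coe_star, star_star]
        have := conj_conj g.2 A
        simpa only [mul_assoc] using this
      have := hequiv (star g) _ _ _ _ hV
      simp only [hc] at this
      exact h ⟨_, this⟩
    simp only [N, dif_neg h, dif_neg h', hd]

theorem curveJet_uconj (hI : IsOpen I) (hγ : ContDiffOn ℝ ∞ γ I) (g : UGroup m) (k : ℕ) {x : ℝ}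
    (hx : x ∈ I) : curveJet k (fun y => uconj g (γ y)) x = fun i => uconj g (curveJet k γ x i) :=
  funext fun i => covIter_uconj hI hγ g i x hx

theorem mParCoeff_lie_act (a : unitary Quat) (A : unitary (Matrix (Fin m) (Fin m) Quat))
    (v w : Cov m) : mParCoeff ⁅perpMat (act a A v), adInvH (act a A w)⁆
      = mParCoeff ⁅perpMat v, adInvH w⁆ := by
  rw [← actMat_conj_perpMat, ← actMat_conj_adInvH, actMat_conj_lie, actMat,
    mParCoeff_isoMat_conj]

variable (F : EquivariantFlow m I) (D : NonlocalTerm F)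

/-- Values are assigned to jets realised by framed curves; single-valuedness is `exists_act_jet`
together with equivariance of h^⊥ and `pairing_change`. One order is added because u itself involves
∇_xγ_x. -/
theorem exists_normal_part (hI : IsOpen I) :
    ∃ N : ℝ → Mat m → (Fin (F.order + 1 + 1) → Mat m) → Mat m,
      (∀ g x P Z, N x (uconj g P) (fun i => uconj g (Z i)) = uconj g (N x P Z)) ∧
      ∀ γ ψ u, IsParallelFrame I γ ψ u → ∀ x ∈ I, N x (γ x) (curveJet (F.order + 1) γ x)
        = -((chi m)⁻¹ • pairing (ψ x) (adInvH (F.along u x))) := by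
  refine Exists.imp ?_ (exists_equivariant_fn (k := F.order + 1 + 1) (m := m) uconj 0
    (fun g => by simp [uconj]) (fun x P Z V => ∃ γ ψ u, IsParallelFrame I γ ψ u ∧ x ∈ I ∧
      γ x = P ∧ curveJet (F.order + 1) γ x = Z ∧
      V = -((chi m)⁻¹ • pairing (ψ x) (adInvH (F.along u x)))) ?_ ?_)
  · exact fun N ⟨hN1, hN2⟩ => ⟨hN1, fun γ ψ u h x hx => hN2 _ _ _ _ ⟨γ, ψ, u, h, hx, rfl, rfl, rfl⟩⟩
  · rintro x P Z V W ⟨γ₁, ψ₁, u₁, h₁, hx, rfl, rfl, rfl⟩ ⟨γ₂, ψ₂, u₂, h₂, -, e1, e2, rfl⟩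
    obtain ⟨a, A, hψ, hj⟩ := exists_act_jet hI h₁ h₂ hx e1.symm e2.symm
    have : F.along u₁ x = act a A (F.along u₂ x) := by
      rw [← F.along_act hI a A (h₂.contDiffOn_covariants hI) (fun _ _ => rfl) hx,
        EquivariantFlow.along, hj _ le_rfl]; rfl
    rw [this, hψ, ← actMat_conj_adInvH, pairing_change]
  · rintro g x P Z V ⟨γ, ψ, u, h, hx, rfl, rfl, rfl⟩
    refine ⟨_, _, u, h.uconj hI g, hx, rfl, curveJet_uconj hI h.contDiffOn_curve g _ hx, ?_⟩
    rw [pairing_uconj, ← uconj_smul, uconj, uconj, mul_neg, neg_mul]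

theorem exists_integrand (hI : IsOpen I) :
    ∃ f : ℝ → Mat m → (Fin (F.order + 1 + 1) → Mat m) → ℝ,
      (∀ (g : UGroup m) x P Z, f x (uconj g P) (fun i => uconj g (Z i)) = f x P Z) ∧
      ∀ γ ψ u, IsParallelFrame I γ ψ u → ∀ x ∈ I, f x (γ x) (curveJet (F.order + 1) γ x)
        = -((chi m)⁻¹ * Real.sqrt (chi m)) * mParCoeff ⁅perpMat (u x), adInvH (F.along u x)⁆ := by
  refine Exists.imp ?_ (exists_equivariant_fn (k := F.order + 1 + 1) (m := m)
    (fun _ r => r) (0 : ℝ) (fun g => rfl) (fun x P Z V => ∃ γ ψ u, IsParallelFrame I γ ψ u ∧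
      x ∈ I ∧ γ x = P ∧ curveJet (F.order + 1) γ x = Z ∧
      V = -((chi m)⁻¹ * Real.sqrt (chi m)) * mParCoeff ⁅perpMat (u x), adInvH (F.along u x)⁆) ?_ ?_)
  · exact fun f ⟨hf1, hf2⟩ => ⟨hf1, fun γ ψ u h x hx => hf2 _ _ _ _ ⟨γ, ψ, u, h, hx, rfl, rfl, rfl⟩⟩
  · rintro x P Z V W ⟨γ₁, ψ₁, u₁, h₁, hx, rfl, rfl, rfl⟩ ⟨γ₂, ψ₂, u₂, h₂, -, e1, e2, rfl⟩
    obtain ⟨a, A, hψ, hj⟩ := exists_act_jet hI h₁ h₂ hx e1.symm e2.symm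
    have h1 : F.along u₁ x = act a A (F.along u₂ x) := by
      rw [← F.along_act hI a A (h₂.contDiffOn_covariants hI) (fun _ _ => rfl) hx,
        EquivariantFlow.along, hj _ le_rfl]; rfl
    have h2 : u₁ x = act a A (u₂ x) := by
      simpa [jet] using congrFun (hj 0 (Nat.zero_le _)) 0
    rw [h1, h2, mParCoeff_lie_act]
  · rintro g x P Z V ⟨γ, ψ, u, h, hx, rfl, rfl, rfl⟩
    exact ⟨_, _, u, h.uconj hI g, hx, rfl, curveJet_uconj hI h.contDiffOn_curve g _ hx, rfl⟩

/-- When the primitive is a differential function, two curves with the same covariant jet can be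
compared in frames aligned at x. Then every ingredient of 𝒴 agrees there, whence the order max(k, l)
+ 1, where k is the order of the flow. -/
theorem exists_local_fn (hI : IsOpen I) (hIc : I.OrdConnected) {l : ℕ}
    {p : ℝ → (Fin (l + 1) → Cov m) → ℝ}
    (hp : ∀ u : ℝ → Cov m, ContDiffOn ℝ ∞ u I → ∀ x ∈ I, D.prim u x = p x (jet l u x)) :
    ∃ (k : ℕ) (G : ℝ → Mat m → (Fin (k + 1) → Mat m) → Mat m),
      (∀ g x P Z, G x (uconj g P) (fun i => uconj g (Z i)) = uconj g (G x P Z)) ∧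
      ∀ γ ψ u, IsParallelFrame I γ ψ u → ∀ x ∈ I,
        evolution F D γ x = G x (γ x) (curveJet k γ x) := by
  refine ⟨max F.order l + 1, Exists.imp ?_ (exists_equivariant_fn (k := max F.order l + 1 + 1) (m := m) uconj 0
    (fun g => by simp [uconj]) (fun x P Z V => ∃ γ ψ u, IsParallelFrame I γ ψ u ∧ x ∈ I ∧
      γ x = P ∧ curveJet (max F.order l + 1) γ x = Z ∧ V = evolution F D γ x) ?_ ?_)⟩
  · exact fun G ⟨hG1, hG2⟩ => ⟨hG1, fun γ ψ u h x hx => (hG2 _ _ _ _ ⟨γ, ψ, u, h, hx, rfl, rfl, rfl⟩).symm⟩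
  · rintro x P Z V W ⟨γ₁, ψ₁, u₁, h₁, hx, rfl, rfl, rfl⟩ ⟨γ₂, ψ₂, u₂, h₂, -, e1, e2, rfl⟩
    obtain ⟨a, A, hψ, hj⟩ := exists_act_jet hI h₁ h₂ hx e1.symm e2.symm
    have h₃ := h₂.change hI a A
    rw [evolution_eq hI hIc h₁ hx, evolution_eq hI hIc h₃ hx, hψ, calY, calY,
      hp _ (h₁.contDiffOn_covariants hI) x hx, hp _ (h₃.contDiffOn_covariants hI) x hx,
      hj l (le_max_right _ _), EquivariantFlow.along, EquivariantFlow.along,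
      hj F.order (le_max_left _ _)]
  · rintro g x P Z V ⟨γ, ψ, u, h, hx, rfl, rfl, rfl⟩
    exact ⟨_, _, u, h.uconj hI g, hx, rfl, curveJet_uconj hI h.contDiffOn_curve g _ hx,
      (evolution_uconj hI hIc h g hx).symm⟩

variable {F D}

/-- The term ad(e_x)⁻¹h^⊥ lies in 𝔪_⊥ and gives the normal part. As (1, 0) = √χ e_x, and e_x pairs
to -γ_x, the tangential coefficient is -χ⁻¹√χ times the primitive. -/
theorem evolution_decomposition (hI : IsOpen I) (hIc : I.OrdConnected)
    (h : IsParallelFrame I γ ψ u) {x : ℝ} (hx : x ∈ I) :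
    metric (-((chi m)⁻¹ • pairing (ψ x) (adInvH (F.along u x)))) (mderiv γ x) = 0 ∧
    evolution F D γ x = -((chi m)⁻¹ • pairing (ψ x) (adInvH (F.along u x)))
      + (-((chi m)⁻¹ * Real.sqrt (chi m)) * D.prim u x) • mderiv γ x := by
  have hus := h.isUnitSpeed hI
  have hT : mderiv γ x ∈ tangent (uconj ⟨ψ x, h.mem x hx⟩ (origin m)) := by
    have := hus.mderiv_mem_tangent hI hx
    rw [h.lift x hx] at this; exact this
  have hoff : origin m * adInvH (F.along u x) + adInvH (F.along u x) * origin m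
      = adInvH (F.along u x) := by
    rw [adInvH, mul_smul_comm, smul_mul_assoc, ← smul_add, mMat_offDiag]
  constructor
  · have h1 := pairing_mem_tangent (h.mem x hx) (star_adInvH (F.along u x))
    have h2 : metric (pairing (ψ x) (adInvH (F.along u x))) (mderiv γ x) = 0 := by
      rw [metric_eq_killing ⟨ψ x, h.mem x hx⟩ _ _ h1 hT]
      simp only
      rw [coframe_pairing (h.mem x hx) hoff, h.coframe_x x hx,
        killing_ex (by rw [star_neg, star_adInvH]), ← mParCLM_apply, map_neg, mParCLM_apply,
        mParCoeff_adInvH]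
      simp
    have h3 : ∀ (r : ℝ) (Z W : Mat m), metric (r • Z) W = r * metric Z W := fun r Z W => by
      have : (Matrix.trace (r • (Z * W))).re = r * (Matrix.trace (Z * W)).re := by
        rw [Matrix.trace_smul]; rfl
      rw [metric, metric, smul_mul_assoc, this]; ring
    rw [← neg_smul, h3, h2, mul_zero]
  · have h1 : pairing (ψ x) (mMat 1 0) = -(Real.sqrt (chi m) • mderiv γ x) := by
      have h2 := pairing_coframe ⟨ψ x, h.mem x hx⟩ (mderiv γ x) hT
      simp only at h2
      rw [h.coframe_x x hx] at h2
      rw [mMat_eq_smul_ex, ← h2, smul_neg, neg_neg]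
      simp only [pairing, Ring.lie_def, mul_smul_comm, smul_mul_assoc, smul_sub, mul_sub, sub_mul,
        smul_neg]
    have h2 : pairing (ψ x) (calY F D u x) = D.prim u x • pairing (ψ x) (mMat 1 0)
        - pairing (ψ x) (adInvH (F.along u x)) := by
      simp only [pairing, calY, Ring.lie_def, mul_smul_comm, smul_mul_assoc, smul_sub, mul_sub,
        sub_mul, smul_neg]
      abel
    rw [evolution_eq hI hIc h hx, h2, h1]
    module

end Invariance

end

end QuatCurve

namespace QuatCurve

noncomputable section

open Topology Filter

attribute [local instance] Matrix.linftyOpNormedRing Matrix.linftyOpNormedAlgebra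

/-! ### Slices and x-derivatives of jointly smooth functions -/

section PartialDerivatives

variable {E : Type*} [NormedAddCommGroup E] [NormedSpace ℝ E] {J I : Set ℝ}

theorem contDiffOn_slice {g : ℝ → ℝ → E}
    (hg : ContDiffOn ℝ ∞ (fun p : ℝ × ℝ => g p.1 p.2) (J ×ˢ I)) {t : ℝ} (ht : t ∈ J) :
    ContDiffOn ℝ ∞ (g t) I :=
  hg.comp (contDiffOn_const.prodMk contDiffOn_id) fun _ hx => ⟨ht, hx⟩

theorem contDiffOn_slice_fst {g : ℝ → ℝ → E}
    (hg : ContDiffOn ℝ ∞ (fun p : ℝ × ℝ => g p.1 p.2) (J ×ˢ I)) {x : ℝ} (hx : x ∈ I) :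
    ContDiffOn ℝ ∞ (fun t => g t x) J :=
  hg.comp (contDiffOn_id.prodMk contDiffOn_const) fun _ ht => ⟨ht, hx⟩

theorem contDiffOn_deriv_snd (hJ : IsOpen J) (hI : IsOpen I) {g : ℝ → ℝ → E}
    (hg : ContDiffOn ℝ ∞ (fun p : ℝ × ℝ => g p.1 p.2) (J ×ˢ I)) :
    ContDiffOn ℝ ∞ (fun p : ℝ × ℝ => deriv (g p.1) p.2) (J ×ˢ I) := by
  have hS : IsOpen (J ×ˢ I) := hJ.prod hI
  have h1 := (hg.fderiv_of_isOpen hS (m := ∞) le_rfl).clm_apply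
    (contDiffOn_const (c := ((0, 1) : ℝ × ℝ)))
  refine h1.congr fun p hp => ?_
  have h2 := ((hg.contDiffAt (hS.mem_nhds hp)).differentiableAt (by simp)).hasFDerivAt
  have h3 : HasDerivAt (fun y : ℝ => ((p.1, y) : ℝ × ℝ)) (0, 1) p.2 :=
    (hasDerivAt_const _ _).prodMk (hasDerivAt_id _)
  exact (h2.comp_hasDerivAt p.2 h3).deriv

theorem contDiffOn_iteratedDeriv_snd (hJ : IsOpen J) (hI : IsOpen I) {g : ℝ → ℝ → E}
    (hg : ContDiffOn ℝ ∞ (fun p : ℝ × ℝ => g p.1 p.2) (J ×ˢ I)) (n : ℕ) :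
    ContDiffOn ℝ ∞ (fun p : ℝ × ℝ => iteratedDeriv n (g p.1) p.2) (J ×ˢ I) := by
  induction n with
  | zero => simpa using hg
  | succ n ih =>
    simp only [iteratedDeriv_succ]
    exact contDiffOn_deriv_snd hJ hI (g := fun t => iteratedDeriv n (g t)) ih

end PartialDerivatives

/-! ### The subspace 𝔪_⊥ and the inverse of ad(e_x) on it -/

section PerpSpace

variable {m : ℕ}

theorem mat_lie_add (X Y Z : Mat m) : ⁅X, Y + Z⁆ = ⁅X, Y⁆ + ⁅X, Z⁆ := by
  simp only [Ring.lie_def]; noncomm_ring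

theorem mat_add_lie (X Y Z : Mat m) : ⁅X + Y, Z⁆ = ⁅X, Z⁆ + ⁅Y, Z⁆ := by
  simp only [Ring.lie_def]; noncomm_ring

theorem mat_lie_neg (X Y : Mat m) : ⁅X, -Y⁆ = -⁅X, Y⁆ := by
  simp only [Ring.lie_def]; noncomm_ring

theorem mat_lie_smul (r : ℝ) (X Y : Mat m) : ⁅X, r • Y⁆ = r • ⁅X, Y⁆ := by
  rw [Ring.lie_def, Ring.lie_def, mul_smul_comm, smul_mul_assoc, smul_sub]

/-- The subspace `𝔪_⊥`. -/
def perpSubmodule (m : ℕ) : Submodule ℝ (Mat m) where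
  carrier := {X | star X = -X ∧ origin m * X + X * origin m = X ∧ mParCoeff X = 0}
  add_mem' := by
    rintro X Y ⟨h1, h2, h3⟩ ⟨k1, k2, k3⟩
    refine ⟨by rw [star_add, h1, k1, neg_add], ?_, ?_⟩
    · conv_rhs => rw [← h2, ← k2]
      noncomm_ring
    · rw [← mParCLM_apply, map_add, mParCLM_apply, mParCLM_apply, h3, k3, add_zero]
  zero_mem' := ⟨by simp, by simp, rfl⟩
  smul_mem' := by
    rintro r X ⟨h1, h2, h3⟩
    refine ⟨by rw [star_smul, h1, smul_neg]; simp, ?_, ?_⟩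
    · rw [mul_smul_comm, smul_mul_assoc, ← smul_add, h2]
    · rw [← mParCLM_apply, map_smul, mParCLM_apply, h3, smul_zero]

theorem exists_mMat_of_mem_perpSubmodule {X : Mat m} (h : X ∈ perpSubmodule m) :
    ∃ (a : ImQuat) (b : Fin m → Quat), X = mMat (a : Quat) b := by
  obtain ⟨h1, h2, h3⟩ := h
  have hij : ∀ i j, star (X j i) = -X i j := fun i j => congrFun (congrFun h1 i) j
  have ho : ∀ i j, (if i = 0 then X 0 j else 0) + (if j = 0 then X i 0 else 0) = X i j :=
    fun i j => by
      rw [← origin_mul_apply, ← mul_origin_apply, ← Matrix.add_apply, h2]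
  refine ⟨⟨X 0 1, skewAdjoint.mem_iff.2 ?_⟩, fun l => X 0 l.succ.succ, ?_⟩
  · have h3' : (X 0 1).re = 0 := h3
    ext <;> simp [h3']
  · apply mat_ext
    · simpa using ho 0 0
    · simp
    · simp
    · rw [← neg_neg (X 1 0), ← hij]; simp
    · simpa using (ho 1 1).symm
    · intro l; simpa using (ho 1 l.succ.succ).symm
    · intro l; rw [← neg_neg (X l.succ.succ 0), ← hij]; simp
    · intro l; simpa using (ho l.succ.succ 1).symm
    · intro l k; simpa using (ho l.succ.succ k.succ.succ).symm

theorem ad_adInvM_of_mem {X : Mat m} (h : X ∈ perpSubmodule m) : ⁅ex m, adInvM X⁆ = X := by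
  obtain ⟨a, b, rfl⟩ := exists_mMat_of_mem_perpSubmodule h
  exact ad_adInvM a b

theorem exists_perpMat_of_mem {X : Mat m} (h : X ∈ perpSubmodule m) :
    ∃ v : Cov m, adInvM X = perpMat v := by
  obtain ⟨a, b, rfl⟩ := exists_mMat_of_mem_perpSubmodule h
  exact ⟨_, adInvM_mMat a b⟩

theorem adInvH_mem (v : Cov m) : adInvH v ∈ perpSubmodule m := by
  refine ⟨star_adInvH v, ?_, mParCoeff_adInvH v⟩
  rw [adInvH, mul_smul_comm, smul_mul_assoc, ← smul_add, mMat_offDiag]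

theorem star_lie_perpMat (v : Cov m) {X : Mat m} (h : star X = -X) :
    star ⁅perpMat v, X⁆ = -⁅perpMat v, X⁆ := by
  simp only [Ring.lie_def, star_sub, star_mul, star_perpMat, h]; noncomm_ring

theorem lie_perpMat_offDiag (v : Cov m) {X : Mat m} (h : origin m * X + X * origin m = X) :
    origin m * ⁅perpMat v, X⁆ + ⁅perpMat v, X⁆ * origin m = ⁅perpMat v, X⁆ := by
  have hd : origin m * perpMat v = perpMat v * origin m := perpMat_diag v
  have e : origin m * ⁅perpMat v, X⁆ + ⁅perpMat v, X⁆ * origin m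
      = (origin m * perpMat v) * X + perpMat v * (X * origin m)
        - (origin m * X * perpMat v + X * (perpMat v * origin m)) := by
    rw [Ring.lie_def]; noncomm_ring
  rw [e, hd, ← hd, ← mul_assoc X, ← add_mul, h, hd, mul_assoc, ← mul_add, h, Ring.lie_def]

theorem mPerp_mem {X : Mat m} (h : star X = -X) (ho : origin m * X + X * origin m = X) :
    mPerp X ∈ perpSubmodule m := by
  refine ⟨?_, ?_, ?_⟩
  · rw [mPerp, star_sub, h, star_smul, star_mMat, smul_neg]; simp; abel
  · rw [mPerp, mul_sub, sub_mul, mul_smul_comm, smul_mul_assoc]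
    have h1 : mParCoeff X • (mMat 1 0 : Mat m) = mParCoeff X • (origin m * mMat 1 0)
        + mParCoeff X • (mMat 1 0 * origin m) := by rw [← smul_add, mMat_offDiag]
    rw [h1, sub_add_sub_comm, ho]
  · rw [mPerp, ← mParCLM_apply, map_sub, map_smul, mParCLM_apply, mParCLM_apply]
    have : mParCoeff (mMat 1 0 : Mat m) = 1 := rfl
    rw [this]; simp

theorem lie_ex_parMat (w : ImQuat × UAlg m) : ⁅ex m, parMat w⁆ = 0 := by
  rw [Ring.lie_def, sub_eq_zero]
  exact (isoMat_ex _ _).symm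

end PerpSpace

/-! ### The zero-curvature equation and the reconstruction of the curve flow -/

section Flow

variable {m : ℕ} {I J : Set ℝ} {F : EquivariantFlow m I} {D : NonlocalTerm F}

theorem hasDerivAt_flowPerp (hI : IsOpen I) {u : ℝ → Cov m} (hu : ContDiffOn ℝ ∞ u I) {x : ℝ}
    (hx : x ∈ I) :
    HasDerivAt (flowPerp F u) ((chi m)⁻¹ • adInvH (deriv (F.along u) x)) x := by
  have h1 := (((F.contDiffOn_along hI hu).contDiffAt (hI.mem_nhds hx)).differentiableAt
    (by simp)).hasDerivAt
  exact ((LinearMap.toContinuousLinearMap (adInvHLin m)).hasFDerivAt.comp_hasDerivAt x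
    h1).const_smul (chi m)⁻¹

/-- This is the 𝔪_∥ component of the zero-curvature equation, built into the choice of primitive. -/
theorem hasDerivAt_flowPar {u : ℝ → Cov m} (hu : ContDiffOn ℝ ∞ u I) {x : ℝ}
    (hx : x ∈ I) : HasDerivAt (flowPar F D u)
      (-(mParCoeff ⁅perpMat (u x), flowPerp F u x⁆ • mMat 1 0)) x := by
  have h1 := (((D.hasDerivAt u hu x hx).const_mul (chi m)⁻¹).smul_const (mMat 1 0 : Mat m)).neg
  refine h1.congr_deriv ?_
  rw [flowPerp, mat_lie_smul, ← mParCLM_apply (_ • _), map_smul, smul_eq_mul, mParCLM_apply]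

theorem star_flowPar (u : ℝ → Cov m) (x : ℝ) : star (flowPar F D u x) = -flowPar F D u x := by
  rw [flowPar, star_neg, star_smul, star_mMat]; simp

theorem flowPar_offDiag (u : ℝ → Cov m) (x : ℝ) :
    origin m * flowPar F D u x + flowPar F D u x * origin m = flowPar F D u x := by
  rw [flowPar, mul_neg, neg_mul, ← neg_add, mul_smul_comm, smul_mul_assoc, ← smul_add,
    mMat_offDiag]

theorem flowPerp_mem (u : ℝ → Cov m) (x : ℝ) : flowPerp F u x ∈ perpSubmodule m :=
  (perpSubmodule m).smul_mem _ (adInvH_mem _)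

/-- `adInvM` inverts ad(e_x) only on 𝔪_⊥. No projection is needed for [u, h_∥], since bracketing 𝔥_⊥
with (1, 0) has no 𝔪_∥ part. -/
theorem connPerp_arg_mem (hI : IsOpen I) {u : ℝ → Cov m} (hu : ContDiffOn ℝ ∞ u I) {x : ℝ}
    (hx : x ∈ I) : mderiv (flowPerp F u) x + ⁅perpMat (u x), flowPar F D u x⁆
    + mPerp ⁅perpMat (u x), flowPerp F u x⁆ ∈ perpSubmodule m := by
  refine add_mem (add_mem ?_ ⟨?_, ?_, ?_⟩) (mPerp_mem ?_ ?_)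
  · rw [mderiv_of_hasDerivAt (hasDerivAt_flowPerp hI hu hx)]
    exact (perpSubmodule m).smul_mem _ (adInvH_mem _)
  · exact star_lie_perpMat _ (star_flowPar u x)
  · exact lie_perpMat_offDiag _ (flowPar_offDiag u x)
  · rw [flowPar, mat_lie_neg, mat_lie_smul, ← mParCLM_apply, map_neg, map_smul, mParCLM_apply,
      mParCoeff_lie_perpMat_mMat_one, smul_zero, neg_zero]
  · exact star_lie_perpMat _ (flowPerp_mem u x).1
  · exact lie_perpMat_offDiag _ (flowPerp_mem u x).2.1

theorem exists_connPerp_eq (hI : IsOpen I) {u : ℝ → Cov m} (hu : ContDiffOn ℝ ∞ u I) {x : ℝ}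
    (hx : x ∈ I) : ∃ v : Cov m, connPerp F D u x = perpMat v := by
  obtain ⟨v, hv⟩ := exists_perpMat_of_mem (connPerp_arg_mem (F := F) (D := D) hI hu hx)
  exact ⟨-v, by rw [connPerp, hv]; exact (map_neg (perpLin m) v).symm⟩

theorem lie_ex_connPerp (hI : IsOpen I) {u : ℝ → Cov m} (hu : ContDiffOn ℝ ∞ u I) {x : ℝ}
    (hx : x ∈ I) : ⁅ex m, connPerp F D u x⁆ = -(mderiv (flowPerp F u) x
      + ⁅perpMat (u x), flowPar F D u x⁆ + mPerp ⁅perpMat (u x), flowPerp F u x⁆) := by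
  rw [connPerp, mat_lie_neg, ad_adInvM_of_mem (connPerp_arg_mem hI hu hx)]

/-- The component of the Maurer-Cartan form in the flow direction. -/
def flowForm (F : EquivariantFlow m I) (D : NonlocalTerm F) (u : ℝ → Cov m)
    (w : ℝ → ImQuat × UAlg m) (x : ℝ) : Mat m :=
  (flowPerp F u x + flowPar F D u x) + (connPerp F D u x + parMat (w x))

variable {u : ℝ → ℝ → Cov m} {w : ℝ → ℝ → ImQuat × UAlg m}

theorem IsSolution.contDiffOn_u (h : IsSolution F D J u w) {t : ℝ} (ht : t ∈ J) :
    ContDiffOn ℝ ∞ (u t) I := contDiffOn_slice h.smooth_u ht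

theorem IsSolution.contDiffOn_flowPerp (h : IsSolution F D J u w) (hJ : IsOpen J)
    (hI : IsOpen I) :
    ContDiffOn ℝ ∞ (fun p : ℝ × ℝ => flowPerp F (u p.1) p.2) (J ×ˢ I) := by
  have h1 : ContDiffOn ℝ ∞ (fun p : ℝ × ℝ => F.along (u p.1) p.2) (J ×ˢ I) :=
    F.smooth.comp (contDiffOn_snd.prodMk (contDiffOn_pi.2 fun i =>
      contDiffOn_iteratedDeriv_snd hJ hI h.smooth_u i)) fun p hp => ⟨hp.2, mem_univ _⟩
  exact (contDiffOn_adInvH h1).const_smul _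

theorem IsSolution.contDiffOn_connPerp (h : IsSolution F D J u w) (hJ : IsOpen J)
    (hI : IsOpen I) :
    ContDiffOn ℝ ∞ (fun p : ℝ × ℝ => connPerp F D (u p.1) p.2) (J ×ˢ I) := by
  have hU := contDiffOn_perpMat_iff.2 h.smooth_u
  have h1 := h.contDiffOn_flowPerp hJ hI
  have h2 : ContDiffOn ℝ ∞ (fun p : ℝ × ℝ => flowPar F D (u p.1) p.2) (J ×ˢ I) :=
    ((contDiffOn_const.mul h.smooth_prim).smul contDiffOn_const).neg
  have h3 : ContDiffOn ℝ ∞ (fun p : ℝ × ℝ => mderiv (flowPerp F (u p.1)) p.2) (J ×ˢ I) := by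
    refine (contDiffOn_deriv_snd hJ hI (g := fun t => flowPerp F (u t)) h1).congr fun p hp => ?_
    exact ((hasDerivAt_mderiv hI (contDiffOn_slice (g := fun t => flowPerp F (u t)) h1 hp.1)
      hp.2).deriv).symm
  have hl : ∀ {X Y : ℝ × ℝ → Mat m}, ContDiffOn ℝ ∞ X (J ×ˢ I) → ContDiffOn ℝ ∞ Y (J ×ˢ I) →
      ContDiffOn ℝ ∞ (fun p => ⁅X p, Y p⁆) (J ×ˢ I) := fun hX hY => (hX.mul hY).sub (hY.mul hX)
  have h4 := hl hU h1
  have h5 : ContDiffOn ℝ ∞ (fun p : ℝ × ℝ => mPerp ⁅perpMat (u p.1 p.2), flowPerp F (u p.1) p.2⁆)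
      (J ×ˢ I) := h4.sub (((mParCLM m).contDiff.comp_contDiffOn h4).smul contDiffOn_const)
  exact ((LinearMap.toContinuousLinearMap (adInvMLin m)).contDiff.comp_contDiffOn
    ((h3.add (hl hU h2)).add h5)).neg

theorem IsSolution.contDiffOn_flowForm (h : IsSolution F D J u w) (hJ : IsOpen J)
    (hI : IsOpen I) :
    ContDiffOn ℝ ∞ (fun p : ℝ × ℝ => flowForm F D (u p.1) (w p.1) p.2) (J ×ˢ I) := by
  have h2 : ContDiffOn ℝ ∞ (fun p : ℝ × ℝ => flowPar F D (u p.1) p.2) (J ×ˢ I) :=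
    ((contDiffOn_const.mul h.smooth_prim).smul contDiffOn_const).neg
  exact ((h.contDiffOn_flowPerp hJ hI).add h2).add
    ((h.contDiffOn_connPerp hJ hI).add (msmoothOn_iff.1 h.smooth_w))

theorem IsSolution.star_flowForm (h : IsSolution F D J u w) (hI : IsOpen I) {t x : ℝ}
    (ht : t ∈ J) (hx : x ∈ I) :
    star (flowForm F D (u t) (w t) x) = -flowForm F D (u t) (w t) x := by
  obtain ⟨v, hv⟩ := exists_connPerp_eq (F := F) (D := D) hI (h.contDiffOn_u ht) hx
  rw [flowForm, hv]
  simp only [star_add, (flowPerp_mem (F := F) (u t) x).1, star_flowPar, star_perpMat, star_parMat,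
    neg_add]

/-- The zero-curvature equation. -/
theorem IsSolution.hasDerivAt_flowForm (h : IsSolution F D J u w) (hJ : IsOpen J) (hI : IsOpen I)
    {t x : ℝ} (ht : t ∈ J) (hx : x ∈ I) : ∃ Bx : Mat m,
      HasDerivAt (flowForm F D (u t) (w t)) Bx x ∧
      HasDerivAt (fun s => ex m + perpMat (u s x)) (Bx +
        ((ex m + perpMat (u t x)) * flowForm F D (u t) (w t) x
          - flowForm F D (u t) (w t) x * (ex m + perpMat (u t x)))) t := by
  have hu := h.contDiffOn_u ht
  have d1 := hasDerivAt_flowPerp (F := F) hI hu hx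
  rw [← mderiv_of_hasDerivAt d1] at d1
  have d2 := hasDerivAt_flowPar (D := D) hu hx
  have d3 := hasDerivAt_mderiv hI
    (contDiffOn_slice (g := fun t => connPerp F D (u t)) (h.contDiffOn_connPerp hJ hI) ht) hx
  have d4 := mhasDerivAt_iff.1 (h.eq_w t ht x hx)
  refine ⟨_, (d1.add d2).add (d3.add d4),
    ((mhasDerivAt_iff.1 (h.eq_u t ht x hx)).const_add _).congr_deriv ?_⟩
  -- The brackets of e_x with the four parts of B: h_⊥ produces the source term χ⁻¹h^⊥, ϖ^⊥ cancels
  -- the 𝔪_⊥ terms by its definition, and h_∥ and ϖ^∥ commute with e_x.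
  have c1 : ⁅ex m, flowPerp F (u t) x⁆ = (chi m)⁻¹ • perpMat (F.along (u t) x) := by
    rw [flowPerp, mat_lie_smul, ad_adInvH]
  have c2 : ⁅ex m, flowPar F D (u t) x⁆ = 0 := by
    rw [flowPar, mMat_eq_smul_ex, mat_lie_neg, mat_lie_smul, mat_lie_smul, Ring.lie_def, sub_self, smul_zero,
      smul_zero, neg_zero]
  have c3 := lie_ex_connPerp (F := F) (D := D) hI hu hx
  have c4 := lie_ex_parMat (w t x)
  rw [← Ring.lie_def, flowForm, mat_add_lie, mat_lie_add, mat_lie_add, mat_lie_add, mat_lie_add, mat_lie_add, mat_lie_add,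
    c1, c2, c3, c4, mPerp, hPerp]
  abel

/-- The t-equation is solved along the single line x = x₀, and its values serve as initial data for
the x-equation at each t. Flatness then propagates the t-equation off that line. Unitarity supplies
the uniform bounds, and smooth coefficients give joint smoothness. -/
theorem IsSolution.exists_frame (h : IsSolution F D J u w) (hJ : IsOpen J) (hJc : J.OrdConnected)
    (hI : IsOpen I) (hIc : I.OrdConnected) :
    ∃ ψ : ℝ → ℝ → Mat m, ContDiffOn ℝ ∞ (fun p : ℝ × ℝ => ψ p.1 p.2) (J ×ˢ I) ∧
      ∀ t ∈ J, ∀ x ∈ I, ψ t x ∈ UGroup m ∧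
        HasDerivAt (ψ t) (ψ t x * (ex m + perpMat (u t x))) x ∧
        HasDerivAt (fun s => ψ s x) (ψ t x * flowForm F D (u t) (w t) x) t := by
  rcases J.eq_empty_or_nonempty with rfl | ⟨t₀, ht₀⟩
  · exact ⟨fun _ _ => 0, contDiffOn_const, fun t ht => ht.elim⟩
  rcases I.eq_empty_or_nonempty with rfl | ⟨x₀, hx₀⟩
  · exact ⟨fun _ _ => 0, contDiffOn_const, fun t _ x hx => hx.elim⟩
  have hA : ContDiffOn ℝ ∞ (fun p : ℝ × ℝ => ex m + perpMat (u p.1 p.2)) (J ×ˢ I) :=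
    contDiffOn_const.add (contDiffOn_perpMat_iff.2 h.smooth_u)
  have hB := h.contDiffOn_flowForm hJ hI
  have hAs : ∀ t x, star (ex m + perpMat (u t x)) = -(ex m + perpMat (u t x)) := fun t x => by
    rw [star_add, star_ex, star_perpMat, neg_add]
  obtain ⟨ψ₀, h₀, hψ₀⟩ := exists_linear_ode hJ hJc (contDiffOn_slice_fst
    (g := fun t x => flowForm F D (u t) (w t) x) hB hx₀).continuousOn ht₀ 1
  have hψ₀m : ∀ t ∈ J, ψ₀ t ∈ UGroup m := fun t ht =>
    mem_unitary_of_linear_ode hJc hψ₀ (fun s hs => h.star_flowForm hI hs hx₀) ht₀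
      (by rw [h₀]; exact one_mem _) ht
  have hAt : ∀ t ∈ J, ContDiffOn ℝ ∞ (fun x => ex m + perpMat (u t x)) I := fun t ht =>
    contDiffOn_slice (g := fun t x => ex m + perpMat (u t x)) hA ht
  have hex : ∀ t, ∃ φ : ℝ → Mat m, t ∈ J → φ x₀ = ψ₀ t ∧
      ∀ x ∈ I, HasDerivAt φ (φ x * (ex m + perpMat (u t x))) x := fun t => by
    by_cases ht : t ∈ J
    · obtain ⟨φ, hφ⟩ := exists_linear_ode hI hIc (hAt t ht).continuousOn hx₀ (ψ₀ t)
      exact ⟨φ, fun _ => hφ⟩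
    · exact ⟨0, fun h => (ht h).elim⟩
  choose ψ hψ using hex
  have hm : ∀ t ∈ J, ∀ x ∈ I, ψ t x ∈ UGroup m := fun t ht x hx =>
    mem_unitary_of_linear_ode hIc (hψ t ht).2 (fun y _ => hAs t y) hx₀
      (by rw [(hψ t ht).1]; exact hψ₀m t ht) hx
  have hbase : ∀ t ∈ J, HasDerivAt (fun s => ψ s x₀)
      (ψ t x₀ * flowForm F D (u t) (w t) x₀) t := fun t ht => by
    rw [(hψ t ht).1]
    refine (hψ₀ t ht).congr_of_eventuallyEq ?_
    filter_upwards [hJ.mem_nhds ht] with s hs using (hψ s hs).1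
  have hx : ∀ t ∈ J, ∀ x ∈ I, HasDerivAt (ψ t) (ψ t x * (ex m + perpMat (u t x))) x :=
    fun t ht => (hψ t ht).2
  have ht : ∀ t ∈ J, ∀ x ∈ I, HasDerivAt (fun s => ψ s x)
      (ψ t x * flowForm F D (u t) (w t) x) t := fun t ht x hx' => by
    have hBx : ∀ t ∈ J, ∀ x ∈ I, HasDerivAt (flowForm F D (u t) (w t))
        (deriv (flowForm F D (u t) (w t)) x) x := fun t ht x hx => by
      obtain ⟨Bx, h1, -⟩ := h.hasDerivAt_flowForm hJ hI ht hx
      exact h1.differentiableAt.hasDerivAt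
    have hAd : ∀ t ∈ J, ∀ x ∈ I, HasDerivAt (fun s => ex m + perpMat (u s x))
        (deriv (flowForm F D (u t) (w t)) x + ((ex m + perpMat (u t x))
          * flowForm F D (u t) (w t) x
          - flowForm F D (u t) (w t) x * (ex m + perpMat (u t x)))) t := fun t ht x hx => by
      obtain ⟨Bx, h1, h2⟩ := h.hasDerivAt_flowForm hJ hI ht hx
      have e : deriv (flowForm F D (u t) (w t)) x = Bx := h1.deriv
      rwa [e]
    refine hasDerivAt_of_flat (A := fun t x => ex m + perpMat (u t x))
      (B := fun t => flowForm F D (u t) (w t)) (φ := fun t x => star (ψ t x)) (C := m + 2)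
      hJ hIc hx₀ (fun t ht => (hAt t ht).continuousOn) ?_ hAd hBx (fun _ _ _ _ => rfl) hx
      (fun t ht x hx' => ?_) (fun t ht x hx => (Unitary.mem_iff.1 (hm t ht x hx)).2)
      (fun t ht x hx => (Unitary.mem_iff.1 (hm t ht x hx)).1)
      (fun t ht x hx => norm_le_of_mem_unitary (hm t ht x hx))
      (fun t ht x hx => norm_le_of_mem_unitary (Unitary.star_mem (hm t ht x hx))) hbase ht hx'
    · exact ((contDiffOn_deriv_snd hJ hI (g := fun t => flowForm F D (u t) (w t)) hB).add
        ((hA.mul hB).sub (hB.mul hA))).continuousOn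
    · refine (hasDerivAt_star (hx t ht x hx')).congr_deriv ?_
      rw [star_mul, hAs, neg_mul]
  exact ⟨ψ, contDiffOn_of_partial (B := fun t => flowForm F D (u t) (w t)) hJ hI hA hB
    (fun t ht x hx => norm_le_of_mem_unitary (hm t ht x hx)) hx ht,
    fun t h1 x h2 => ⟨hm t h1 x h2, hx t h1 x h2, ht t h1 x h2⟩⟩

theorem IsSolution.exists_framedFlow (h : IsSolution F D J u w) (hJ : IsOpen J)
    (hJc : J.OrdConnected) (hI : IsOpen I) (hIc : I.OrdConnected) :
    ∃ γ ψ, IsFramedFlow F D J u w γ ψ := by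
  obtain ⟨ψ, hs, hψ⟩ := h.exists_frame hJ hJc hI hIc
  have hct : ∀ t ∈ J, ∀ x ∈ I,
      coframe (ψ t x) (mderiv (fun s => ψ s x * origin m * star (ψ s x)) t)
        = flowPerp F (u t) x + flowPar F D (u t) x ∧
      connection (ψ t x) (mderiv (fun s => ψ s x) t) = connPerp F D (u t) x + parMat (w t x) :=
    fun t ht x hx => by
    obtain ⟨v, hv⟩ := exists_connPerp_eq (F := F) (D := D) hI (h.contDiffOn_u ht) hx
    refine coframe_connection_of_hasDerivAt (ψ := fun s => ψ s x) (hψ t ht x hx).2.2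
      (by filter_upwards [hJ.mem_nhds ht] with s hs using (hψ s hs x hx).1)
      (Filter.Eventually.of_forall fun s => rfl) ?_ ?_
    · rw [mul_add, add_mul, add_add_add_comm, (flowPerp_mem (u t) x).2.1, flowPar_offDiag]
    · have hp : origin m * parMat (w t x) = parMat (w t x) * origin m := hMat_diag _ _ _ _
      have hq : origin m * perpMat v = perpMat v * origin m := perpMat_diag v
      rw [hv, mul_add, add_mul, hp, hq]
  exact ⟨fun t x => ψ t x * origin m * star (ψ t x), ψ,
    { smooth_curve := msmoothOn_iff.2 ((hs.mul contDiffOn_const).mul (contDiffOn_star hs))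
      smooth_frame := msmoothOn_iff.2 hs
      parallel := fun t ht => isParallelFrame_of_hasDerivAt hI (contDiffOn_slice hs ht)
        (fun x hx => (hψ t ht x hx).1) (fun _ _ => rfl) fun x hx => (hψ t ht x hx).2.1
      coframe_t := fun t ht x hx => (hct t ht x hx).1
      connection_t := fun t ht x hx => (hct t ht x hx).2 }⟩

variable {γ ψ : ℝ → ℝ → Mat m}

theorem IsFramedFlow.hasDerivAt_frame (h : IsFramedFlow F D J u w γ ψ) (hJ : IsOpen J) {t x : ℝ}
    (ht : t ∈ J) (hx : x ∈ I) :
    HasDerivAt (fun s => ψ s x) (ψ t x * flowForm F D (u t) (w t) x) t := by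
  have hd := hasDerivAt_mderiv hJ
    (contDiffOn_slice_fst (msmoothOn_iff.1 h.smooth_frame) hx) ht
  have e := coframe_add_connection hd
    (by filter_upwards [hJ.mem_nhds ht] with s hs using (h.parallel s hs).mem x hx)
    (γ := fun s => γ s x)
    (by filter_upwards [hJ.mem_nhds ht] with s hs using (h.parallel s hs).lift x hx)
  rw [h.coframe_t t ht x hx, h.connection_t t ht x hx] at e
  rw [← e] at hd
  exact hd

/-- The diagonal part ϖ of B commutes with o and does not move the curve. The remaining part h_⊥ +
h_∥ equals -χ⁻¹𝒴, which the frame turns into Y. -/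
theorem IsFramedFlow.hasDerivAt_curve (h : IsFramedFlow F D J u w γ ψ) (hJ : IsOpen J)
    (hI : IsOpen I) (hIc : I.OrdConnected) {t x : ℝ} (ht : t ∈ J) (hx : x ∈ I) :
    HasDerivAt (fun s => γ s x) (evolution F D (γ t) x) t := by
  have hp := h.parallel t ht
  refine (hasDerivAt_of_lift (h.hasDerivAt_frame hJ ht hx)
    (by filter_upwards [hJ.mem_nhds ht] with s hs using (h.parallel s hs).mem x hx)
    (by filter_upwards [hJ.mem_nhds ht] with s hs using (h.parallel s hs).lift x hx)).congr_deriv ?_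
  have h1 : star (ψ t x) * ψ t x = 1 := (Unitary.mem_iff.1 (hp.mem x hx)).1
  obtain ⟨v, hv⟩ := exists_connPerp_eq (F := F) (D := D) hI (hp.contDiffOn_covariants hI) hx
  have e1 : ⁅connPerp F D (u t) x + parMat (w t x), origin m⁆ = 0 := by
    have hp : origin m * parMat (w t x) = parMat (w t x) * origin m := hMat_diag _ _ _ _
    have hq : origin m * perpMat v = perpMat v * origin m := perpMat_diag v
    rw [hv, Ring.lie_def, mul_add, add_mul, hp, hq, sub_self]
  have e2 : flowPerp F (u t) x + flowPar F D (u t) x = -((chi m)⁻¹ • calY F D (u t) x) := by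
    rw [flowPerp, flowPar, calY, smul_sub, smul_smul, neg_sub, sub_eq_add_neg]
  rw [evolution_eq hI hIc hp hx, ← mul_assoc, h1, one_mul, flowForm, mat_add_lie, e1, add_zero, e2,
    pairing, smul_neg, ← neg_smul]
  simp only [Ring.lie_def, ← neg_smul, smul_mul_assoc, mul_smul_comm, ← smul_sub]

/-- Two framed flows with the same covariants differ by a fixed element of `U(n+1, ℍ)`. -/
theorem IsFramedFlow.exists_uconj (hJ : IsOpen J) (hJc : J.OrdConnected) (hI : IsOpen I)
    (hIc : I.OrdConnected) {γ' ψ' : ℝ → ℝ → Mat m} (hu : IsSolution F D J u w)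
    (h : IsFramedFlow F D J u w γ ψ)
    (h' : IsFramedFlow F D J u w γ' ψ') :
    ∃ g : UGroup m, ∀ t ∈ J, ∀ x ∈ I, γ' t x = uconj g (γ t x) := by
  rcases J.eq_empty_or_nonempty with rfl | ⟨t₀, ht₀⟩
  · exact ⟨1, fun t ht => ht.elim⟩
  rcases I.eq_empty_or_nonempty with rfl | ⟨x₀, hx₀⟩
  · exact ⟨1, fun t _ x hx => hx.elim⟩
  have key : ∀ {A ψ ψ' : ℝ → Mat m} {z : ℝ}, HasDerivAt ψ (ψ z * A z) z →
      HasDerivAt ψ' (ψ' z * A z) z → star (A z) = -A z →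
      HasDerivAt (fun y => ψ' y * star (ψ y)) 0 z := fun h1 h2 h3 => by
    refine (h2.mul (hasDerivAt_star h1)).congr_deriv ?_
    rw [star_mul, h3]; noncomm_ring
  -- Both frames solve the same skew-Hermitian linear equations, so the left quotient is constant,
  -- first in x and then in t along x₀.
  have hk : ∀ t ∈ J, ∀ x ∈ I, ψ' t x * star (ψ t x) = ψ' t₀ x₀ * star (ψ t₀ x₀) :=
    fun t ht x hx => by
    have e1 := eq_of_hasDerivAt_zero hIc (f := fun y => ψ' t y * star (ψ t y)) (fun y hy =>
      key (A := fun y => ex m + perpMat (u t y)) ((h.parallel t ht).hasDerivAt hI hy)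
        ((h'.parallel t ht).hasDerivAt hI hy)
        (by rw [star_add, star_ex, star_perpMat, neg_add])) hx hx₀
    have e2 := eq_of_hasDerivAt_zero hJc (f := fun s => ψ' s x₀ * star (ψ s x₀)) (fun s hs =>
      key (A := fun s => flowForm F D (u s) (w s) x₀) (h.hasDerivAt_frame hJ hs hx₀)
        (h'.hasDerivAt_frame hJ hs hx₀) (hu.star_flowForm hI hs hx₀)) ht ht₀
    exact e1.trans e2
  refine ⟨⟨ψ' t₀ x₀ * star (ψ t₀ x₀), mul_mem ((h'.parallel t₀ ht₀).mem x₀ hx₀)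
    (Unitary.star_mem ((h.parallel t₀ ht₀).mem x₀ hx₀))⟩, fun t ht x hx => ?_⟩
  have h1 : star (ψ t x) * ψ t x = 1 := (Unitary.mem_iff.1 ((h.parallel t ht).mem x hx)).1
  have h2 : ψ' t x = ψ' t₀ x₀ * star (ψ t₀ x₀) * ψ t x := by
    rw [← hk t ht x hx, mul_assoc, h1, mul_one]
  rw [uconj, (h'.parallel t ht).lift x hx, (h.parallel t ht).lift x hx, h2]
  simp only [star_mul, mul_assoc]

end Flow

end

end QuatCurve

/-! ### The proposition -/

theorem mainTheorem4 (m : ℕ) (I : Set ℝ) (hIo : IsOpen I) (hIc : I.OrdConnected)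
    (F : EquivariantFlow m I) (D : NonlocalTerm F) :
    ∃ Y : (ℝ → Mat m) → ℝ → Mat m,
      -- along every arclength-parametrised curve, `Y = χ⁻¹ ⟨e*, 𝒴(h^⊥)⟩` in every parallel frame,
      -- and the evolution vector `Y` is non-stretching
      (∀ γ, IsUnitSpeed I γ →
        (∃ ψ u, IsParallelFrame I γ ψ u) ∧
        (∀ ψ u, IsParallelFrame I γ ψ u → ∀ x ∈ I,
          Y γ x = (chi m)⁻¹ • pairing (ψ x) (calY F D u x)) ∧
        MSmoothOn (Y γ) I ∧
        (∀ x ∈ I, Y γ x ∈ tangent (γ x)) ∧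
        (∀ x ∈ I, metric (covDeriv γ (Y γ) x) (mderiv γ x) = 0)) ∧
      -- `U(n+1, ℍ)`-invariance of the evolution equation `γ_t = Y`
      (∀ (g : UGroup m) (γ : ℝ → Mat m), IsUnitSpeed I γ → ∀ x ∈ I,
        Y (fun y => uconj g (γ y)) x = uconj g (Y γ x)) ∧
      -- the normal part of `Y`, and the integrand of its tangential part, are invariant functions
      -- of `x, γ_x, ∇_x γ_x, ∇_x² γ_x, …`
      (∃ (N : ℝ → Mat m → (Fin (F.order + 1 + 1) → Mat m) → Mat m)
          (f : ℝ → Mat m → (Fin (F.order + 1 + 1) → Mat m) → ℝ),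
        (∀ (g : UGroup m) x P Z, N x (uconj g P) (fun i => uconj g (Z i)) = uconj g (N x P Z)) ∧
        (∀ (g : UGroup m) x P Z, f x (uconj g P) (fun i => uconj g (Z i)) = f x P Z) ∧
        ∀ γ, IsUnitSpeed I γ → ∃ c : ℝ → ℝ, ∀ x ∈ I,
          HasDerivAt c (f x (γ x) (curveJet (F.order + 1) γ x)) x ∧
          metric (N x (γ x) (curveJet (F.order + 1) γ x)) (mderiv γ x) = 0 ∧
          Y γ x = N x (γ x) (curveJet (F.order + 1) γ x) + c x • mderiv γ x) ∧
      -- if the nonlocal term is a differential function of `u`, then so is `Y` one of `γ`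
      (∀ (l : ℕ) (p : ℝ → (Fin (l + 1) → Cov m) → ℝ),
        (∀ u : ℝ → Cov m, ContDiffOn ℝ ∞ u I → ∀ x ∈ I, D.prim u x = p x (jet l u x)) →
        ∃ (k : ℕ) (G : ℝ → Mat m → (Fin (k + 1) → Mat m) → Mat m),
          (∀ (g : UGroup m) x P Z, G x (uconj g P) (fun i => uconj g (Z i)) = uconj g (G x P Z)) ∧
          ∀ γ, IsUnitSpeed I γ → ∀ x ∈ I, Y γ x = G x (γ x) (curveJet k γ x)) ∧
      -- every solution of the evolution of the covariants determines a non-stretching curve flow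
      -- with `γ_t = Y`, which is unique up to `U(n+1, ℍ)`
      (∀ (J : Set ℝ), IsOpen J → J.OrdConnected →
        ∀ (u : ℝ → ℝ → Cov m) (w : ℝ → ℝ → ImQuat × UAlg m), IsSolution F D J u w →
          (∃ γ ψ, IsFramedFlow F D J u w γ ψ) ∧
          (∀ γ ψ, IsFramedFlow F D J u w γ ψ → ∀ t ∈ J, IsUnitSpeed I (γ t) ∧
            ∀ x ∈ I, MHasDerivAt (fun s => γ s x) (Y (γ t) x) t) ∧
          (∀ γ ψ γ' ψ', IsFramedFlow F D J u w γ ψ → IsFramedFlow F D J u w γ' ψ' →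
            ∃ g : UGroup m, ∀ t ∈ J, ∀ x ∈ I, γ' t x = uconj g (γ t x))) := by
  refine ⟨evolution F D, fun γ hγ => ?_, fun g γ hγ x hx => ?_, ?_, fun l p hp => ?_,
    fun J hJ hJc u w hu => ⟨hu.exists_framedFlow hJ hJc hIo hIc, fun γ ψ h t ht =>
      ⟨(h.parallel t ht).isUnitSpeed hIo, fun x hx =>
        mhasDerivAt_iff.2 (h.hasDerivAt_curve hJ hIo hIc ht hx)⟩,
      fun γ ψ γ' ψ' h h' => h.exists_uconj hJ hJc hIo hIc hu h'⟩⟩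
  · obtain ⟨ψ, u, h⟩ := hγ.exists_parallelFrame hIo hIc
    exact ⟨⟨ψ, u, h⟩, fun ψ u h x hx => evolution_eq hIo hIc h hx,
      msmoothOn_iff.2 (evolution_contDiffOn hIo hIc h),
      fun x hx => evolution_mem_tangent hIo hIc h hx,
      fun x hx => metric_covDeriv_evolution hIo hIc hγ h hx⟩
  · obtain ⟨ψ, u, h⟩ := hγ.exists_parallelFrame hIo hIc
    exact evolution_uconj hIo hIc h g hx
  · obtain ⟨N, hN, hN'⟩ := exists_normal_part F hIo
    obtain ⟨f, hf, hf'⟩ := exists_integrand F hIo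
    refine ⟨N, f, hN, hf, fun γ hγ => ?_⟩
    obtain ⟨ψ, u, h⟩ := hγ.exists_parallelFrame hIo hIc
    -- The coefficient c is computed in one parallel frame. It is a constant multiple of the chosen
    -- primitive and so inherits its derivative.
    refine ⟨fun x => -((chi m)⁻¹ * Real.sqrt (chi m)) * D.prim u x, fun x hx => ?_⟩
    have hd := evolution_decomposition (D := D) hIo hIc h hx
    rw [hN' γ ψ u h x hx, hf' γ ψ u h x hx]
    exact ⟨(D.hasDerivAt u (h.contDiffOn_covariants hIo) x hx).const_mul _, hd⟩
  · obtain ⟨k, G, hG, hG'⟩ := exists_local_fn F D hIo hIc hp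
    refine ⟨k, G, hG, fun γ hγ x hx => ?_⟩
    obtain ⟨ψ, u, h⟩ := hγ.exists_parallelFrame hIo hIc
    exact hG' γ ψ u h x hx
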